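/- **Setting.** Let a quantum system have a finite-dimensional Hilbert space, Hamiltonian $H=H^\dagger$, jump operators $L_k$ ($k$ in a finite set) and feedback channels $\mathcal F_k$, each a unital completely positive trace-preserving map, applied right after a jump in channel $k$. Let $k\mapsto k^*$ be an involution of the channels such that local detailed balance $L_k=e^{\Delta s_k/2}L_{k^*}^\dagger$ holds with real numbers $\Delta s_k$. On $[0,\tau]$, $\tau>0$, let the density matrix $\varrho_t$ with initial value $\varrho_0$ solve $$\dot\varrho_t=-i[H,\varrho_t]+\sum_k\Big(\mathcal F_k[L_k\varrho_tL_k^\dagger]-\tfrac12\{L_k^\dagger L_k,\varrho_t\}\Big),$$ and assume that $\varrho_t$ has full rank for $0<t<\tau$. Write $r_k(t)=\operatorname{tr}(L_k\varrho_tL_k^\dagger)$ and $S(X)=-\operatorname{tr}(X\ln X)$. *Current.* For a step $h>0$ put $M_0=\mathbb 1-h\,(iH+\frac12\sum_kL_k^\dagger L_k)$, $M_k=\sqrt h\,L_k$, and $\mathcal F_0=\mathrm{id}$. Divide $[0,\tau]$ into $N$ steps of length $h=\tau/N$; a trajectory $\Gamma=(k_1,\dots,k_N)$ (with $k_i=0$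 for no jump) has weight $p_N(\Gamma)=\operatorname{tr}\,\mathcal F_{k_N}[M_{k_N}\cdots\mathcal F_{k_1}[M_{k_1}\varrho_0M_{k_1}^\dagger]\cdots M_{k_N}^\dagger]$. Let $c_k$ be real with $c_{k^*}=-c_k$, put $c_0=0$ and $J(\Gamma)=\sum_ic_{k_i}$. Define $\langle J^m\rangle=\lim_{N\to\infty}\sum_\Gamma J(\Gamma)^mp_N(\Gamma)$ and $\operatorname{Var}[J]=\langle J^2\rangle-\langle J\rangle^2$. *Thermodynamic quantities.* The dynamical activity is $A=\int_0^\tau\sum_kr_k(t)\,dt$, and $$\Sigma=S(\varrho_\tau)-S(\varrho_0)+\int_0^\tau\sum_k\Delta s_k\,r_k(t)\,dt-\int_0^\tau\dot I_t\,dt .$$ Here $\dot I_t=\lim_{h\to0^+}\big(I_{t,h}-I^-_{t,h}\big)/h$, where $I^-_{t,h}$ and $I_{t,h}$ are the Holevo informations $S(\sum_kp_k\omega_k)-\sum_kp_kS(\omega_k)$ of the ensembles formed by the conditional states $\omega_k$ of a measurement step of length $h$ on $\varrho_t$, before and after feedback: in both $p_k=\operatorname{tr}(M_k\varrho_tM_k^\dagger)$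 ($k\ge0$), with $\omega_k=M_k\varrho_tM_k^\dagger/p_k$ before feedback and $\omega_k=\mathcal F_k[M_k\varrho_tM_k^\dagger/p_k]$ after it. *Linear response.* Let $\ell_k(t)=\dfrac{r_k(t)-r_{k^*}(t)}{r_k(t)+r_{k^*}(t)}$ (with value $0$ if both rates vanish). For $|\theta|<1$ let $\varrho_{t,\theta}$ be the solution on $[0,\tau]$, with $\varrho_{0,\theta}=\varrho_0$, of the master equation with each $L_k$ replaced by $\sqrt{1+\ell_k(t)\theta}\,L_k$. Put $\varphi_t=\partial_\theta\varrho_{t,\theta}|_{\theta=0}$, $\langle J\rangle_\varphi=\int_0^\tau\sum_kc_k\operatorname{tr}(L_k\varphi_tL_k^\dagger)\,dt$ and $\delta_J=\langle J\rangle_\varphi/\langle J\rangle$. Finally let $\Phi$ be the inverse function of $x\mapsto x\tanh x$ on $[0,\infty)$. **Theorem.** The limits defining $\langle J\rangle$, $\langle J^2\rangle$ and (for $0<t<\tau$) $\dot I_t$ exist, $\dot I$ is integrable on $[0,\tau]$, $\varphi_t$ exists for every $t\in[0,\tau]$, and the integrand of $\langle J\rangle_\varphi$ is integrable. If $\langle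 J\rangle\neq0$, then $A>0$, $\Sigma>0$ and $$\frac{\operatorname{Var}[J]}{\langle J\rangle^2}\;\ge\;(1+\delta_J)^2\,\frac{4A}{\Sigma^2}\,\Phi\!\Big(\frac{\Sigma}{2A}\Big)^2\;\ge\;\frac{2(1+\delta_J)^2}{\Sigma}.$$ -/

import Mathlib

open Filter Topology Matrix
open scoped ComplexOrder

noncomputable section

/-- A linear map on matrices is completely positive if `id ⊗ F` preserves positive
semidefiniteness of block matrices, for every number `m` of blocks. -/
def IsCompletelyPositive {n : Type*} (F : Matrix n n ℂ →ₗ[ℂ] Matrix n n ℂ) : Prop :=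
  ∀ (m : ℕ) (X : Matrix (Fin m × n) (Fin m × n) ℂ), X.PosSemidef →
    (Matrix.of fun p q : Fin m × n =>
      F (Matrix.of fun a b => X (p.1, a) (q.1, b)) p.2 q.2).PosSemidef

/-- Completely positive, trace preserving and unital. -/
structure IsUnitalCPTP {n : Type*} [Fintype n] [DecidableEq n]
    (F : Matrix n n ℂ →ₗ[ℂ] Matrix n n ℂ) : Prop where
  completelyPositive : IsCompletelyPositive F
  tracePreserving : ∀ X, (F X).trace = X.trace
  unital : F 1 = 1

/-- Data of Markovian quantum-jump-feedback dynamics on the Hilbert space `ℂⁿ`, with jump channels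
labelled by a finite type `K`: Hamiltonian, jump operators, feedback channels, the pairing
`k ↦ k*` of each jump with its reverse, the environmental entropy changes `Δs k`, and the
initial density matrix. -/
structure FeedbackSystem (n K : Type*) [Fintype n] [DecidableEq n] where
  /-- Hamiltonian -/
  H : Matrix n n ℂ
  /-- jump operators -/
  L : K → Matrix n n ℂ
  /-- feedback channel applied right after a jump in channel `k` -/
  F : K → (Matrix n n ℂ →ₗ[ℂ] Matrix n n ℂ)
  /-- reversed jump channel -/
  rev : K → K
  /-- environmental entropy change of a jump -/
  Δs : K → ℝ
  /-- initial state -/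
  ρ₀ : Matrix n n ℂ
  isHermitian_H : H.IsHermitian
  isUnitalCPTP_F : ∀ k, IsUnitalCPTP (F k)
  rev_rev : ∀ k, rev (rev k) = k
  /-- local detailed balance -/
  localDetailedBalance : ∀ k, L k = (Real.exp (Δs k / 2) : ℂ) • (L (rev k))ᴴ
  posSemidef_ρ₀ : ρ₀.PosSemidef
  trace_ρ₀ : ρ₀.trace = 1

/-- Von Neumann entropy `-tr (X ln X)` of a positive semidefinite matrix. -/
def vonNeumannEntropy {n : Type*} [Fintype n] [DecidableEq n] (X : Matrix n n ℂ) : ℝ :=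
  -(X * cfc Real.log X).trace.re

/-- Holevo information `S (∑ p_k X_k) - ∑ p_k S (X_k)` of an ensemble: the mutual information
between the system and a classical memory holding `k`. -/
def holevoInformation {n : Type*} [Fintype n] [DecidableEq n] {ι : Type*} [Fintype ι]
    (p : ι → ℝ) (X : ι → Matrix n n ℂ) : ℝ :=
  vonNeumannEntropy (∑ k, (p k : ℂ) • X k) - ∑ k, p k * vonNeumannEntropy (X k)

/-- The inverse function of `x ↦ x tanh x` on `[0, ∞)`. -/
def Phi : ℝ → ℝ :=
  Function.invFunOn (fun x : ℝ => x * Real.tanh x) (Set.Ici 0)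

namespace FeedbackSystem

variable {n K : Type*} [Fintype n] [DecidableEq n] [Fintype K] (S : FeedbackSystem n K)

/-- The generator of the feedback master equation, with jump operators `L'`:
`-i[H, X] + ∑_k (F_k[L'_k X L'_k†] - ½ {L'_k† L'_k, X})`. -/
def generator (L' : K → Matrix n n ℂ) (X : Matrix n n ℂ) : Matrix n n ℂ :=
  -Complex.I • (S.H * X - X * S.H) +
    ∑ k, (S.F k (L' k * X * (L' k)ᴴ) -
      (1 / 2 : ℂ) • ((L' k)ᴴ * L' k * X + X * ((L' k)ᴴ * L' k)))

/-- `ρ` solves the feedback master equation on `[0, τ]` from the initial state. -/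
def IsEvolution (τ : ℝ) (ρ : ℝ → Matrix n n ℂ) : Prop :=
  ρ 0 = S.ρ₀ ∧
    ∀ t ∈ Set.Icc 0 τ, HasDerivWithinAt ρ (S.generator S.L (ρ t)) (Set.Icc 0 τ) t

/-- Jump rate `tr (L_k X L_k†)`. -/
def rate (X : Matrix n n ℂ) (k : K) : ℝ := (S.L k * X * (S.L k)ᴴ).trace.re

/-! ### The counting current along quantum-jump trajectories -/

/-- Kraus operators of a measurement step of duration `h`; `none` means that no jump occurs. -/
def kraus (h : ℝ) : Option K → Matrix n n ℂ
  | none => 1 - (h : ℂ) • (Complex.I • S.H + (1 / 2 : ℂ) • ∑ k, (S.L k)ᴴ * S.L k)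
  | some k => (Real.sqrt h : ℂ) • S.L k

/-- Feedback conditioned on the recorded outcome; no feedback without a jump. -/
def feedback : Option K → Matrix n n ℂ → Matrix n n ℂ
  | none => fun X => X
  | some k => fun X => S.F k X

/-- Unnormalised state after the outcomes in the list (earliest first), for time step `h`. -/
def trajectoryState (h : ℝ) (Γ : List (Option K)) : Matrix n n ℂ :=
  Γ.foldl (fun X k => S.feedback k (S.kraus h k * X * (S.kraus h k)ᴴ)) S.ρ₀

/-- Probability of the trajectory `Γ` when `[0, τ]` is divided into `N` steps. -/
def trajectoryProb (τ : ℝ) {N : ℕ} (Γ : Fin N → Option K) : ℝ :=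
  (S.trajectoryState (τ / N) (List.ofFn Γ)).trace.re

/-- The counting current `J(Γ) = ∑_i c_{k_i}`, where a step without a jump counts `0`. -/
def current (c : K → ℝ) {N : ℕ} (Γ : Fin N → Option K) : ℝ :=
  ∑ i, (Γ i).elim 0 c

/-- The `m`-th moment of the current when `[0, τ]` is divided into `N` steps. -/
def discreteMoment (c : K → ℝ) (τ : ℝ) (m N : ℕ) : ℝ :=
  ∑ Γ : Fin N → Option K, current c Γ ^ m * S.trajectoryProb τ Γ

/-- The `m`-th moment `⟨J^m⟩` of the current, in the continuous-time limit. -/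
def currentMoment (c : K → ℝ) (τ : ℝ) (m : ℕ) : ℝ :=
  limUnder atTop (S.discreteMoment c τ m)

/-- `⟨J⟩` -/
def meanCurrent (c : K → ℝ) (τ : ℝ) : ℝ := S.currentMoment c τ 1

/-- `Var[J] = ⟨J²⟩ - ⟨J⟩²` -/
def varCurrent (c : K → ℝ) (τ : ℝ) : ℝ := S.currentMoment c τ 2 - S.meanCurrent c τ ^ 2

/-! ### Thermodynamic quantities -/

/-- Probability of outcome `k` of a measurement step of duration `h` on the state `X`. -/
def outcomeProb (X : Matrix n n ℂ) (h : ℝ) (k : Option K) : ℝ :=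
  (S.kraus h k * X * (S.kraus h k)ᴴ).trace.re

/-- Normalised state after outcome `k`, before feedback. -/
def measuredState (X : Matrix n n ℂ) (h : ℝ) (k : Option K) : Matrix n n ℂ :=
  ((S.outcomeProb X h k)⁻¹ : ℂ) • (S.kraus h k * X * (S.kraus h k)ᴴ)

/-- Change, in the feedback step, of the mutual information between system and memory, for a
measurement of duration `h` on the state `X`. -/
def mutualInfoChange (X : Matrix n n ℂ) (h : ℝ) : ℝ :=
  holevoInformation (S.outcomeProb X h) (fun k => S.feedback k (S.measuredState X h k)) -
    holevoInformation (S.outcomeProb X h) (S.measuredState X h)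

/-- Rate of change of the mutual information in the continuous-time limit. -/
def mutualInfoRate (X : Matrix n n ℂ) : ℝ :=
  limUnder (𝓝[>] (0 : ℝ)) (fun h => S.mutualInfoChange X h / h)

/-- Dynamical activity `A`: the mean number of jumps. -/
def activity (τ : ℝ) (ρ : ℝ → Matrix n n ℂ) : ℝ :=
  ∫ t in (0 : ℝ)..τ, ∑ k, S.rate (ρ t) k

/-- Total entropy production: entropy change of the system plus that of the environment. -/
def totalEntropyProduction (τ : ℝ) (ρ : ℝ → Matrix n n ℂ) : ℝ :=
  (vonNeumannEntropy (ρ τ) - vonNeumannEntropy (ρ 0)) +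
    ∫ t in (0 : ℝ)..τ, ∑ k, S.Δs k * S.rate (ρ t) k

/-- `Σ`: total entropy production minus mutual-information change. -/
def entropyProduction (τ : ℝ) (ρ : ℝ → Matrix n n ℂ) : ℝ :=
  S.totalEntropyProduction τ ρ - ∫ t in (0 : ℝ)..τ, S.mutualInfoRate (ρ t)

/-! ### Perturbed dynamics and linear response -/

/-- Relative bias of a jump with respect to its reverse. If both rates vanish the value is `0`;
both jumps are then without effect on `X`. -/
def bias (X : Matrix n n ℂ) (k : K) : ℝ :=
  (S.rate X k - S.rate X (S.rev k)) / (S.rate X k + S.rate X (S.rev k))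

/-- `ρθ` solves on `[0, τ]` the master equation in which each jump operator `L_k` is replaced by
`√(1 + ℓ_k(t) θ) L_k`, with `ℓ_k(t)` the bias in the unperturbed state `ρ t`. -/
def IsPerturbedEvolution (τ : ℝ) (ρ : ℝ → Matrix n n ℂ) (θ : ℝ) (ρθ : ℝ → Matrix n n ℂ) : Prop :=
  ρθ 0 = S.ρ₀ ∧
    ∀ t ∈ Set.Icc 0 τ,
      HasDerivWithinAt ρθ
        (S.generator (fun k => (Real.sqrt (1 + S.bias (ρ t) k * θ) : ℂ) • S.L k) (ρθ t))
        (Set.Icc 0 τ) t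

/-- First-order response `φ_t` of the perturbed state: `ρ_{t,θ} = ρ_t + θ φ_t + o(θ)`. -/
def response (ρp : ℝ → ℝ → Matrix n n ℂ) (t : ℝ) : Matrix n n ℂ :=
  deriv (fun θ => ρp θ t) 0

/-- The correction `δ_J = ⟨J⟩_φ / ⟨J⟩`, `⟨J⟩_φ = ∫ ∑_k c_k tr (L_k φ_t L_k†) dt`. -/
def correction (c : K → ℝ) (τ : ℝ) (ρp : ℝ → ℝ → Matrix n n ℂ) : ℝ :=
  (∫ t in (0 : ℝ)..τ, ∑ k, c k * S.rate (response ρp t) k) / S.meanCurrent c τ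

end FeedbackSystem

end

/-! The bound is a Cramér–Rao inequality for the dynamics perturbed by `θ`, followed by a
thermodynamic bound on the Fisher information `I = ∫ ∑ ℓ_k² r_k`. No path measure is used:
everything is carried by matrix differential equations.

Variance. The state-valued moments of the current obey an exact linear recursion whose limit is a
linear flow (`stateMoments_eq`, `tendsto_euler`). Let the Hermitian matrix `N_t` solve the backward
equation with source the current and `N_τ = 0`; it is the observable of the current still to come. A
jump in channel `k` produces the defect `D_k = (c_k + F_k†(N)) L_k - L_k N`, with `F_k†` the trace
adjoint. Kadison's inequality for `F_k†` gives `Var[J] ≥ ∫ ∑ tr (D_k ρ D_k†)` (`sum_defect_le`,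
`integral_defect_le`).

Response. Since `c` is odd under `k ↦ k*`, weighting the channels by their biases leaves the mean
current unchanged (`sum_mul_rate_eq`), and duality between `N` and the response `φ` gives `⟨J⟩ +
⟨J⟩_φ = ∫ ∑ ℓ_k Re tr (D_k ρ L_k†)`. Cauchy–Schwarz, kept as an inequality quadratic in a free
parameter, yields `((1 + δ_J) ⟨J⟩)² ≤ I Var[J]` (`two_mul_response_sub_le_varCurrent`).

Thermodynamics. In `Σ` the feedback part of the entropy change cancels against the information rate.
Klein's inequality in each channel, with a scale fixed by local detailed balance, and the fact that
unital feedback cannot lower entropy bound the rate of `Σ` below by `∑ r_k log (r_k / r_{k*})`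
(`sum_rate_mul_log_le`). Because `ℓ_k = tanh (½ log (r_k / r_{k*}))`, this controls `I`: the curve
`(x tanh x, tanh² x)` is concave, and its tangent at `x₀ = Φ(Σ / 2A)` gives `I ≤ A tanh² x₀ = Σ² /
(4 A x₀²)`. The tangent replaces Jensen's inequality, both over channels and over time. The weaker
final bound is `Φ(s)² ≥ s`.

The state may lose rank at the end points, where `log ρ_t` can blow up. Integrability is rescued by
`‖log ρ‖ ≤ -log det ρ` and analyticity of `t ↦ det ρ_t`. -/

/-! ### Scalar inequalities for `tanh` and the function `Φ`. -/

theorem Real.hasDerivAt_tanh_cosh (x : ℝ) :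
    HasDerivAt Real.tanh (1 / Real.cosh x ^ 2) x := by
  have h := (Real.hasDerivAt_sinh x).div (Real.hasDerivAt_cosh x) (Real.cosh_pos x).ne'
  have e : Real.tanh = fun y => Real.sinh y / Real.cosh y := by
    funext y; exact Real.tanh_eq_sinh_div_cosh y
  rw [e]
  refine h.congr_deriv ?_
  congr 1
  nlinarith [Real.cosh_sq x]

theorem Real.continuous_tanh' : Continuous Real.tanh :=
  continuous_iff_continuousAt.2 fun x => (Real.hasDerivAt_tanh_cosh x).continuousAt

theorem Real.tanh_nonneg_of_nonneg {x : ℝ} (hx : 0 ≤ x) : 0 ≤ Real.tanh x := by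
  rw [Real.tanh_eq_sinh_div_cosh]
  exact div_nonneg (Real.sinh_nonneg_iff.2 hx) (Real.cosh_pos x).le

theorem Real.tanh_le_self_of_nonneg {x : ℝ} (hx : 0 ≤ x) : Real.tanh x ≤ x := by
  have h : MonotoneOn (fun y => y - Real.tanh y) (Set.Ici 0) := by
    refine monotoneOn_of_hasDerivWithinAt_nonneg (f' := fun y => 1 - 1 / Real.cosh y ^ 2)
      (convex_Ici 0) (by have := Real.continuous_tanh'; fun_prop) (fun y _ => ?_) (fun y _ => ?_)
    · exact ((hasDerivAt_id y).sub (Real.hasDerivAt_tanh_cosh y)).hasDerivWithinAt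
    · have := Real.one_le_cosh y
      rw [sub_nonneg, div_le_one (by positivity)]
      nlinarith
  have := h (Set.mem_Ici.2 le_rfl) (Set.mem_Ici.2 hx) hx
  simp only [Real.tanh_zero, sub_zero] at this
  linarith

theorem Real.tanh_sq_le_mul_tanh (x : ℝ) : Real.tanh x ^ 2 ≤ x * Real.tanh x := by
  wlog hx : 0 ≤ x generalizing x
  · have := this (-x) (by linarith)
    simpa [Real.tanh_neg] using this
  · rw [pow_two]
    exact mul_le_mul_of_nonneg_right (tanh_le_self_of_nonneg hx) (tanh_nonneg_of_nonneg hx)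

/-- Surjectivity onto `[0, ∞)` is what makes `Function.invFunOn` a right inverse, the property of
`Phi` on which the estimates rest. -/
theorem exists_mul_tanh_eq {s : ℝ} (hs : 0 ≤ s) : ∃ x ∈ Set.Ici (0 : ℝ), x * Real.tanh x = s := by
  have hc : ContinuousOn (fun x : ℝ => x * Real.tanh x) (Set.Icc 0 (s + 1)) :=
    (continuous_id.mul Real.continuous_tanh').continuousOn
  -- After clearing denominators this reads `2 s + 1 ≤ exp (2 (s + 1))`, so `s + 1` is far enough to
  -- the right for the intermediate value theorem.
  have hend : s ≤ (s + 1) * Real.tanh (s + 1) := by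
    rw [Real.tanh_eq_sinh_div_cosh, mul_div_assoc', le_div_iff₀ (Real.cosh_pos _),
      Real.cosh_eq, Real.sinh_eq]
    have h1 : 2 * (s + 1) + 1 ≤ Real.exp (2 * (s + 1)) := Real.add_one_le_exp _
    have h2 : Real.exp (2 * (s + 1)) * Real.exp (-(s + 1)) = Real.exp (s + 1) := by
      rw [← Real.exp_add]; congr 1; ring
    have h3 := mul_le_mul_of_nonneg_right h1 (Real.exp_pos (-(s + 1))).le
    rw [h2] at h3
    nlinarith [Real.exp_pos (-(s + 1))]
  obtain ⟨x, hx, hxs⟩ := intermediate_value_Icc (by linarith : (0 : ℝ) ≤ s + 1) hc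
    ⟨by simpa using hs, hend⟩
  exact ⟨x, hx.1, hxs⟩

theorem Phi_nonneg {s : ℝ} (hs : 0 ≤ s) : 0 ≤ Phi s :=
  Function.invFunOn_mem (exists_mul_tanh_eq hs)

theorem Phi_mul_tanh_Phi {s : ℝ} (hs : 0 ≤ s) : Phi s * Real.tanh (Phi s) = s :=
  Function.invFunOn_eq (exists_mul_tanh_eq hs)

theorem Phi_pos {s : ℝ} (hs : 0 < s) : 0 < Phi s := by
  rcases (Phi_nonneg hs.le).lt_or_eq with h | h
  · exact h
  · have := Phi_mul_tanh_Phi hs.le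
    rw [← h] at this
    simp at this
    exact absurd this hs.ne

theorem le_Phi_sq {s : ℝ} (hs : 0 ≤ s) : s ≤ Phi s ^ 2 := by
  conv_lhs => rw [← Phi_mul_tanh_Phi hs]
  rw [pow_two]
  exact mul_le_mul_of_nonneg_left (Real.tanh_le_self_of_nonneg (Phi_nonneg hs)) (Phi_nonneg hs)

/-- The numerator of the derivative of `x coth x` is `sinh x cosh x - x`. Monotonicity is needed for
the concavity of the curve `(x tanh x, tanh² x)`. -/
theorem monotoneOn_mul_cosh_div_sinh :
    MonotoneOn (fun x : ℝ => x * Real.cosh x / Real.sinh x) (Set.Ioi 0) := by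
  have hd : ∀ x : ℝ, 0 < x → HasDerivAt (fun x : ℝ => x * Real.cosh x / Real.sinh x)
      (((1 * Real.cosh x + x * Real.sinh x) * Real.sinh x - x * Real.cosh x * Real.cosh x) /
        Real.sinh x ^ 2) x := fun x hx =>
    ((hasDerivAt_id x).mul (Real.hasDerivAt_cosh x)).div (Real.hasDerivAt_sinh x)
      (Real.sinh_pos_iff.2 hx).ne'
  refine monotoneOn_of_hasDerivWithinAt_nonneg (convex_Ioi 0)
    (fun x hx => (hd x hx).continuousAt.continuousWithinAt)
    (fun x hx => (hd x (by simpa using hx)).hasDerivWithinAt) (fun x hx => ?_)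
  rw [interior_Ioi] at hx
  have hx : 0 < x := hx
  refine div_nonneg ?_ (sq_nonneg _)
  have h1 : x ≤ Real.sinh x := Real.self_le_sinh_iff.2 hx.le
  have h2 := Real.one_le_cosh x
  nlinarith [Real.cosh_sq x, mul_nonneg (sub_nonneg.2 h1) (sub_nonneg.2 h2)]

/-- The tangent of the curve `(x tanh x, tanh² x)` lies above the curve. -/
theorem exists_tanh_sq_le_tangent {x₀ : ℝ} (hx₀ : 0 < x₀) :
    ∃ m : ℝ, 0 ≤ m ∧ ∀ x : ℝ,
      Real.tanh x ^ 2 ≤ Real.tanh x₀ ^ 2 + m * (x * Real.tanh x - x₀ * Real.tanh x₀) := by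
  -- The derivatives of `tanh² x` and `x tanh x` are `tanh x / cosh² x` times `2` and `w x`. The
  -- slope of the curve is therefore `2 / w`, which decreases because `w` increases; the function
  -- `k` below then has its minimum at `x₀`.
  set w : ℝ → ℝ := fun x => Real.cosh x ^ 2 + x * Real.cosh x / Real.sinh x with hw
  have hwpos : ∀ x, 0 < x → 0 < w x := fun x hx => by
    have := Real.sinh_pos_iff.2 hx
    have := Real.cosh_pos x
    simp only [hw]; positivity
  have hwmono : ∀ x y, 0 < x → x ≤ y → w x ≤ w y := fun x y hx hxy => by
    have h1 := monotoneOn_mul_cosh_div_sinh (Set.mem_Ioi.2 hx) (Set.mem_Ioi.2 (hx.trans_le hxy)) hxy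
    have h2 : Real.cosh x ≤ Real.cosh y := by
      rw [Real.cosh_le_cosh, abs_of_pos hx, abs_of_pos (hx.trans_le hxy)]; exact hxy
    have := Real.cosh_pos x
    simp only [hw]
    gcongr
  set m := 2 / w x₀ with hm
  have hm0 : 0 < m := div_pos two_pos (hwpos x₀ hx₀)
  set k : ℝ → ℝ := fun x => m * (x * Real.tanh x) - Real.tanh x ^ 2 with hk
  have hkd : ∀ x, 0 < x → HasDerivAt k (Real.tanh x / Real.cosh x ^ 2 * (m * w x - 2)) x := by
    intro x hx
    have h := (((hasDerivAt_id x).mul (Real.hasDerivAt_tanh_cosh x)).const_mul m).sub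
      ((Real.hasDerivAt_tanh_cosh x).pow 2)
    refine h.congr_deriv ?_
    have h1 := (Real.sinh_pos_iff.2 hx).ne'
    have h2 := (Real.cosh_pos x).ne'
    simp only [id, hw, Real.tanh_eq_sinh_div_cosh]
    norm_num
    field_simp
  have hkc : Continuous k := by
    have := Real.continuous_tanh'
    simp only [hk]; fun_prop
  have hmw : m * w x₀ = 2 := div_mul_cancel₀ _ (hwpos x₀ hx₀).ne'
  have hfac : ∀ x, 0 < x → 0 ≤ Real.tanh x / Real.cosh x ^ 2 := fun x hx =>
    div_nonneg (Real.tanh_nonneg_of_nonneg hx.le) (sq_nonneg _)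
  have hanti : AntitoneOn k (Set.Icc 0 x₀) := by
    refine antitoneOn_of_hasDerivWithinAt_nonpos (convex_Icc 0 x₀) hkc.continuousOn
      (f' := fun x => Real.tanh x / Real.cosh x ^ 2 * (m * w x - 2)) ?_ ?_
    all_goals
      intro x hx
      rw [interior_Icc] at hx
    · exact (hkd x hx.1).hasDerivWithinAt
    · refine mul_nonpos_of_nonneg_of_nonpos (hfac x hx.1) ?_
      have := mul_le_mul_of_nonneg_left (hwmono x x₀ hx.1 hx.2.le) hm0.le
      linarith
  have hmono : MonotoneOn k (Set.Ici x₀) := by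
    refine monotoneOn_of_hasDerivWithinAt_nonneg (convex_Ici x₀) hkc.continuousOn
      (f' := fun x => Real.tanh x / Real.cosh x ^ 2 * (m * w x - 2)) ?_ ?_
    all_goals
      intro x hx
      rw [interior_Ici] at hx
      have hx' : x₀ < x := hx
    · exact (hkd x (hx₀.trans hx')).hasDerivWithinAt
    · refine mul_nonneg (hfac x (hx₀.trans hx')) ?_
      have := mul_le_mul_of_nonneg_left (hwmono x₀ x hx₀ hx'.le) hm0.le
      linarith
  have hmin : ∀ x, 0 ≤ x → k x₀ ≤ k x := fun x hx => by
    rcases le_total x x₀ with h | h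
    · exact hanti ⟨hx, h⟩ ⟨hx₀.le, le_rfl⟩ h
    · exact hmono (Set.mem_Ici.2 le_rfl) h h
  refine ⟨m, hm0.le, fun x => ?_⟩
  have h1 := hmin |x| (abs_nonneg x)
  have h2 : k |x| = k x := by
    rcases abs_choice x with h | h <;> rw [h]
    simp [hk, Real.tanh_neg]
  rw [h2] at h1
  simp only [hk] at h1
  linarith

/-- This is `artanh y = ½ log ((1 + y) / (1 - y))` at `y = (r - s) / (r + s)`: the bias of a channel
is the `tanh` of half its log ratio. -/
theorem tanh_half_log_div {r s : ℝ} (hr : 0 < r) (hs : 0 < s) :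
    Real.tanh (1 / 2 * Real.log (r / s)) = (r - s) / (r + s) := by
  have hrs : 0 < r + s := add_pos hr hs
  have h1 : -1 < (r - s) / (r + s) := by rw [lt_div_iff₀ hrs]; linarith
  have h2 : (r - s) / (r + s) < 1 := by rw [div_lt_one hrs]; linarith
  have h3 := Real.artanh_eq_half_log (x := (r - s) / (r + s)) ⟨h1.le, h2.le⟩
  have h4 : (1 + (r - s) / (r + s)) / (1 - (r - s) / (r + s)) = r / s := by
    have : 1 - (r - s) / (r + s) = 2 * s / (r + s) := by field_simp; ring
    rw [this]
    field_simp
    ring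
  rw [h4] at h3
  rw [← h3, Real.tanh_artanh ⟨h1, h2⟩]

theorem sq_div_add_le_mul_log {r s : ℝ} (hr : 0 < r) (hs : 0 < s) :
    (r - s) ^ 2 / (r + s) ≤ 1 / 2 * ((r - s) * Real.log (r / s)) := by
  have h := Real.tanh_sq_le_mul_tanh (1 / 2 * Real.log (r / s))
  rw [tanh_half_log_div hr hs] at h
  have hrs : 0 < r + s := add_pos hr hs
  have h2 := mul_le_mul_of_nonneg_left h hrs.le
  calc _ = (r + s) * ((r - s) / (r + s)) ^ 2 := by field_simp
    _ ≤ _ := h2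
    _ = _ := by field_simp

/-- The tangent inequality at `½ log (r / s)`, multiplied by `r + s`. The right side is linear in `r
+ s` and `(r - s) log (r / s)`, so it can be summed over channels and integrated over time. -/
theorem exists_sq_div_add_le_tangent {x₀ : ℝ} (hx₀ : 0 < x₀) :
    ∃ m : ℝ, 0 ≤ m ∧ ∀ r s : ℝ, 0 < r → 0 < s → (r - s) ^ 2 / (r + s) ≤
      (r + s) * Real.tanh x₀ ^ 2 +
        m * (1 / 2 * ((r - s) * Real.log (r / s)) - x₀ * Real.tanh x₀ * (r + s)) := by
  obtain ⟨m, hm, h⟩ := exists_tanh_sq_le_tangent hx₀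
  refine ⟨m, hm, fun r s hr hs => ?_⟩
  have h := h (1 / 2 * Real.log (r / s))
  rw [tanh_half_log_div hr hs] at h
  have hrs : 0 < r + s := add_pos hr hs
  have h2 := mul_le_mul_of_nonneg_left h hrs.le
  calc _ = (r + s) * ((r - s) / (r + s)) ^ 2 := by field_simp
    _ ≤ _ := h2
    _ = _ := by field_simp

noncomputable section

open scoped Matrix.Norms.L2Operator

/-! ### Positive maps, Klein's and Kadison's inequalities, von Neumann entropy. -/

section Positivity

variable {n : Type*} [Fintype n] [DecidableEq n]

theorem Matrix.PosSemidef.trace_mul_nonneg {X Y : Matrix n n ℂ} (hX : X.PosSemidef)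
    (hY : Y.PosSemidef) : 0 ≤ (X * Y).trace := by
  obtain ⟨B, rfl⟩ : ∃ B : Matrix n n ℂ, Y = Bᴴ * B := by
    open scoped MatrixOrder in
    obtain ⟨B, hB⟩ := CStarAlgebra.nonneg_iff_eq_star_mul_self.1 hY.nonneg
    exact ⟨B, hB⟩
  rw [← Matrix.mul_assoc, Matrix.trace_mul_comm, ← Matrix.mul_assoc]
  exact (hX.mul_mul_conjTranspose_same B).trace_nonneg

/-- A linear map on matrices preserving positive semidefiniteness. -/
def IsPositiveMap (F : Matrix n n ℂ →ₗ[ℂ] Matrix n n ℂ) : Prop :=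
  ∀ X : Matrix n n ℂ, X.PosSemidef → (F X).PosSemidef

theorem IsCompletelyPositive.isPositiveMap {F : Matrix n n ℂ →ₗ[ℂ] Matrix n n ℂ}
    (hF : IsCompletelyPositive F) : IsPositiveMap F := by
  intro X hX
  have h := hF 1 (X.submatrix Prod.snd Prod.snd) (hX.submatrix _)
  have h2 := h.submatrix (fun i : n => ((0 : Fin 1), i))
  exact h2

theorem isPositiveMap_id : IsPositiveMap (LinearMap.id : Matrix n n ℂ →ₗ[ℂ] Matrix n n ℂ) :=
  fun _ h => h

/-- The map `X ↦ L X L†`. -/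
def conjMap (L : Matrix n n ℂ) : Matrix n n ℂ →ₗ[ℂ] Matrix n n ℂ :=
  LinearMap.mulLeft ℂ L ∘ₗ LinearMap.mulRight ℂ Lᴴ

theorem conjMap_apply (L X : Matrix n n ℂ) : conjMap L X = L * X * Lᴴ := by
  simp [conjMap, Matrix.mul_assoc]

theorem isPositiveMap_conjMap (L : Matrix n n ℂ) : IsPositiveMap (conjMap L) := fun X hX => by
  rw [conjMap_apply]; exact hX.mul_mul_conjTranspose_same L

/-- The `P i` are the rank-one eigenprojections. One family serves all functions `f`, so traces of
several functions of `A` can be compared eigenvalue by eigenvalue. -/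
theorem Matrix.IsHermitian.exists_spectral {A : Matrix n n ℂ} (hA : A.IsHermitian) :
    ∃ P : n → Matrix n n ℂ, (∀ i, (P i).PosSemidef) ∧
      ∀ f : ℝ → ℝ, cfc f A = ∑ i, (f (hA.eigenvalues i) : ℂ) • P i := by
  set U : Matrix n n ℂ := (hA.eigenvectorUnitary : Matrix n n ℂ) with hU
  refine ⟨fun i => U * Matrix.diagonal (Pi.single i 1) * Uᴴ, fun i => ?_, fun f => ?_⟩
  · refine Matrix.PosSemidef.mul_mul_conjTranspose_same (Matrix.PosSemidef.diagonal ?_) U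
    intro j
    by_cases h : j = i
    · subst h; simp
    · simp [h]
  · rw [hA.cfc_eq, Matrix.IsHermitian.cfc, Unitary.conjStarAlgAut_apply]
    have : (Matrix.diagonal (RCLike.ofReal ∘ f ∘ hA.eigenvalues) : Matrix n n ℂ) =
        ∑ i, (f (hA.eigenvalues i) : ℂ) • Matrix.diagonal (Pi.single i 1) := by
      ext a b
      simp only [Matrix.sum_apply, Matrix.smul_apply, Matrix.diagonal_apply, Function.comp_apply]
      by_cases h : a = b
      · subst h
        simp [Pi.single_apply]
      · simp [h]
    rw [this, Finset.mul_sum, Finset.sum_mul]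
    simp [hU, Matrix.star_eq_conjTranspose]

theorem Matrix.IsHermitian.cfc_mul_cfc {A : Matrix n n ℂ} (hA : A.IsHermitian) (f g : ℝ → ℝ) :
    cfc f A * cfc g A = cfc (fun x => f x * g x) A :=
  (cfc_mul f g A (Matrix.finite_real_spectrum.continuousOn f)
    (Matrix.finite_real_spectrum.continuousOn g)).symm

theorem Matrix.IsHermitian.cfc_self {A : Matrix n n ℂ} (hA : A.IsHermitian) :
    cfc (fun x : ℝ => x) A = A := cfc_id' ℝ A hA

theorem Matrix.IsHermitian.cfc_one' {A : Matrix n n ℂ} (hA : A.IsHermitian) :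
    cfc (fun _ : ℝ => (1 : ℝ)) A = 1 := by
  have := cfc_const_one ℝ A hA
  exact this

/-- A Hermitian matrix is a real combination of positive semidefinite ones, so its image is
Hermitian; `Z + Z†` and `i (Z - Z†)` reduce the general case to this. -/
theorem IsPositiveMap.map_conjTranspose {F : Matrix n n ℂ →ₗ[ℂ] Matrix n n ℂ}
    (hF : IsPositiveMap F) (Z : Matrix n n ℂ) : F Zᴴ = (F Z)ᴴ := by
  have key : ∀ A : Matrix n n ℂ, A.IsHermitian → (F A)ᴴ = F A := by
    intro A hA
    obtain ⟨P, hP, hf⟩ := hA.exists_spectral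
    rw [← hA.cfc_self, hf, map_sum, Matrix.conjTranspose_sum]
    refine Finset.sum_congr rfl fun i _ => ?_
    rw [map_smul, Matrix.conjTranspose_smul, (hF _ (hP i)).1]
    simp
  have h1 := key (Z + Zᴴ) (by rw [Matrix.IsHermitian]; simp [add_comm])
  have h2 := key (Complex.I • (Z - Zᴴ)) (by
    rw [Matrix.IsHermitian, Matrix.conjTranspose_smul]
    simp [← smul_neg])
  simp only [map_add, map_smul, map_sub, Matrix.conjTranspose_add, Matrix.conjTranspose_smul,
    Matrix.conjTranspose_sub, Complex.star_def, Complex.conj_I] at h1 h2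
  have h3 : (F Z)ᴴ - (F Zᴴ)ᴴ = -(F Z - F Zᴴ) := by
    have := congrArg (fun M => Complex.I • M) h2
    simp only [smul_smul, neg_smul, smul_neg] at this
    simp only [Complex.I_mul_I, neg_neg, one_smul, neg_smul] at this
    simpa using this
  have h4 : (2 : ℂ) • (F Zᴴ) = (2 : ℂ) • (F Z)ᴴ := by
    rw [two_smul, two_smul]
    have e1 : F Zᴴ = (F Z)ᴴ + (F Zᴴ)ᴴ - F Z := by rw [h1]; abel
    have e2 : F Zᴴ = (F Z)ᴴ - (F Zᴴ)ᴴ + F Z := by rw [h3]; abel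
    nth_rewrite 1 [e1]
    nth_rewrite 2 [e2]
    abel
  exact smul_right_injective _ (two_ne_zero : (2 : ℂ) ≠ 0) h4

/-- Traces `tr (F (f A) g B)` are averages of `f (a) g (b)` over the spectra with nonnegative
weights. -/
theorem IsPositiveMap.exists_weights {F : Matrix n n ℂ →ₗ[ℂ] Matrix n n ℂ}
    (hF : IsPositiveMap F) {A B : Matrix n n ℂ} (hA : A.IsHermitian) (hB : B.IsHermitian) :
    ∃ w : n → n → ℝ, (∀ i j, 0 ≤ w i j) ∧ ∀ f g : ℝ → ℝ,
      (F (cfc f A) * cfc g B).trace.re =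
        ∑ i, ∑ j, w i j * (f (hA.eigenvalues i) * g (hB.eigenvalues j)) := by
  obtain ⟨P, hP, hPf⟩ := hA.exists_spectral
  obtain ⟨Q, hQ, hQg⟩ := hB.exists_spectral
  refine ⟨fun i j => (F (P i) * Q j).trace.re, fun i j => ?_, fun f g => ?_⟩
  · exact (Complex.nonneg_iff.1 ((hF _ (hP i)).trace_mul_nonneg (hQ j))).1
  · rw [hPf, hQg, map_sum, Finset.sum_mul, Matrix.trace_sum, Complex.re_sum]
    refine Finset.sum_congr rfl fun i _ => ?_
    rw [Finset.mul_sum, Matrix.trace_sum, Complex.re_sum]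
    refine Finset.sum_congr rfl fun j _ => ?_
    rw [map_smul, Matrix.smul_mul, Matrix.mul_smul, Matrix.trace_smul, Matrix.trace_smul]
    simp only [smul_eq_mul, Complex.re_ofReal_mul]
    ring

theorem Real.mul_log_sub_nonneg {x y : ℝ} (hx : 0 < x) (hy : 0 < y) :
    0 ≤ x * Real.log x - x * Real.log y - x + y := by
  have h := Real.log_le_sub_one_of_pos (div_pos hy hx)
  rw [Real.log_div hy.ne' hx.ne'] at h
  have := mul_le_mul_of_nonneg_left h hx.le
  have e : x * (y / x - 1) = y - x := by field_simp
  rw [e] at this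
  linarith

/-- Klein's inequality, with a positive map and a scale `c`. -/
theorem IsPositiveMap.klein {F : Matrix n n ℂ →ₗ[ℂ] Matrix n n ℂ}
    (hF : IsPositiveMap F) {A B : Matrix n n ℂ} (hA : A.PosDef) (hB : B.PosDef) {c : ℝ}
    (hc : 0 < c) :
    0 ≤ (F (A * cfc Real.log A)).trace.re - (F A * cfc Real.log B).trace.re -
      (1 + Real.log c) * (F A).trace.re + c * (F 1 * B).trace.re := by
  obtain ⟨w, hw, h⟩ := hF.exists_weights hA.1 hB.1
  have e1 := h (fun x => x * Real.log x) (fun _ => 1)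
  have e2 := h (fun x => x) Real.log
  have e3 := h (fun x => x) (fun _ => 1)
  have e4 := h (fun _ => 1) (fun x => x)
  have eA : cfc (fun x => x * Real.log x) A = A * cfc Real.log A := by
    rw [← hA.1.cfc_mul_cfc (fun x => x) Real.log, hA.1.cfc_self]
  simp only [hA.1.cfc_self, hB.1.cfc_self, hA.1.cfc_one', hB.1.cfc_one', Matrix.mul_one, eA]
    at e1 e2 e3 e4
  rw [e1, e2, e3, e4]
  simp only [Finset.mul_sum, ← Finset.sum_add_distrib, ← Finset.sum_sub_distrib]
  refine Finset.sum_nonneg fun i _ => Finset.sum_nonneg fun j _ => ?_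
  have ha := hA.eigenvalues_pos i
  have hb := hB.eigenvalues_pos j
  -- The scalar inequality `a log a - a log (c b) - a + c b ≥ 0` at a pair of eigenvalues; averaging
  -- it with the weights gives the claim.
  have key := Real.mul_log_sub_nonneg ha (mul_pos hc hb)
  rw [Real.log_mul hc.ne' hb.ne'] at key
  have := mul_nonneg (hw i j) key
  linarith

theorem vonNeumannEntropy_eq_cfc {A : Matrix n n ℂ} (hA : A.IsHermitian) :
    vonNeumannEntropy A = (cfc Real.negMulLog A).trace.re := by
  have : cfc Real.negMulLog A = -(A * cfc Real.log A) := by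
    have h1 := hA.cfc_mul_cfc (fun x => x) Real.log
    rw [hA.cfc_self] at h1
    rw [h1, ← cfc_neg]
    congr 1
    funext x
    simp [Real.negMulLog]
  rw [this, vonNeumannEntropy, Matrix.trace_neg, Complex.neg_re]

/-- Upper hemicontinuity of the spectrum puts all nearby spectra into one compact subset of `s`, on
which `f` is continuous. -/
theorem tendsto_cfc_of_isOpen {X : Type*} {s : Set ℝ} (hs : IsOpen s) {f : ℝ → ℝ}
    (hf : ContinuousOn f s) {l : Filter X} {a : X → Matrix n n ℂ} {a₀ : Matrix n n ℂ}
    (ha : Tendsto a l (𝓝 a₀)) (h : ∀ᶠ x in l, (a x).IsHermitian) (h₀ : a₀.IsHermitian)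
    (hsp : spectrum ℝ a₀ ⊆ s) : Tendsto (fun x => cfc f (a x)) l (𝓝 (cfc f a₀)) := by
  obtain ⟨k, ⟨hk1, hk2⟩, hk3⟩ :=
    (spectrum.isCompact (𝕜 := ℝ) a₀).nhdsSet_basis_isCompact.mem_iff.mp (hs.mem_nhdsSet.2 hsp)
  have hk4 := (upperHemicontinuous_spectrum ℝ (Matrix n n ℂ)).upperHemicontinuousAt a₀ _ hk1
  exact ha.cfc hk2 f ((ha.eventually hk4).mono fun _ => subset_of_mem_nhdsSet) h
    (subset_of_mem_nhdsSet hk1) h₀ (hf.mono hk3)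

theorem Matrix.PosDef.spectrum_subset {A : Matrix n n ℂ} (hA : A.PosDef) :
    spectrum ℝ A ⊆ Set.Ioi 0 := by
  rw [hA.1.spectrum_real_eq_range_eigenvalues]
  rintro _ ⟨i, rfl⟩
  exact hA.eigenvalues_pos i

theorem eventually_posDef {X : Type*} {l : Filter X} {a : X → Matrix n n ℂ} {a₀ : Matrix n n ℂ}
    (ha : Tendsto a l (𝓝 a₀)) (h : ∀ᶠ x in l, (a x).IsHermitian) (h₀ : a₀.PosDef) :
    ∀ᶠ x in l, (a x).PosDef := by
  have hk := (upperHemicontinuous_spectrum ℝ (Matrix n n ℂ)).upperHemicontinuousAt a₀ _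
    (isOpen_Ioi.mem_nhdsSet.2 h₀.spectrum_subset)
  filter_upwards [ha.eventually hk, h] with x hx hx2
  rw [hx2.posDef_iff_eigenvalues_pos]
  intro i
  exact subset_of_mem_nhdsSet hx (hx2.eigenvalues_mem_spectrum_real i)

theorem tendsto_log {X : Type*} {l : Filter X} {a : X → Matrix n n ℂ} {a₀ : Matrix n n ℂ}
    (ha : Tendsto a l (𝓝 a₀)) (h : ∀ᶠ x in l, (a x).IsHermitian) (h₀ : a₀.PosDef) :
    Tendsto (fun x => cfc Real.log (a x)) l (𝓝 (cfc Real.log a₀)) :=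
  tendsto_cfc_of_isOpen isOpen_Ioi (Real.continuousOn_log.mono fun _ hx => (ne_of_gt hx)) ha h
    h₀.1 h₀.spectrum_subset

theorem continuous_trace_re : Continuous fun X : Matrix n n ℂ => X.trace.re :=
  Complex.continuous_re.comp (Continuous.matrix_trace continuous_id)

theorem tendsto_vonNeumannEntropy {X : Type*} {l : Filter X} {a : X → Matrix n n ℂ}
    {a₀ : Matrix n n ℂ} (ha : Tendsto a l (𝓝 a₀)) (h : ∀ᶠ x in l, (a x).IsHermitian)
    (h₀ : a₀.IsHermitian) :
    Tendsto (fun x => vonNeumannEntropy (a x)) l (𝓝 (vonNeumannEntropy a₀)) := by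
  have h1 := tendsto_cfc_of_isOpen isOpen_univ Real.continuous_negMulLog.continuousOn ha h h₀
    (Set.subset_univ _)
  have h2 := (continuous_trace_re.tendsto _).comp h1
  rw [← vonNeumannEntropy_eq_cfc h₀] at h2
  refine h2.congr' ?_
  filter_upwards [h] with x hx
  exact (vonNeumannEntropy_eq_cfc hx).symm

/-- The tangent inequality of the concave function `S` at `Z`: Klein's inequality for the identity
map with `c = 1`. -/
theorem vonNeumannEntropy_sub_le {Y Z : Matrix n n ℂ} (hY : Y.PosDef) (hZ : Z.PosDef) :
    vonNeumannEntropy Y - vonNeumannEntropy Z ≤ -((Y - Z) * (cfc Real.log Z + 1)).trace.re := by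
  have h := isPositiveMap_id.klein hY hZ one_pos
  simp only [LinearMap.id_apply, Real.log_one, Matrix.one_mul] at h
  simp only [vonNeumannEntropy, Matrix.mul_add, Matrix.sub_mul, Matrix.trace_add, Matrix.trace_sub,
    Matrix.mul_one, Complex.add_re, Complex.sub_re]
  linarith

/-- Directional derivative of the von Neumann entropy at a positive definite matrix. -/
theorem tendsto_vonNeumannEntropy_slope {X : Type*} {l : Filter X} {Y Z : X → Matrix n n ℂ}
    {h : X → ℝ} {A W : Matrix n n ℂ} (hW : W.PosDef) (hY : Tendsto Y l (𝓝 W))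
    (hZ : Tendsto Z l (𝓝 W)) (hY' : ∀ᶠ x in l, (Y x).IsHermitian)
    (hZ' : ∀ᶠ x in l, (Z x).IsHermitian) (hh : ∀ᶠ x in l, 0 < h x)
    (hA : Tendsto (fun x => (h x)⁻¹ • (Y x - Z x)) l (𝓝 A)) :
    Tendsto (fun x => (vonNeumannEntropy (Y x) - vonNeumannEntropy (Z x)) / h x) l
      (𝓝 (-(A * (cfc Real.log W + 1)).trace.re)) := by
  have lim : ∀ V : X → Matrix n n ℂ, Tendsto V l (𝓝 W) → (∀ᶠ x in l, (V x).IsHermitian) →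
      Tendsto (fun x => -(((h x)⁻¹ • (Y x - Z x)) * (cfc Real.log (V x) + 1)).trace.re) l
        (𝓝 (-(A * (cfc Real.log W + 1)).trace.re)) := fun V hV hV' =>
    ((continuous_trace_re.tendsto _).comp
      (hA.mul ((tendsto_log hV hV' hW).add_const 1))).neg
  -- By concavity the slope lies between the gradients at `Y` and at `Z`, which have the same limit.
  -- The matrix logarithm only has to be continuous, not differentiated.
  refine tendsto_of_tendsto_of_tendsto_of_le_of_le' (lim Y hY hY') (lim Z hZ hZ') ?_ ?_
  all_goals
    filter_upwards [eventually_posDef hY hY' hW, eventually_posDef hZ hZ' hW, hh]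
      with x hy hz hx
    rw [Matrix.smul_mul, Matrix.trace_smul, Complex.smul_re, smul_eq_mul, inv_mul_eq_div,
      ← neg_div]
    refine div_le_div_of_nonneg_right ?_ hx.le
  · have := vonNeumannEntropy_sub_le hz hy
    rw [← neg_sub (Y x), Matrix.neg_mul, Matrix.trace_neg, Complex.neg_re] at this
    linarith
  · exact vonNeumannEntropy_sub_le hy hz

/-- A positive, unital, trace preserving map does not decrease the entropy. -/
theorem IsPositiveMap.vonNeumannEntropy_le {F : Matrix n n ℂ →ₗ[ℂ] Matrix n n ℂ}
    (hF : IsPositiveMap F) (htr : ∀ X, (F X).trace = X.trace) (h1 : F 1 = 1)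
    {A : Matrix n n ℂ} (hA : A.PosSemidef) : vonNeumannEntropy A ≤ vonNeumannEntropy (F A) := by
  -- Klein's inequality needs positive definite matrices. Adding `ε • 1` provides this and commutes
  -- with `F`, as `F` is unital; then `ε → 0`.
  have key : ∀ ε : ℝ, 0 < ε →
      vonNeumannEntropy (A + (ε : ℂ) • 1) ≤ vonNeumannEntropy (F A + (ε : ℂ) • 1) := by
    intro ε hε
    have he : (((ε : ℂ) • (1 : Matrix n n ℂ))).PosDef :=
      Matrix.PosDef.one.smul (by exact_mod_cast hε)
    have hX : (A + (ε : ℂ) • 1).PosDef := Matrix.PosDef.posSemidef_add hA he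
    have hFX : F (A + (ε : ℂ) • 1) = F A + (ε : ℂ) • 1 := by rw [map_add, map_smul, h1]
    have hFX' : (F (A + (ε : ℂ) • 1)).PosDef := by
      rw [hFX]; exact Matrix.PosDef.posSemidef_add (hF A hA) he
    have h := hF.klein hX hFX' one_pos
    rw [htr, h1, Matrix.one_mul, Real.log_one] at h
    rw [← hFX, vonNeumannEntropy, vonNeumannEntropy]
    linarith
  have lim : ∀ B : Matrix n n ℂ, B.PosSemidef →
      Tendsto (fun ε : ℝ => vonNeumannEntropy (B + (ε : ℂ) • 1)) (𝓝[>] 0)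
        (𝓝 (vonNeumannEntropy B)) := by
    intro B hB
    refine tendsto_vonNeumannEntropy ?_ (Eventually.of_forall fun ε => ?_) hB.1
    · have : Continuous fun ε : ℝ => B + (ε : ℂ) • (1 : Matrix n n ℂ) := by fun_prop
      have := (this.tendsto 0).mono_left (nhdsWithin_le_nhds (s := Set.Ioi 0))
      simpa using this
    · refine hB.1.add ?_
      rw [Matrix.IsHermitian, Matrix.conjTranspose_smul]
      simp
  exact le_of_tendsto_of_tendsto (lim A hA) (lim (F A) (hF A hA))
    (eventually_nhdsWithin_of_forall key)

/-- Adjoint of a linear map on matrices for the pairing `tr (X Y)`. -/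
def traceAdjoint (F : Matrix n n ℂ →ₗ[ℂ] Matrix n n ℂ) : Matrix n n ℂ →ₗ[ℂ] Matrix n n ℂ where
  toFun X := Matrix.of fun i j => (X * F (Matrix.single j i 1)).trace
  map_add' X Y := by ext; simp [Matrix.add_mul]
  map_smul' a X := by ext; simp

theorem trace_traceAdjoint_mul (F : Matrix n n ℂ →ₗ[ℂ] Matrix n n ℂ) (X Z : Matrix n n ℂ) :
    (traceAdjoint F X * Z).trace = (X * F Z).trace := by
  have h1 : ∀ i j, traceAdjoint F X i j = (X * F (Matrix.single j i 1)).trace := fun _ _ => rfl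
  have h2 : Z = ∑ i, ∑ j, Z i j • Matrix.single i j (1 : ℂ) := by
    conv_lhs => rw [Matrix.matrix_eq_sum_single Z]
    simp [Matrix.smul_single]
  have h3 : (X * F Z).trace = ∑ i, ∑ j, Z i j * (X * F (Matrix.single i j 1)).trace := by
    conv_lhs => rw [h2]
    simp only [map_sum, map_smul, Finset.mul_sum, Matrix.trace_sum, Matrix.mul_smul,
      Matrix.trace_smul, smul_eq_mul]
  rw [h3, Finset.sum_comm, Matrix.trace]
  refine Finset.sum_congr rfl fun i _ => ?_
  rw [Matrix.diag, Matrix.mul_apply]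
  refine Finset.sum_congr rfl fun j _ => ?_
  rw [h1, mul_comm]

theorem ext_trace_mul {X Y : Matrix n n ℂ} (h : ∀ Z, (X * Z).trace = (Y * Z).trace) : X = Y := by
  ext i j
  have := h (Matrix.single j i 1)
  simpa [Matrix.trace_mul_single] using this

theorem IsPositiveMap.traceAdjoint_isHermitian {F : Matrix n n ℂ →ₗ[ℂ] Matrix n n ℂ}
    (hF : IsPositiveMap F) {X : Matrix n n ℂ} (hX : X.IsHermitian) :
    (traceAdjoint F X).IsHermitian := by
  refine ext_trace_mul fun Z => ?_
  have h1 : ((traceAdjoint F X)ᴴ * Z).trace = star ((traceAdjoint F X * Zᴴ).trace) := by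
    rw [← Matrix.trace_conjTranspose, Matrix.conjTranspose_mul, Matrix.conjTranspose_conjTranspose,
      Matrix.trace_mul_comm]
  rw [h1, trace_traceAdjoint_mul, trace_traceAdjoint_mul, hF.map_conjTranspose,
    ← Matrix.trace_conjTranspose, Matrix.conjTranspose_mul, Matrix.conjTranspose_conjTranspose, hX,
    Matrix.trace_mul_comm]

/-- Kadison's inequality for the adjoint of a positive trace preserving map. -/
theorem IsPositiveMap.kadison {F : Matrix n n ℂ →ₗ[ℂ] Matrix n n ℂ}
    (hF : IsPositiveMap F) (htr : ∀ X, (F X).trace = X.trace) {N Z : Matrix n n ℂ}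
    (hN : N.IsHermitian) (hZ : Z.PosSemidef) :
    (traceAdjoint F N * traceAdjoint F N * Z).trace.re ≤ (N * N * F Z).trace.re := by
  obtain ⟨P, hP, hf⟩ := hN.exists_spectral
  set Y := traceAdjoint F N with hY
  have hYh : Y.IsHermitian := hF.traceAdjoint_isHermitian hN
  set μ := hN.eigenvalues
  -- Expanding the squares and using `∑ P_i = 1`, `∑ μ_i P_i = N`, `∑ μ_i² P_i = N²` turns this sum
  -- into `tr (N² F(Z)) - tr (Y² Z)`.
  have hpos : 0 ≤ ∑ i, (P i * F (((μ i : ℂ) • 1 - Y) * Z * ((μ i : ℂ) • 1 - Y))).trace.re := by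
    refine Finset.sum_nonneg fun i _ => ?_
    have hh : ((μ i : ℂ) • 1 - Y)ᴴ = (μ i : ℂ) • 1 - Y := by
      rw [Matrix.conjTranspose_sub, hYh, Matrix.conjTranspose_smul]; simp
    have := hZ.mul_mul_conjTranspose_same ((μ i : ℂ) • 1 - Y)
    rw [hh] at this
    exact (Complex.nonneg_iff.1 ((hP i).trace_mul_nonneg (hF _ this))).1
  have h0 : ∑ i, P i = 1 := by
    have := hf (fun _ => 1)
    rw [hN.cfc_one'] at this
    simpa using this.symm
  have h1 : ∑ i, (μ i : ℂ) • P i = N := by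
    have := hf (fun x => x)
    rw [hN.cfc_self] at this
    exact this.symm
  have h2 : ∑ i, ((μ i : ℂ) * (μ i : ℂ)) • P i = N * N := by
    have e := hN.cfc_mul_cfc (fun x => x) (fun x => x)
    rw [hN.cfc_self, hf] at e
    rw [e]
    push_cast; rfl
  have expand : ∀ i, (P i * F (((μ i : ℂ) • 1 - Y) * Z * ((μ i : ℂ) • 1 - Y))).trace =
      ((((μ i : ℂ) * (μ i : ℂ)) • P i) * F Z).trace - (((μ i : ℂ) • P i) * F (Z * Y)).trace
        - (((μ i : ℂ) • P i) * F (Y * Z)).trace + (P i * F (Y * Z * Y)).trace := by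
    intro i
    simp only [Matrix.sub_mul, Matrix.mul_sub, Matrix.smul_mul, Matrix.mul_smul, Matrix.one_mul,
      Matrix.mul_one, map_sub, map_smul, Matrix.trace_sub, Matrix.trace_smul, smul_sub, smul_eq_mul]
    ring
  have hsum : ∑ i, (P i * F (((μ i : ℂ) • 1 - Y) * Z * ((μ i : ℂ) • 1 - Y))).trace =
      (N * N * F Z).trace - (Y * Y * Z).trace := by
    simp only [expand, Finset.sum_add_distrib, Finset.sum_sub_distrib, ← Matrix.trace_sum,
      ← Finset.sum_mul, h0, h1, h2, Matrix.one_mul, htr]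
    rw [← trace_traceAdjoint_mul F N (Z * Y), ← trace_traceAdjoint_mul F N (Y * Z), ← hY]
    have e1 : (Y * (Z * Y)).trace = (Y * Z * Y).trace := by rw [Matrix.mul_assoc]
    have e2 : (Y * (Y * Z)).trace = (Y * Y * Z).trace := by rw [Matrix.mul_assoc]
    rw [e1, e2]
    ring
  rw [← Complex.re_sum, hsum, Complex.sub_re] at hpos
  linarith

end Positivity

/-! ### Linear flows: Duhamel's formula and convergence of the Euler scheme. -/

section Flow

variable {E : Type*} [NormedAddCommGroup E] [NormedSpace ℝ E] [CompleteSpace E]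

theorem hasDerivAt_flow (A : E →L[ℝ] E) (v : E) (t : ℝ) :
    HasDerivAt (fun s : ℝ => NormedSpace.exp (s • A) v) (A (NormedSpace.exp (t • A) v)) t := by
  have h := hasDerivAt_exp_smul_const' (𝕂 := ℝ) A t
  have h2 := h.clm_apply (hasDerivAt_const t v)
  refine h2.congr_deriv ?_
  simp

theorem continuous_flow (A : E →L[ℝ] E) (v : E) :
    Continuous fun s : ℝ => NormedSpace.exp (s • A) v :=
  continuous_iff_continuousAt.2 fun t => (hasDerivAt_flow A v t).continuousAt

theorem flow_zero (A : E →L[ℝ] E) (v : E) : NormedSpace.exp ((0 : ℝ) • A) v = v := by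
  simp [NormedSpace.exp_zero]

/-- Duhamel's formula. -/
theorem duhamel {A : E →L[ℝ] E} {u f : ℝ → E} {τ : ℝ}
    (hu : ∀ t ∈ Set.Icc 0 τ, HasDerivWithinAt u (A (u t) + f t) (Set.Icc 0 τ) t)
    (hf : IntervalIntegrable (fun s => NormedSpace.exp ((-s) • A) (f s))
      MeasureTheory.volume 0 τ) {t : ℝ} (ht : t ∈ Set.Icc 0 τ) :
    u t = NormedSpace.exp (t • A)
      (u 0 + ∫ s in (0 : ℝ)..t, NormedSpace.exp ((-s) • A) (f s)) := by
  have hexp : ∀ s : ℝ, HasDerivAt (fun s : ℝ => NormedSpace.exp ((-s) • A))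
      (-(NormedSpace.exp ((-s) • A) * A)) s := by
    intro s
    have h := (hasDerivAt_exp_smul_const (𝕂 := ℝ) A (-s)).scomp s (hasDerivAt_neg s)
    refine h.congr_deriv ?_
    simp
  -- Variation of constants: conjugating away the flow leaves only the source term in the
  -- derivative.
  have hg : ∀ s ∈ Set.Icc 0 τ, HasDerivWithinAt (fun s => NormedSpace.exp ((-s) • A) (u s))
      (NormedSpace.exp ((-s) • A) (f s)) (Set.Icc 0 τ) s := by
    intro s hs
    refine ((hexp s).hasDerivWithinAt.clm_apply (hu s hs)).congr_deriv ?_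
    simp
  have hsub : Set.uIcc 0 t ⊆ Set.uIcc 0 τ := by
    rw [Set.uIcc_of_le ht.1, Set.uIcc_of_le (ht.1.trans ht.2)]
    exact Set.Icc_subset_Icc_right ht.2
  have h1 := intervalIntegral.integral_eq_sub_of_hasDerivAt_of_le ht.1
    (f := fun s => NormedSpace.exp ((-s) • A) (u s))
    (f' := fun s => NormedSpace.exp ((-s) • A) (f s))
    (fun s hs => ((hg s ⟨hs.1, hs.2.trans ht.2⟩).continuousWithinAt.mono
      (Set.Icc_subset_Icc_right ht.2)))
    (fun s hs => (hg s ⟨hs.1.le, hs.2.le.trans ht.2⟩).hasDerivAt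
      (Icc_mem_nhds hs.1 (hs.2.trans_le ht.2))) (hf.mono_set hsub)
  rw [h1]
  simp only [neg_zero, flow_zero, add_sub_cancel]
  have h2 : NormedSpace.exp (t • A) * NormedSpace.exp ((-t) • A) = 1 := by
    let : NormedAlgebra ℚ (E →L[ℝ] E) := .restrictScalars ℚ ℝ _
    rw [← NormedSpace.exp_add_of_commute ((Commute.refl A).smul_left t |>.smul_right (-t)),
      ← add_smul, add_neg_cancel, zero_smul, NormedSpace.exp_zero]
  rw [← mul_apply_eq_comp, h2, one_apply_eq_self]

theorem eq_flow {A : E →L[ℝ] E} {u : ℝ → E} {τ : ℝ}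
    (hu : ∀ t ∈ Set.Icc 0 τ, HasDerivWithinAt u (A (u t)) (Set.Icc 0 τ) t) {t : ℝ}
    (ht : t ∈ Set.Icc 0 τ) : u t = NormedSpace.exp (t • A) (u 0) := by
  have h := duhamel (f := fun _ => 0) (u := u) (A := A) (τ := τ) (by simpa using hu)
    (by simp) ht
  simpa using h

theorem norm_exp_smul_le (A : E →L[ℝ] E) {h : ℝ} (hh : 0 ≤ h) :
    ‖NormedSpace.exp (h • A)‖ ≤ Real.exp (h * ‖A‖) := by
  have h0 : ∀ t ∈ Set.Icc 0 h, ‖NormedSpace.exp (t • A)‖ ≤ gronwallBound 1 ‖A‖ 0 (t - 0) := by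
    have hd : ∀ t : ℝ, HasDerivAt (fun s : ℝ => NormedSpace.exp (s • A))
      (A * NormedSpace.exp (t • A)) t := hasDerivAt_exp_smul_const' (𝕂 := ℝ) A
    refine norm_le_gronwallBound_of_norm_deriv_right_le
      (f' := fun t => A * NormedSpace.exp (t • A))
      (fun t _ => (hd t).continuousAt.continuousWithinAt) (fun t _ => (hd t).hasDerivWithinAt)
      ?_ (fun t _ => ?_)
    · rw [zero_smul, NormedSpace.exp_zero]
      exact ContinuousLinearMap.norm_id_le
    · simpa using norm_mul_le A _
  have := h0 h ⟨hh, le_rfl⟩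
  rw [gronwallBound_ε0, sub_zero, one_mul, mul_comm] at this
  exact this

/-- Telescoping: replace one factor `X` by `Y` at a time. Stability (`κ`) times consistency (`‖X -
Y‖`) controls the global error. -/
theorem norm_pow_sub_pow_le {X Y : E →L[ℝ] E} {κ : ℝ} (hκ : 1 ≤ κ) (hX : ‖X‖ ≤ κ) (hY : ‖Y‖ ≤ κ)
    (N : ℕ) : ‖X ^ N - Y ^ N‖ ≤ N * κ ^ N * ‖X - Y‖ := by
  have hκ0 : 0 ≤ κ := zero_le_one.trans hκ
  have hpow : ∀ N : ℕ, ‖Y ^ N‖ ≤ κ ^ N := fun N => by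
    induction N with
    | zero =>
      rw [pow_zero, pow_zero]
      exact ContinuousLinearMap.norm_id_le
    | succ N ih =>
      rw [pow_succ, pow_succ]
      exact (norm_mul_le _ _).trans (mul_le_mul ih hY (norm_nonneg _) (by positivity))
  induction N with
  | zero => simp
  | succ N ih =>
    have e : X ^ (N + 1) - Y ^ (N + 1) = X * (X ^ N - Y ^ N) + (X - Y) * Y ^ N := by
      rw [pow_succ', pow_succ']; noncomm_ring
    have h1 : ‖X * (X ^ N - Y ^ N)‖ ≤ κ * (N * κ ^ N * ‖X - Y‖) :=
      (norm_mul_le _ _).trans (mul_le_mul hX ih (norm_nonneg _) hκ0)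
    have h2 : ‖(X - Y) * Y ^ N‖ ≤ ‖X - Y‖ * κ ^ N :=
      (norm_mul_le _ _).trans (mul_le_mul_of_nonneg_left (hpow N) (norm_nonneg _))
    have h3 : ‖X - Y‖ * κ ^ N ≤ κ ^ (N + 1) * ‖X - Y‖ := by
      rw [mul_comm]
      exact mul_le_mul_of_nonneg_right (pow_le_pow_right₀ hκ (Nat.le_succ N)) (norm_nonneg _)
    rw [e]
    refine (norm_add_le _ _).trans ((add_le_add h1 (h2.trans h3)).trans_eq ?_)
    push_cast; ring

/-- Convergence of the Euler scheme with a second order perturbation. -/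
theorem tendsto_euler (A B : E →L[ℝ] E) {τ : ℝ} (hτ : 0 < τ) :
    Tendsto (fun N : ℕ => (1 + (τ / N) • A + (τ / N) ^ 2 • B) ^ N) atTop
      (𝓝 (NormedSpace.exp (τ • A))) := by
  set X : ℝ → E →L[ℝ] E := fun h => 1 + h • A + h ^ 2 • B
  -- One step agrees with the exact flow to first order, so the local error is `o(h)`. There are `τ
  -- / h` steps, hence the total error tends to `0`.
  have hd : HasDerivAt (fun h : ℝ => X h - NormedSpace.exp (h • A)) 0 0 := by
    have h1 : HasDerivAt X A 0 := by
      have := (((hasDerivAt_id (0 : ℝ)).smul_const A).const_add (1 : E →L[ℝ] E)).add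
        (((hasDerivAt_id (0 : ℝ)).pow 2).smul_const B)
      refine this.congr_deriv ?_
      simp
    have h2 := hasDerivAt_exp_smul_const' (𝕂 := ℝ) A 0
    refine (h1.sub h2).congr_deriv ?_
    simp [NormedSpace.exp_zero]
  have hslope := hd.tendsto_slope
  have hseq : Tendsto (fun N : ℕ => τ / (N : ℝ)) atTop (𝓝[≠] 0) := by
    rw [tendsto_nhdsWithin_iff]
    refine ⟨tendsto_const_div_atTop_nhds_zero_nat τ, ?_⟩
    filter_upwards [eventually_gt_atTop 0] with N hN
    have : (0 : ℝ) < N := by exact_mod_cast hN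
    exact (div_pos hτ this).ne'
  have hlim := (hslope.comp hseq).norm
  -- Chosen so that, for `0 < h ≤ τ`, both the step and the exact flow have norm at most `exp (h
  -- κ)`; `N` of them then stay below `exp (τ κ)`.
  set κ : ℝ := ‖A‖ + τ * ‖B‖ with hκ
  rw [tendsto_iff_norm_sub_tendsto_zero]
  have hbound : ∀ᶠ N : ℕ in atTop,
      ‖(1 + (τ / N) • A + (τ / N) ^ 2 • B) ^ N - NormedSpace.exp (τ • A)‖ ≤
        τ * Real.exp (τ * κ) *
          ‖slope (fun h : ℝ => X h - NormedSpace.exp (h • A)) 0 (τ / N)‖ := by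
    filter_upwards [eventually_gt_atTop 0] with N hN
    have hN' : (1 : ℝ) ≤ N := by exact_mod_cast hN
    have hN0 : (0 : ℝ) < N := by linarith
    set h : ℝ := τ / N with hh
    have hh0 : 0 < h := div_pos hτ hN0
    have hhτ : h ≤ τ := div_le_self hτ.le hN'
    have hNh : N * h = τ := by rw [hh]; field_simp
    have hκ0 : 0 ≤ κ := by positivity
    have hX : ‖X h‖ ≤ Real.exp (h * κ) := by
      have h1 : ‖X h‖ ≤ 1 + h * ‖A‖ + h ^ 2 * ‖B‖ := by
        refine (norm_add₃_le).trans ?_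
        refine add_le_add (add_le_add ContinuousLinearMap.norm_id_le ?_) ?_
        · rw [norm_smul, Real.norm_of_nonneg hh0.le]
        · rw [norm_smul, Real.norm_of_nonneg (by positivity)]
      have h2 : h ^ 2 * ‖B‖ ≤ h * (τ * ‖B‖) := by
        rw [pow_two, mul_assoc]
        gcongr
      have h3 := Real.add_one_le_exp (h * κ)
      rw [hκ] at h3 ⊢
      linarith
    have hY : ‖NormedSpace.exp (h • A)‖ ≤ Real.exp (h * κ) := by
      refine (norm_exp_smul_le A hh0.le).trans (Real.exp_le_exp.2 ?_)
      rw [hκ]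
      have : 0 ≤ τ * ‖B‖ := by positivity
      gcongr
      linarith
    have h1 : NormedSpace.exp (τ • A) = NormedSpace.exp (h • A) ^ N := by
      let : NormedAlgebra ℚ (E →L[ℝ] E) := .restrictScalars ℚ ℝ _
      rw [← NormedSpace.exp_nsmul, ← Nat.cast_smul_eq_nsmul ℝ, smul_smul, hNh]
    have h2 := norm_pow_sub_pow_le (Real.one_le_exp (by positivity)) hX hY N
    rw [h1]
    refine h2.trans_eq ?_
    have h3 : Real.exp (h * κ) ^ N = Real.exp (τ * κ) := by
      rw [← Real.exp_nat_mul, ← mul_assoc, hNh]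
    have h4 : slope (fun h : ℝ => X h - NormedSpace.exp (h • A)) 0 h =
        h⁻¹ • (X h - NormedSpace.exp (h • A)) := by
      rw [slope_def_module]
      simp [X, NormedSpace.exp_zero]
    rw [h3, h4, norm_smul, norm_inv, Real.norm_of_nonneg hh0.le, ← hNh]
    field_simp
  refine squeeze_zero' (Eventually.of_forall fun _ => norm_nonneg _) hbound ?_
  have := hlim.const_mul (τ * Real.exp (τ * κ))
  simpa using this

end Flow

/-- A complex linear map between finite-dimensional spaces as a continuous real linear map. -/
def realCLM {E E' : Type*} [NormedAddCommGroup E] [NormedSpace ℂ E] [FiniteDimensional ℂ E]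
    [NormedAddCommGroup E'] [NormedSpace ℂ E'] (T : E →ₗ[ℂ] E') : E →L[ℝ] E' :=
  (LinearMap.toContinuousLinearMap T).restrictScalars ℝ

@[simp]
theorem realCLM_apply {E E' : Type*} [NormedAddCommGroup E] [NormedSpace ℂ E]
    [FiniteDimensional ℂ E] [NormedAddCommGroup E'] [NormedSpace ℂ E'] (T : E →ₗ[ℂ] E') (x : E) :
    realCLM T x = T x := rfl

/-! ### The moments of the current as a linear flow. -/

namespace FeedbackSystem

variable {n K : Type*} [Fintype n] [DecidableEq n] [Fintype K] (S : FeedbackSystem n K)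

/-- A jump followed by feedback. -/
def jump (k : K) : Matrix n n ℂ →ₗ[ℂ] Matrix n n ℂ := S.F k ∘ₗ conjMap (S.L k)

theorem jump_apply (k : K) (X : Matrix n n ℂ) : S.jump k X = S.F k (S.L k * X * (S.L k)ᴴ) := by
  simp [jump, conjMap_apply]

theorem trace_jump (k : K) (X : Matrix n n ℂ) :
    (S.jump k X).trace = (S.L k * X * (S.L k)ᴴ).trace := by
  rw [jump_apply, (S.isUnitalCPTP_F k).tracePreserving]

theorem rate_eq_trace_jump (k : K) (X : Matrix n n ℂ) :
    S.rate X k = (S.jump k X).trace.re := by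
  rw [trace_jump, rate]

/-- The generator of the unperturbed dynamics as a linear map. -/
def gen : Matrix n n ℂ →ₗ[ℂ] Matrix n n ℂ where
  toFun := S.generator S.L
  map_add' X Y := by
    simp only [generator, Matrix.mul_add, Matrix.add_mul, map_add, smul_add, smul_sub,
      Finset.sum_add_distrib, Finset.sum_sub_distrib]
    abel
  map_smul' a X := by
    simp only [generator, Matrix.mul_smul, Matrix.smul_mul, map_smul, smul_add, smul_sub,
      RingHom.id_apply, Finset.smul_sum, smul_comm a]

theorem gen_apply (X : Matrix n n ℂ) : S.gen X = S.generator S.L X := rfl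

/-- Jumps weighted by `c`. -/
def weightedJump (c : K → ℝ) : Matrix n n ℂ →ₗ[ℂ] Matrix n n ℂ := ∑ k, (c k : ℂ) • S.jump k

theorem weightedJump_apply (c : K → ℝ) (X : Matrix n n ℂ) :
    S.weightedJump c X = ∑ k, (c k : ℂ) • S.jump k X := by
  simp [weightedJump]

theorem re_trace_weightedJump (c : K → ℝ) (X : Matrix n n ℂ) :
    (S.weightedJump c X).trace.re = ∑ k, c k * S.rate X k := by
  rw [weightedJump_apply, Matrix.trace_sum, Complex.re_sum]
  refine Finset.sum_congr rfl fun k _ => ?_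
  rw [Matrix.trace_smul, smul_eq_mul, Complex.re_ofReal_mul, rate_eq_trace_jump]

/-- The generator of the evolution between jumps is `X ↦ -(G X + X G†)`. -/
def decay : Matrix n n ℂ := Complex.I • S.H + (1 / 2 : ℂ) • ∑ k, (S.L k)ᴴ * S.L k

theorem decay_conjTranspose :
    S.decayᴴ = -Complex.I • S.H + (1 / 2 : ℂ) • ∑ k, (S.L k)ᴴ * S.L k := by
  rw [decay, Matrix.conjTranspose_add, Matrix.conjTranspose_smul, Matrix.conjTranspose_smul,
    Matrix.conjTranspose_sum, S.isHermitian_H]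
  simp [Matrix.conjTranspose_mul]

theorem gen_eq (X : Matrix n n ℂ) :
    S.gen X = ∑ k, S.jump k X - (S.decay * X + X * S.decayᴴ) := by
  rw [gen_apply, generator, decay_conjTranspose, decay]
  simp only [jump_apply, Matrix.add_mul, Matrix.mul_add, Matrix.smul_mul, Matrix.mul_smul,
    Finset.sum_sub_distrib, Finset.sum_add_distrib, ← Finset.smul_sum, Finset.sum_mul,
    Finset.mul_sum, smul_add, smul_sub, neg_smul, Matrix.mul_neg]
  abel

/-- One measurement and feedback step with a given outcome. -/
def stepMap (h : ℝ) : Option K → (Matrix n n ℂ →ₗ[ℂ] Matrix n n ℂ)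
  | none => conjMap (S.kraus h none)
  | some k => S.F k ∘ₗ conjMap (S.kraus h (some k))

theorem feedback_kraus (h : ℝ) (a : Option K) (X : Matrix n n ℂ) :
    S.feedback a (S.kraus h a * X * (S.kraus h a)ᴴ) = S.stepMap h a X := by
  cases a <;> simp [stepMap, feedback, conjMap_apply]

theorem kraus_some_conj {h : ℝ} (hh : 0 ≤ h) (k : K) (X : Matrix n n ℂ) :
    S.kraus h (some k) * X * (S.kraus h (some k))ᴴ = (h : ℂ) • (S.L k * X * (S.L k)ᴴ) := by
  have : (Real.sqrt h : ℂ) * (Real.sqrt h : ℂ) = h := by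
    exact_mod_cast Real.mul_self_sqrt hh
  rw [kraus, Matrix.conjTranspose_smul]
  simp only [Matrix.smul_mul, Matrix.mul_smul, smul_smul, Complex.star_def, Complex.conj_ofReal,
    this]

theorem stepMap_some {h : ℝ} (hh : 0 ≤ h) (k : K) (X : Matrix n n ℂ) :
    S.stepMap h (some k) X = (h : ℂ) • S.jump k X := by
  rw [← feedback_kraus, kraus_some_conj S hh, jump_apply]
  exact map_smul _ _ _

theorem stepMap_none (h : ℝ) (X : Matrix n n ℂ) :
    S.stepMap h none X = X - (h : ℂ) • (S.decay * X + X * S.decayᴴ) +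
      ((h : ℂ) ^ 2) • (S.decay * X * S.decayᴴ) := by
  have : S.kraus h none = 1 - (h : ℂ) • S.decay := rfl
  rw [← feedback_kraus, this, feedback, Matrix.conjTranspose_sub, Matrix.conjTranspose_smul,
    Matrix.conjTranspose_one]
  simp only [Matrix.sub_mul, Matrix.mul_sub, Matrix.smul_mul, Matrix.mul_smul, Matrix.one_mul,
    Matrix.mul_one, Complex.star_def, Complex.conj_ofReal, smul_add, smul_smul, smul_sub, pow_two]
  abel

theorem sum_stepMap {h : ℝ} (hh : 0 ≤ h) (X : Matrix n n ℂ) :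
    ∑ a, S.stepMap h a X = X + (h : ℂ) • S.gen X + ((h : ℂ) ^ 2) • conjMap S.decay X := by
  rw [Fintype.sum_option, stepMap_none, gen_eq, conjMap_apply]
  simp only [S.stepMap_some hh, ← Finset.smul_sum, smul_sub]
  abel

/-- State-valued moments of the current. -/
def stateMoment (c : K → ℝ) (h : ℝ) (j N : ℕ) : Matrix n n ℂ :=
  ∑ Γ : Fin N → Option K, ((current c Γ : ℂ) ^ j) • S.trajectoryState h (List.ofFn Γ)

theorem re_trace_stateMoment (c : K → ℝ) (τ : ℝ) (m N : ℕ) :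
    (S.stateMoment c (τ / N) m N).trace.re = S.discreteMoment c τ m N := by
  rw [stateMoment, Matrix.trace_sum, Complex.re_sum, discreteMoment]
  refine Finset.sum_congr rfl fun Γ _ => ?_
  rw [Matrix.trace_smul, smul_eq_mul, ← Complex.ofReal_pow, Complex.re_ofReal_mul, trajectoryProb]

/-- The last step is split off the trajectory, since the state is a left fold with the earliest
outcome first. -/
theorem stateMoment_succ (c : K → ℝ) (h : ℝ) (j N : ℕ) :
    S.stateMoment c h j (N + 1) = ∑ a : Option K, ∑ Γ : Fin N → Option K,
      (((current c Γ + a.elim 0 c : ℝ) : ℂ) ^ j) •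
        S.stepMap h a (S.trajectoryState h (List.ofFn Γ)) := by
  rw [stateMoment, ← (Fin.snocEquiv (fun _ => Option K)).sum_comp, Fintype.sum_prod_type]
  refine Finset.sum_congr rfl fun a _ => Finset.sum_congr rfl fun Γ _ => ?_
  have h1 : current c (Fin.snoc (α := fun _ => Option K) Γ a) = current c Γ + a.elim 0 c := by
    simp [current, Fin.sum_univ_castSucc]
  have h2 : S.trajectoryState h (List.ofFn (Fin.snoc (α := fun _ => Option K) Γ a)) =
      S.stepMap h a (S.trajectoryState h (List.ofFn Γ)) := by
    rw [← feedback_kraus, List.ofFn_succ']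
    simp [trajectoryState, List.concat_eq_append]
  simp only [Fin.snocEquiv, Equiv.coe_fn_mk]
  rw [h1, h2]

theorem sum_weight_stepMap {h : ℝ} (hh : 0 ≤ h) (c : K → ℝ) (X : Matrix n n ℂ) :
    ∑ a : Option K, ((a.elim 0 c : ℝ) : ℂ) • S.stepMap h a X = (h : ℂ) • S.weightedJump c X := by
  rw [Fintype.sum_option]
  simp only [S.stepMap_some hh, Option.elim_none, Option.elim_some, Complex.ofReal_zero, zero_smul,
    zero_add, weightedJump_apply, Finset.smul_sum]
  exact Finset.sum_congr rfl fun k _ => smul_comm _ _ _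

theorem stateMoment_zero_succ (c : K → ℝ) {h : ℝ} (hh : 0 ≤ h) (N : ℕ) :
    S.stateMoment c h 0 (N + 1) = S.stateMoment c h 0 N + (h : ℂ) • S.gen (S.stateMoment c h 0 N) +
      ((h : ℂ) ^ 2) • conjMap S.decay (S.stateMoment c h 0 N) := by
  rw [stateMoment_succ, ← S.sum_stepMap hh]
  simp [stateMoment, map_sum]

theorem stateMoment_one_succ (c : K → ℝ) {h : ℝ} (hh : 0 ≤ h) (N : ℕ) :
    S.stateMoment c h 1 (N + 1) = S.stateMoment c h 1 N + (h : ℂ) • S.gen (S.stateMoment c h 1 N) +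
      ((h : ℂ) ^ 2) • conjMap S.decay (S.stateMoment c h 1 N) +
      (h : ℂ) • S.weightedJump c (S.stateMoment c h 0 N) := by
  rw [stateMoment_succ, ← S.sum_stepMap hh, ← S.sum_weight_stepMap hh]
  simp only [stateMoment, map_sum, map_smul, Finset.smul_sum, pow_one, pow_zero, one_smul,
    Complex.ofReal_add, add_smul, Finset.sum_add_distrib]

/-- From `(J + c)² = J² + 2 c J + c²`. The outcome without a jump has weight `0`, so the last two
terms come from jumps alone and are exactly of order `h`. -/
theorem stateMoment_two_succ (c : K → ℝ) {h : ℝ} (hh : 0 ≤ h) (N : ℕ) :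
    S.stateMoment c h 2 (N + 1) = S.stateMoment c h 2 N + (h : ℂ) • S.gen (S.stateMoment c h 2 N) +
      ((h : ℂ) ^ 2) • conjMap S.decay (S.stateMoment c h 2 N) +
      (h : ℂ) • ((2 : ℂ) • S.weightedJump c (S.stateMoment c h 1 N) +
        S.weightedJump (fun k => c k ^ 2) (S.stateMoment c h 0 N)) := by
  have h2 : ∀ a : Option K, ((a.elim 0 (fun k => c k ^ 2) : ℝ) : ℂ) = ((a.elim 0 c : ℝ) : ℂ) ^ 2 :=
    fun a => by cases a <;> simp
  rw [stateMoment_succ, ← S.sum_stepMap hh, smul_add, smul_comm, ← S.sum_weight_stepMap hh,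
    ← S.sum_weight_stepMap hh]
  simp only [stateMoment, map_sum, map_smul, Finset.smul_sum, pow_one, pow_zero, one_smul,
    Complex.ofReal_add, h2, ← Finset.sum_add_distrib, smul_smul, ← add_smul]
  refine Finset.sum_congr rfl fun a _ => Finset.sum_congr rfl fun Γ _ => ?_
  congr 1
  ring

variable (n) in
/-- Triples of matrices: the state and its first two current moments. -/
abbrev MomentSpace := Matrix n n ℂ × Matrix n n ℂ × Matrix n n ℂ

/-- Generator of the joint evolution of the state-valued moments. -/
def momentGen (c : K → ℝ) : MomentSpace n →ₗ[ℂ] MomentSpace n :=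
  (S.gen ∘ₗ LinearMap.fst ℂ _ _).prod
    ((S.gen ∘ₗ LinearMap.fst ℂ _ _ ∘ₗ LinearMap.snd ℂ _ _ +
        S.weightedJump c ∘ₗ LinearMap.fst ℂ _ _).prod
      (S.gen ∘ₗ LinearMap.snd ℂ _ _ ∘ₗ LinearMap.snd ℂ _ _ +
        ((2 : ℂ) • S.weightedJump c ∘ₗ LinearMap.fst ℂ _ _ ∘ₗ LinearMap.snd ℂ _ _ +
          S.weightedJump (fun k => c k ^ 2) ∘ₗ LinearMap.fst ℂ _ _)))

theorem momentGen_apply (c : K → ℝ) (x : MomentSpace n) :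
    S.momentGen c x = (S.gen x.1, S.gen x.2.1 + S.weightedJump c x.1,
      S.gen x.2.2 + ((2 : ℂ) • S.weightedJump c x.2.1 +
        S.weightedJump (fun k => c k ^ 2) x.1)) := rfl

/-- Second order term of a step in the joint evolution of the moments. -/
def momentRem : MomentSpace n →ₗ[ℂ] MomentSpace n :=
  (conjMap S.decay).prodMap ((conjMap S.decay).prodMap (conjMap S.decay))

theorem momentRem_apply (x : MomentSpace n) :
    S.momentRem x = (conjMap S.decay x.1, conjMap S.decay x.2.1, conjMap S.decay x.2.2) := rfl

/-- The state-valued moments in continuous time. -/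
def moments (c : K → ℝ) (t : ℝ) : MomentSpace n :=
  NormedSpace.exp (t • realCLM (S.momentGen c)) (S.ρ₀, 0, 0)

/-- The recursions of the three moments close on themselves and have no term beyond `h²`, so the
discrete moments are exactly an Euler scheme with a quadratic perturbation. -/
theorem stateMoments_eq (c : K → ℝ) {h : ℝ} (hh : 0 ≤ h) (N : ℕ) :
    ((S.stateMoment c h 0 N, S.stateMoment c h 1 N, S.stateMoment c h 2 N) : MomentSpace n) =
      ((1 + h • realCLM (S.momentGen c) + h ^ 2 • realCLM S.momentRem) ^ N) (S.ρ₀, 0, 0) := by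
  induction N with
  | zero =>
    simp [stateMoment, current, trajectoryState]
  | succ N ih =>
    rw [pow_succ', mul_apply_eq_comp, ← ih, stateMoment_zero_succ S c hh,
      stateMoment_one_succ S c hh, stateMoment_two_succ S c hh]
    have e1 : ∀ X : Matrix n n ℂ, h • X = (h : ℂ) • X := fun X => (Complex.coe_smul h X).symm
    have e2 : ∀ X : Matrix n n ℂ, h ^ 2 • X = (h : ℂ) ^ 2 • X := fun X => by
      rw [← Complex.ofReal_pow, Complex.coe_smul]
    simp only [_root_.add_apply, _root_.smul_apply, realCLM_apply,
      one_apply_eq_self, momentGen_apply, momentRem_apply, Prod.smul_mk, Prod.mk_add_mk, e1, e2]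
    refine Prod.ext rfl (Prod.ext ?_ ?_)
    · simp only [smul_add]; abel
    · simp only [smul_add]; abel

theorem tendsto_stateMoments (c : K → ℝ) {τ : ℝ} (hτ : 0 < τ) :
    Tendsto (fun N : ℕ => ((S.stateMoment c (τ / N) 0 N, S.stateMoment c (τ / N) 1 N,
      S.stateMoment c (τ / N) 2 N) : MomentSpace n)) atTop (𝓝 (S.moments c τ)) := by
  have h := (tendsto_euler (realCLM (S.momentGen c)) (realCLM S.momentRem) hτ)
  have h2 := ((ContinuousLinearMap.apply ℝ (MomentSpace n)
    ((S.ρ₀, 0, 0) : MomentSpace n)).continuous.tendsto _).comp h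
  refine h2.congr fun N => ?_
  rw [stateMoments_eq S c (by positivity)]
  rfl

theorem tendsto_discreteMoment_one (c : K → ℝ) {τ : ℝ} (hτ : 0 < τ) :
    Tendsto (S.discreteMoment c τ 1) atTop (𝓝 (S.moments c τ).2.1.trace.re) := by
  have h := ((continuous_trace_re.comp (continuous_fst.comp continuous_snd)).tendsto _).comp
    (S.tendsto_stateMoments c hτ)
  exact h.congr fun N => S.re_trace_stateMoment c τ 1 N

theorem tendsto_discreteMoment_two (c : K → ℝ) {τ : ℝ} (hτ : 0 < τ) :
    Tendsto (S.discreteMoment c τ 2) atTop (𝓝 (S.moments c τ).2.2.trace.re) := by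
  have h := ((continuous_trace_re.comp (continuous_snd.comp continuous_snd)).tendsto _).comp
    (S.tendsto_stateMoments c hτ)
  exact h.congr fun N => S.re_trace_stateMoment c τ 2 N

theorem meanCurrent_eq (c : K → ℝ) {τ : ℝ} (hτ : 0 < τ) :
    S.meanCurrent c τ = (S.moments c τ).2.1.trace.re :=
  (S.tendsto_discreteMoment_one c hτ).limUnder_eq

theorem currentMoment_two_eq (c : K → ℝ) {τ : ℝ} (hτ : 0 < τ) :
    S.currentMoment c τ 2 = (S.moments c τ).2.2.trace.re :=
  (S.tendsto_discreteMoment_two c hτ).limUnder_eq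

theorem hasDerivAt_moments (c : K → ℝ) (t : ℝ) :
    HasDerivAt (S.moments c) (S.momentGen c (S.moments c t)) t :=
  hasDerivAt_flow (realCLM (S.momentGen c)) (S.ρ₀, 0, 0) t

theorem moments_zero (c : K → ℝ) : S.moments c 0 = (S.ρ₀, 0, 0) := flow_zero _ _

end FeedbackSystem

/-! ### The backward equation and a lower bound on the variance. -/

section

variable {n : Type*} [Fintype n] [DecidableEq n]

/-- The real part of the trace as a continuous linear map. -/
def reTrace (n : Type*) [Fintype n] [DecidableEq n] : Matrix n n ℂ →L[ℝ] ℝ :=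
  Complex.reCLM.comp (realCLM (Matrix.traceLinearMap n ℂ ℂ))

theorem HasDerivAt.reTrace {u : ℝ → Matrix n n ℂ} {u' : Matrix n n ℂ} {t : ℝ}
    (h : HasDerivAt u u' t) : HasDerivAt (fun t => (u t).trace.re) u'.trace.re t :=
  (_root_.reTrace n).hasFDerivAt.comp_hasDerivAt t h

theorem traceAdjoint_conjTranspose {T : Matrix n n ℂ →ₗ[ℂ] Matrix n n ℂ}
    (hT : ∀ Z, T Zᴴ = (T Z)ᴴ) (X : Matrix n n ℂ) : traceAdjoint T Xᴴ = (traceAdjoint T X)ᴴ := by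
  refine ext_trace_mul fun Z => ?_
  have h1 : ((traceAdjoint T X)ᴴ * Z).trace = star ((traceAdjoint T X * Zᴴ).trace) := by
    rw [← Matrix.trace_conjTranspose, Matrix.conjTranspose_mul, Matrix.conjTranspose_conjTranspose,
      Matrix.trace_mul_comm]
  rw [h1, trace_traceAdjoint_mul, trace_traceAdjoint_mul, hT, ← Matrix.trace_conjTranspose,
    Matrix.conjTranspose_mul, Matrix.conjTranspose_conjTranspose, Matrix.trace_mul_comm]

/-- Hermitian solutions of the inhomogeneous backward equation with final value `0`. -/
theorem exists_backward_solution {T : Matrix n n ℂ →ₗ[ℂ] Matrix n n ℂ}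
    (hT : ∀ Z, T Zᴴ = (T Z)ᴴ) {B : Matrix n n ℂ} (hB : B.IsHermitian) (τ : ℝ) :
    ∃ N : ℝ → Matrix n n ℂ, N τ = 0 ∧ (∀ t, (N t).IsHermitian) ∧
      ∀ t, HasDerivAt N (-(T (N t) + B)) t := by
  -- Carrying the constant source `B` as a second component makes the equation homogeneous; the
  -- solution is its flow run backwards from `τ`.
  set A : (Matrix n n ℂ × Matrix n n ℂ) →ₗ[ℂ] (Matrix n n ℂ × Matrix n n ℂ) :=
    (T ∘ₗ LinearMap.fst ℂ _ _ + LinearMap.snd ℂ _ _).prod 0 with hA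
  set y : ℝ → Matrix n n ℂ × Matrix n n ℂ :=
    fun t => NormedSpace.exp (t • realCLM A) ((0, B) : Matrix n n ℂ × Matrix n n ℂ) with hy
  have hyd : ∀ t, HasDerivAt y (T (y t).1 + (y t).2, 0) t := fun t =>
    hasDerivAt_flow (realCLM A) _ t
  have hy0 : y 0 = (0, B) := flow_zero _ _
  have hd1 : ∀ t, HasDerivAt (fun t => (y t).1) (T (y t).1 + (y t).2) t := fun t => (hyd t).fst
  have hd2 : ∀ t, HasDerivAt (fun t => (y t).2) 0 t := fun t => (hyd t).snd
  have hc : ∀ t, (y t).2 = B := by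
    intro t
    have := is_const_of_deriv_eq_zero (f := fun t => (y t).2)
      (fun t => (hd2 t).differentiableAt) (fun t => (hd2 t).deriv) t 0
    simpa [hy0] using this
  -- The adjoint of a solution is again one, because `T` commutes with the adjoint and `B` is
  -- Hermitian; the average of the two is Hermitian by construction.
  refine ⟨fun t => (1 / 2 : ℝ) • ((y (τ - t)).1 + star (y (τ - t)).1), ?_, fun t => ?_, fun t => ?_⟩
  · simp [hy0]
  · rw [Matrix.IsHermitian, Matrix.conjTranspose_smul, Matrix.conjTranspose_add,
      Matrix.star_eq_conjTranspose, Matrix.conjTranspose_conjTranspose, add_comm]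
    simp [Matrix.star_eq_conjTranspose]
  · have h1 : HasDerivAt (fun t => (y (τ - t)).1) (-(T (y (τ - t)).1 + B)) t := by
      have := (hd1 (τ - t)).scomp t ((hasDerivAt_id t).const_sub τ)
      simpa [hc, Function.comp_def, add_comm] using this
    refine ((h1.add h1.star).const_smul (1 / 2 : ℝ)).congr_deriv ?_
    have hB' : star B = B := hB
    have hT' : ∀ Z, star (T Z) = T (star Z) := fun Z => (hT Z).symm
    rw [star_neg, star_add, hB', hT']
    have : T ((1 / 2 : ℝ) • ((y (τ - t)).1 + star (y (τ - t)).1)) =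
        (1 / 2 : ℝ) • (T (y (τ - t)).1 + T (star (y (τ - t)).1)) := by
      rw [← map_add]
      exact (realCLM T).map_smul (1 / 2 : ℝ) _
    rw [this]
    module

end

namespace FeedbackSystem

variable {n K : Type*} [Fintype n] [DecidableEq n] [Fintype K] (S : FeedbackSystem n K)

theorem isPositiveMap_F (k : K) : IsPositiveMap (S.F k) :=
  (S.isUnitalCPTP_F k).completelyPositive.isPositiveMap

theorem isPositiveMap_jump (k : K) : IsPositiveMap (S.jump k) := fun X hX =>
  S.isPositiveMap_F k _ (isPositiveMap_conjMap _ X hX)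

theorem weightedJump_conjTranspose (c : K → ℝ) (Z : Matrix n n ℂ) :
    S.weightedJump c Zᴴ = (S.weightedJump c Z)ᴴ := by
  simp only [weightedJump_apply, Matrix.conjTranspose_sum, Matrix.conjTranspose_smul,
    (S.isPositiveMap_jump _).map_conjTranspose, Complex.star_def, Complex.conj_ofReal]

theorem gen_conjTranspose (Z : Matrix n n ℂ) : S.gen Zᴴ = (S.gen Z)ᴴ := by
  simp only [gen_eq, Matrix.conjTranspose_sub, Matrix.conjTranspose_sum,
    (S.isPositiveMap_jump _).map_conjTranspose, Matrix.conjTranspose_add,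
    Matrix.conjTranspose_mul, Matrix.conjTranspose_conjTranspose]
  rw [add_comm (Zᴴ * S.decayᴴ)]

theorem trace_gen (X : Matrix n n ℂ) : (S.gen X).trace = 0 := by
  rw [gen_eq, decay_conjTranspose, decay]
  simp only [Matrix.trace_sub, Matrix.trace_sum, Matrix.trace_add, trace_jump, Matrix.add_mul,
    Matrix.mul_add, Matrix.smul_mul, Matrix.mul_smul, Matrix.trace_smul, Finset.sum_mul,
    Finset.mul_sum, smul_eq_mul]
  have h1 : (S.H * X).trace = (X * S.H).trace := Matrix.trace_mul_comm _ _
  have h2 : ∀ k, (S.L k * X * (S.L k)ᴴ).trace = ((S.L k)ᴴ * S.L k * X).trace := fun k => by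
    rw [Matrix.trace_mul_comm, ← Matrix.mul_assoc]
  have h3 : ∀ k, (X * ((S.L k)ᴴ * S.L k)).trace = ((S.L k)ᴴ * S.L k * X).trace := fun k =>
    Matrix.trace_mul_comm _ _
  simp only [h1, h2, h3, ← Finset.mul_sum]
  ring

/-- Change, at a jump, of the expectation of the current. -/
def jumpDefect (c : K → ℝ) (N : Matrix n n ℂ) (k : K) : Matrix n n ℂ :=
  ((c k : ℂ) • 1 + traceAdjoint (S.F k) N) * S.L k - S.L k * N

/-- The right side is the growth rate of the second moment of collected plus expected future current
(`v'` in `integral_defect_le`). The only loss is Kadison's inequality, which replaces `F_k†(N²)` by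
`F_k†(N)²`; with that, each channel completes a square. -/
theorem sum_defect_le (c : K → ℝ) {N X : Matrix n n ℂ} (hN : N.IsHermitian)
    (hX : X.PosSemidef) :
    ∑ k, (S.jumpDefect c N k * X * (S.jumpDefect c N k)ᴴ).trace.re ≤
      (S.weightedJump (fun k => c k ^ 2) X).trace.re + 2 * (N * S.weightedJump c X).trace.re -
        (S.weightedJump c (N * X)).trace.re - (S.weightedJump c (X * N)).trace.re -
        (N * S.gen (N * X)).trace.re - (N * S.gen (X * N)).trace.re +
        (N * N * S.gen X).trace.re := by
  have hG : S.decay + S.decayᴴ = ∑ k, (S.L k)ᴴ * S.L k := by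
    rw [decay_conjTranspose, decay]
    module
  -- Terms with both factors `N` on the same side of `X` cancel. The others combine to `N (G + G†) N
  -- X`, with `G` the decay matrix, and the Hamiltonian drops out of `G + G†`.
  have hdec : (N * (S.decay * (N * X) + N * X * S.decayᴴ)).trace +
      (N * (S.decay * (X * N) + X * N * S.decayᴴ)).trace -
        (N * N * (S.decay * X + X * S.decayᴴ)).trace =
      ∑ k, (S.L k * N * X * N * (S.L k)ᴴ).trace := by
    have e1 : (N * (S.decay * (X * N))).trace = (N * N * (S.decay * X)).trace := by
      rw [← Matrix.mul_assoc S.decay, ← Matrix.mul_assoc N, Matrix.trace_mul_comm,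
        ← Matrix.mul_assoc]
    have e2 : (N * (N * X * S.decayᴴ)).trace = (N * N * (X * S.decayᴴ)).trace := by
      simp only [Matrix.mul_assoc]
    have e3 : (N * (X * N * S.decayᴴ)).trace = (N * (S.decayᴴ * (N * X))).trace := by
      rw [← Matrix.mul_assoc N, Matrix.trace_mul_comm, ← Matrix.mul_assoc N X,
        ← Matrix.mul_assoc S.decayᴴ, Matrix.trace_mul_comm]
    have e4 : ∀ k, (S.L k * N * X * N * (S.L k)ᴴ).trace =
        (N * ((S.L k)ᴴ * S.L k * (N * X))).trace := fun k => by
      rw [Matrix.trace_mul_comm, ← Matrix.mul_assoc, Matrix.trace_mul_comm]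
      simp only [Matrix.mul_assoc]
    simp only [Matrix.mul_add, Matrix.trace_add, e1, e2, e3, e4]
    rw [← Matrix.trace_sum, ← Finset.mul_sum, ← Finset.sum_mul, ← hG, Matrix.add_mul,
      Matrix.mul_add, Matrix.trace_add]
    ring
  have hre := congrArg Complex.re hdec
  simp only [Complex.sub_re, Complex.add_re, Complex.re_sum] at hre
  have hgen : ∀ Q Z : Matrix n n ℂ, (Q * S.gen Z).trace.re =
      ∑ k, (Q * S.jump k Z).trace.re - (Q * (S.decay * Z + Z * S.decayᴴ)).trace.re := by
    intro Q Z
    rw [gen_eq, Matrix.mul_sub, Matrix.trace_sub, Finset.mul_sum, Matrix.trace_sum, Complex.sub_re,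
      Complex.re_sum]
  have hwj : ∀ Q Z : Matrix n n ℂ, (Q * S.weightedJump c Z).trace.re =
      ∑ k, c k * (Q * S.jump k Z).trace.re := by
    intro Q Z
    simp only [weightedJump_apply, Finset.mul_sum, Matrix.trace_sum, Complex.re_sum,
      Matrix.mul_smul, Matrix.trace_smul, smul_eq_mul, Complex.re_ofReal_mul]
  rw [hgen, hgen, hgen, hwj, re_trace_weightedJump, re_trace_weightedJump, re_trace_weightedJump]
  have key : ∀ k, (S.jumpDefect c N k * X * (S.jumpDefect c N k)ᴴ).trace.re ≤
      c k ^ 2 * S.rate X k + 2 * (c k * (N * S.jump k X).trace.re) - c k * S.rate (N * X) k -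
        c k * S.rate (X * N) k - (N * S.jump k (N * X)).trace.re -
        (N * S.jump k (X * N)).trace.re + (N * N * S.jump k X).trace.re +
        (S.L k * N * X * N * (S.L k)ᴴ).trace.re := by
    intro k
    have hkad := (S.isPositiveMap_F k).kadison (S.isUnitalCPTP_F k).tracePreserving hN
      (hX.mul_mul_conjTranspose_same (S.L k))
    rw [← jump_apply] at hkad
    set Y := traceAdjoint (S.F k) N with hY
    have hYh : Yᴴ = Y := (S.isPositiveMap_F k).traceAdjoint_isHermitian hN
    have hYj : ∀ Z, (N * S.jump k Z).trace = (Y * (S.L k * Z * (S.L k)ᴴ)).trace := fun Z => by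
      rw [jump_apply, hY, trace_traceAdjoint_mul]
    have hNh : Nᴴ = N := hN
    have hexp : (S.jumpDefect c N k * X * (S.jumpDefect c N k)ᴴ).trace =
        (c k : ℂ) ^ 2 * (S.L k * X * (S.L k)ᴴ).trace +
        2 * ((c k : ℂ) * (Y * (S.L k * X * (S.L k)ᴴ)).trace) -
        (c k : ℂ) * (S.L k * (N * X) * (S.L k)ᴴ).trace -
        (c k : ℂ) * (S.L k * (X * N) * (S.L k)ᴴ).trace -
        (Y * (S.L k * (N * X) * (S.L k)ᴴ)).trace - (Y * (S.L k * (X * N) * (S.L k)ᴴ)).trace +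
        (Y * Y * (S.L k * X * (S.L k)ᴴ)).trace + (S.L k * N * X * N * (S.L k)ᴴ).trace := by
      have t1 : ∀ Z, (Z * Y).trace = (Y * Z).trace := fun Z => Matrix.trace_mul_comm _ _
      have hd : (S.jumpDefect c N k)ᴴ =
          (c k : ℂ) • (S.L k)ᴴ + (S.L k)ᴴ * Y - N * (S.L k)ᴴ := by
        rw [jumpDefect, Matrix.conjTranspose_sub, Matrix.conjTranspose_mul,
          Matrix.conjTranspose_mul, Matrix.conjTranspose_add, Matrix.conjTranspose_smul, ← hY, hYh,
          hNh]
        simp [Matrix.mul_add]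
      have hd2 : S.jumpDefect c N k = (c k : ℂ) • S.L k + Y * S.L k - S.L k * N := by
        rw [jumpDefect, ← hY]; simp [Matrix.add_mul]
      have a1 : ((S.L k * X) * ((S.L k)ᴴ * Y)).trace = (Y * (S.L k * X * (S.L k)ᴴ)).trace := by
        rw [← Matrix.mul_assoc, t1]
      have a2 : ((Y * S.L k * X) * ((S.L k)ᴴ * Y)).trace =
          (Y * Y * (S.L k * X * (S.L k)ᴴ)).trace := by
        rw [← Matrix.mul_assoc, t1]; simp only [Matrix.mul_assoc]
      have a3 : ((S.L k * N * X) * ((S.L k)ᴴ * Y)).trace =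
          (Y * (S.L k * (N * X) * (S.L k)ᴴ)).trace := by
        rw [← Matrix.mul_assoc, t1]; simp only [Matrix.mul_assoc]
      rw [hd, hd2]
      simp only [Matrix.add_mul, Matrix.sub_mul, Matrix.mul_add, Matrix.mul_sub, Matrix.smul_mul,
        Matrix.mul_smul, Matrix.trace_add, Matrix.trace_sub, Matrix.trace_smul, smul_eq_mul, a1, a2,
        a3]
      simp only [Matrix.mul_assoc]
      ring
    have hexp' := congrArg Complex.re hexp
    simp only [Complex.sub_re, Complex.add_re, ← Complex.ofReal_pow, Complex.re_ofReal_mul] at hexp'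
    have h2 : ∀ z : ℂ, (2 * z).re = 2 * z.re := fun z => by simp
    simp only [h2, Complex.re_ofReal_mul] at hexp'
    rw [hexp', hYj, hYj, hYj]
    simp only [rate]
    linarith
  refine (Finset.sum_le_sum fun k _ => key k).trans_eq ?_
  simp only [Finset.sum_add_distrib, Finset.sum_sub_distrib, ← Finset.mul_sum]
  linarith

theorem hasDerivAt_moments_fst (c : K → ℝ) (t : ℝ) :
    HasDerivAt (fun t => (S.moments c t).1) (S.gen (S.moments c t).1) t :=
  (S.hasDerivAt_moments c t).fst

theorem hasDerivAt_moments_snd (c : K → ℝ) (t : ℝ) :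
    HasDerivAt (fun t => (S.moments c t).2.1)
      (S.gen (S.moments c t).2.1 + S.weightedJump c (S.moments c t).1) t :=
  HasFDerivAtFilter.fst (HasFDerivAtFilter.snd (S.hasDerivAt_moments c t))

theorem hasDerivAt_moments_trd (c : K → ℝ) (t : ℝ) :
    HasDerivAt (fun t => (S.moments c t).2.2)
      (S.gen (S.moments c t).2.2 + ((2 : ℂ) • S.weightedJump c (S.moments c t).2.1 +
        S.weightedJump (fun k => c k ^ 2) (S.moments c t).1)) t :=
  HasFDerivAtFilter.snd (HasFDerivAtFilter.snd (S.hasDerivAt_moments c t))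

/-- The conserved mean of the total current. -/
theorem re_trace_backward_zero (c : K → ℝ) {τ : ℝ} {N : ℝ → Matrix n n ℂ} (hNτ : N τ = 0)
    (hN : ∀ t, HasDerivAt N (-(traceAdjoint S.gen (N t) +
      traceAdjoint (S.weightedJump c) 1)) t) :
    (N 0 * S.ρ₀).trace.re = (S.moments c τ).2.1.trace.re := by
  have hd : ∀ t, HasDerivAt (fun t => (N t * (S.moments c t).1 + (S.moments c t).2.1).trace.re)
      0 t := by
    intro t
    have := (((hN t).mul (S.hasDerivAt_moments_fst c t)).add
      (S.hasDerivAt_moments_snd c t)).reTrace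
    refine this.congr_deriv ?_
    simp only [Matrix.neg_mul, Matrix.add_mul, Matrix.trace_add, Matrix.trace_neg,
      trace_traceAdjoint_mul, Matrix.one_mul, trace_gen]
    simp
  have h := is_const_of_deriv_eq_zero (fun t => (hd t).differentiableAt) (fun t => (hd t).deriv) 0 τ
  simpa [hNτ, moments_zero] using h

/-- A martingale decomposition of the variance: `v` below runs from at least `⟨J⟩²` at time `0` to
`⟨J²⟩` at time `τ`, and grows at least as fast as the defects. -/
theorem integral_defect_le (c : K → ℝ) {τ : ℝ} (hτ : 0 ≤ τ) {N : ℝ → Matrix n n ℂ}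
    (hNτ : N τ = 0) (hNh : ∀ t, (N t).IsHermitian)
    (hN : ∀ t, HasDerivAt N (-(traceAdjoint S.gen (N t) +
      traceAdjoint (S.weightedJump c) 1)) t)
    (hpos : ∀ t ∈ Set.Icc 0 τ, (S.moments c t).1.PosSemidef) {φ : ℝ → ℝ}
    (hφ : MeasureTheory.IntegrableOn φ (Set.Icc 0 τ))
    (hle : ∀ t ∈ Set.Ioo 0 τ, φ t ≤ ∑ k, (S.jumpDefect c (N t) k * (S.moments c t).1 *
      (S.jumpDefect c (N t) k)ᴴ).trace.re) :
    ∫ t in (0 : ℝ)..τ, φ t ≤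
      (S.moments c τ).2.2.trace.re - (S.moments c τ).2.1.trace.re ^ 2 := by
  -- The second moment of past current plus `N t`: the square is expanded with the past carried by
  -- the state-valued moments.
  set v : ℝ → ℝ := fun t => ((S.moments c t).2.2 + (N t * (S.moments c t).2.1 +
    N t * (S.moments c t).2.1) + N t * N t * (S.moments c t).1).trace.re with hv
  set v' : ℝ → ℝ := fun t =>
    (S.weightedJump (fun k => c k ^ 2) (S.moments c t).1).trace.re +
      2 * (N t * S.weightedJump c (S.moments c t).1).trace.re -
        (S.weightedJump c (N t * (S.moments c t).1)).trace.re -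
        (S.weightedJump c ((S.moments c t).1 * N t)).trace.re -
        (N t * S.gen (N t * (S.moments c t).1)).trace.re -
        (N t * S.gen ((S.moments c t).1 * N t)).trace.re +
        (N t * N t * S.gen (S.moments c t).1).trace.re with hv'
  have hd : ∀ t, HasDerivAt v (v' t) t := by
    intro t
    have := (((S.hasDerivAt_moments_trd c t).add
      (((hN t).mul (S.hasDerivAt_moments_snd c t)).add
      ((hN t).mul (S.hasDerivAt_moments_snd c t)))).add
      (((hN t).mul (hN t)).mul (S.hasDerivAt_moments_fst c t))).reTrace
    refine this.congr_deriv ?_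
    simp only [hv', Pi.mul_apply]
    set X := (S.moments c t).1
    set B := traceAdjoint (S.weightedJump c) 1
    have b1 : (N t * traceAdjoint S.gen (N t) * X).trace = (N t * S.gen (X * N t)).trace := by
      rw [Matrix.mul_assoc, Matrix.trace_mul_comm, Matrix.mul_assoc, trace_traceAdjoint_mul]
    have b2 : (N t * B * X).trace = (S.weightedJump c (X * N t)).trace := by
      rw [Matrix.mul_assoc, Matrix.trace_mul_comm, Matrix.mul_assoc, trace_traceAdjoint_mul,
        Matrix.one_mul]
    have b3 : (traceAdjoint S.gen (N t) * N t * X).trace = (N t * S.gen (N t * X)).trace := by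
      rw [Matrix.mul_assoc, trace_traceAdjoint_mul]
    have b4 : (B * N t * X).trace = (S.weightedJump c (N t * X)).trace := by
      rw [Matrix.mul_assoc, trace_traceAdjoint_mul, Matrix.one_mul]
    have b5 : ∀ Z, (B * Z).trace = (S.weightedJump c Z).trace := fun Z => by
      rw [trace_traceAdjoint_mul, Matrix.one_mul]
    simp only [Matrix.neg_mul, Matrix.mul_neg, Matrix.add_mul, Matrix.mul_add,
      Matrix.trace_add, Matrix.trace_neg, b1, b2, b3, b4, b5, trace_traceAdjoint_mul, trace_gen,
      Matrix.trace_smul, smul_eq_mul, Complex.add_re, Complex.neg_re, Complex.zero_re]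
    have h2 : ∀ z : ℂ, (2 * z).re = 2 * z.re := fun z => by simp
    rw [h2]
    ring
  have h1 := intervalIntegral.integral_le_sub_of_hasDeriv_right_of_le hτ
    (fun t _ => (hd t).continuousAt.continuousWithinAt) (fun t _ => (hd t).hasDerivWithinAt) hφ
    (fun t ht => (hle t ht).trans
      (S.sum_defect_le c (hNh t) (hpos t ⟨ht.1.le, ht.2.le⟩)))
  refine h1.trans ?_
  have hvτ : v τ = (S.moments c τ).2.2.trace.re := by simp [hv, hNτ]
  have hv0 : v 0 = (N 0 * N 0 * S.ρ₀).trace.re := by simp [hv, moments_zero]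
  have hsq : (S.moments c τ).2.1.trace.re ^ 2 ≤ v 0 := by
    rw [hv0, ← S.re_trace_backward_zero c hNτ hN]
    set a := (N 0 * S.ρ₀).trace.re
    -- Nonnegativity of the variance of `N 0` in the initial state, whose mean `a` is the mean
    -- current.
    have hpos := S.posSemidef_ρ₀.mul_mul_conjTranspose_same (N 0 - (a : ℂ) • 1)
    have h := (Complex.nonneg_iff.1 hpos.trace_nonneg).1
    rw [Matrix.conjTranspose_sub, hNh 0, Matrix.conjTranspose_smul, Matrix.conjTranspose_one] at h
    simp only [Matrix.sub_mul, Matrix.mul_sub, Matrix.smul_mul, Matrix.mul_smul, Matrix.one_mul,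
      Matrix.mul_one, Matrix.trace_sub, Matrix.trace_smul, Complex.star_def, Complex.conj_ofReal,
      smul_eq_mul, Complex.sub_re, Complex.re_ofReal_mul, S.trace_ρ₀] at h
    have c1 : (N 0 * S.ρ₀ * N 0).trace = (N 0 * N 0 * S.ρ₀).trace := by
      rw [Matrix.trace_mul_comm, ← Matrix.mul_assoc]
    have c2 : (S.ρ₀ * N 0).trace.re = a := by rw [Matrix.trace_mul_comm]
    rw [c1, c2] at h
    simp only [Complex.one_re] at h
    change 0 ≤ _ - a * a - a * (a - a * 1) at h
    linarith
  rw [hvτ]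
  linarith

end FeedbackSystem

/-! ### Linear response of the perturbed dynamics. -/

theorem intervalIntegrable_bdd_smul {E : Type*} [NormedAddCommGroup E] [NormedSpace ℝ E] {τ : ℝ}
    (hτ : 0 ≤ τ) {g : ℝ → ℝ} {F : ℝ → E}
    (hg : MeasureTheory.AEStronglyMeasurable g
      (MeasureTheory.volume.restrict (Set.Icc 0 τ)))
    (hb : ∀ t ∈ Set.Icc 0 τ, |g t| ≤ 1) (hF : ContinuousOn F (Set.Icc 0 τ)) :
    IntervalIntegrable (fun t => g t • F t) MeasureTheory.volume 0 τ := by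
  rw [intervalIntegrable_iff_integrableOn_Icc_of_le hτ]
  have hFi : MeasureTheory.IntegrableOn F (Set.Icc 0 τ) := hF.integrableOn_Icc
  refine MeasureTheory.Integrable.mono hFi (hg.smul hFi.aestronglyMeasurable) ?_
  filter_upwards [MeasureTheory.ae_restrict_mem measurableSet_Icc] with t ht
  rw [norm_smul]
  exact mul_le_of_le_one_left (norm_nonneg _) (hb t ht)

namespace FeedbackSystem

variable {n K : Type*} [Fintype n] [DecidableEq n] [Fintype K] (S : FeedbackSystem n K)

/-- Contribution of the channel `k` to the generator. -/
def dissipator (k : K) : Matrix n n ℂ →ₗ[ℂ] Matrix n n ℂ :=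
  S.jump k - (1 / 2 : ℂ) • (LinearMap.mulLeft ℂ ((S.L k)ᴴ * S.L k) +
    LinearMap.mulRight ℂ ((S.L k)ᴴ * S.L k))

theorem dissipator_apply (k : K) (X : Matrix n n ℂ) :
    S.dissipator k X = S.F k (S.L k * X * (S.L k)ᴴ) -
      (1 / 2 : ℂ) • ((S.L k)ᴴ * S.L k * X + X * ((S.L k)ᴴ * S.L k)) := by
  simp [dissipator, jump_apply, Matrix.mul_assoc]

theorem rate_nonneg {X : Matrix n n ℂ} (hX : X.PosSemidef) (k : K) : 0 ≤ S.rate X k :=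
  (Complex.nonneg_iff.1 (hX.mul_mul_conjTranspose_same (S.L k)).trace_nonneg).1

/-- With `X = B B†` and `B` invertible, a vanishing rate forces `L_k B = 0`, hence `L_k = 0`. So at
full rank the log ratios of nonzero channels involve positive rates only. -/
theorem rate_pos {X : Matrix n n ℂ} (hX : X.PosDef) {k : K} (hk : S.L k ≠ 0) :
    0 < S.rate X k := by
  refine lt_of_le_of_ne (S.rate_nonneg hX.posSemidef k) fun h => hk ?_
  have hps := hX.posSemidef.mul_mul_conjTranspose_same (S.L k)
  have him := (Complex.nonneg_iff.1 hps.trace_nonneg).2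
  have htr : (S.L k * X * (S.L k)ᴴ).trace = 0 := Complex.ext h.symm him.symm
  have hzero := hps.trace_eq_zero_iff.1 htr
  obtain ⟨B, hBu, hB⟩ : ∃ B : Matrix n n ℂ, IsUnit B ∧ X = B * Bᴴ := by
    obtain ⟨B, hB⟩ : ∃ B : Matrix n n ℂ, X = Bᴴ * B := by
      open scoped MatrixOrder in
      obtain ⟨B, hB⟩ := CStarAlgebra.nonneg_iff_eq_star_mul_self.1 hX.posSemidef.nonneg
      exact ⟨B, hB⟩
    refine ⟨Bᴴ, ?_, by simpa using hB⟩
    have := hX.isUnit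
    rw [hB] at this
    rw [Matrix.isUnit_iff_isUnit_det, Matrix.det_mul] at this
    rw [Matrix.isUnit_iff_isUnit_det]
    exact isUnit_of_mul_isUnit_left this
  have h2 : (S.L k * B) * (S.L k * B)ᴴ = 0 := by
    rw [← hzero, hB, Matrix.conjTranspose_mul]
    simp only [Matrix.mul_assoc]
  rw [Matrix.self_mul_conjTranspose_eq_zero] at h2
  exact (hBu.mul_left_eq_zero).1 h2

theorem L_rev (k : K) : S.L (S.rev k) = (Real.exp (-S.Δs k / 2) : ℂ) • (S.L k)ᴴ := by
  have h : (S.L k)ᴴ = (Real.exp (S.Δs k / 2) : ℂ) • S.L (S.rev k) := by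
    conv_lhs => rw [S.localDetailedBalance k, Matrix.conjTranspose_smul,
      Matrix.conjTranspose_conjTranspose, Complex.star_def, Complex.conj_ofReal]
  rw [h, smul_smul, ← Complex.ofReal_mul, ← Real.exp_add]
  rw [show -S.Δs k / 2 + S.Δs k / 2 = 0 by ring]
  simp

theorem L_rev_ne_zero {k : K} (hk : S.L k ≠ 0) : S.L (S.rev k) ≠ 0 := by
  intro h
  apply hk
  rw [S.localDetailedBalance k, h]
  simp

theorem rate_eq_zero {k : K} (hk : S.L k = 0) (X : Matrix n n ℂ) : S.rate X k = 0 := by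
  simp [rate, hk]

theorem rate_rev_eq_zero {k : K} (hk : S.L k = 0) (X : Matrix n n ℂ) :
    S.rate X (S.rev k) = 0 := by
  simp [rate, S.L_rev, hk]

theorem abs_bias_le_one {X : Matrix n n ℂ} (hX : X.PosSemidef) (k : K) : |S.bias X k| ≤ 1 := by
  have h1 := S.rate_nonneg hX k
  have h2 := S.rate_nonneg hX (S.rev k)
  rw [bias, abs_div, abs_of_nonneg (add_nonneg h1 h2)]
  refine div_le_one_of_le₀ ?_ (add_nonneg h1 h2)
  rw [abs_le]
  constructor <;> linarith

theorem continuous_rate (k : K) : Continuous fun X : Matrix n n ℂ => S.rate X k := by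
  have : (fun X : Matrix n n ℂ => S.rate X k) = fun X => reTrace n (realCLM (S.jump k) X) := by
    funext X
    rw [rate_eq_trace_jump]; rfl
  rw [this]
  exact (reTrace n).continuous.comp (realCLM (S.jump k)).continuous

/-- A nonzero channel and its reverse both have positive rates at full rank; for a zero channel the
quotient is `0 / 0 = 0` identically. -/
theorem continuousAt_bias {X : Matrix n n ℂ} (hX : X.PosDef) (k : K) :
    ContinuousAt (fun X : Matrix n n ℂ => S.bias X k) X := by
  by_cases hk : S.L k = 0
  · have : (fun X : Matrix n n ℂ => S.bias X k) = fun _ => 0 := by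
      funext Y
      simp [bias, S.rate_eq_zero hk, S.rate_rev_eq_zero hk]
    rw [this]
    exact continuousAt_const
  · have h1 := (S.continuous_rate k).continuousAt (x := X)
    have h2 := (S.continuous_rate (S.rev k)).continuousAt (x := X)
    exact (h1.sub h2).div (h1.add h2)
      (add_pos (S.rate_pos hX hk) (S.rate_pos hX (S.L_rev_ne_zero hk))).ne'

theorem aestronglyMeasurable_bias {ρ : ℝ → Matrix n n ℂ} {τ : ℝ}
    (hρ : ContinuousOn ρ (Set.Icc 0 τ)) (k : K) :
    MeasureTheory.AEStronglyMeasurable (fun t => S.bias (ρ t) k)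
      (MeasureTheory.volume.restrict (Set.Icc 0 τ)) := by
  have h : ∀ k, AEMeasurable (fun t => S.rate (ρ t) k)
      (MeasureTheory.volume.restrict (Set.Icc 0 τ)) := fun k =>
    ((S.continuous_rate k).comp_continuousOn hρ).aemeasurable measurableSet_Icc
  exact (((h k).sub (h _)).div ((h k).add (h _))).aestronglyMeasurable

/-- The perturbation of the generator, for a given bias of the channels. -/
def perturbation (ℓ : K → ℝ) (X : Matrix n n ℂ) : Matrix n n ℂ :=
  ∑ k, ℓ k • realCLM (S.dissipator k) X

/-- Each jump operator occurs together with its adjoint, so the square roots multiply to `1 + ℓ_k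
θ`, nonnegative by the two bounds: the generator is exactly affine in `θ`. -/
theorem generator_perturbed {ℓ : K → ℝ} (hℓ : ∀ k, |ℓ k| ≤ 1) {θ : ℝ}
    (hθ : θ ∈ Set.Ioo (-1 : ℝ) 1) (X : Matrix n n ℂ) :
    S.generator (fun k => (Real.sqrt (1 + ℓ k * θ) : ℂ) • S.L k) X =
      S.gen X + θ • S.perturbation ℓ X := by
  have hs : ∀ k, (Real.sqrt (1 + ℓ k * θ) : ℂ) * (Real.sqrt (1 + ℓ k * θ) : ℂ) =
      1 + (ℓ k : ℂ) * θ := by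
    intro k
    have h0 : 0 ≤ 1 + ℓ k * θ := by
      have : |ℓ k * θ| ≤ 1 := by
        rw [abs_mul]
        exact mul_le_one₀ (hℓ k) (abs_nonneg _) (abs_le.2 ⟨hθ.1.le, hθ.2.le⟩)
      linarith [(abs_le.1 this).1]
    exact_mod_cast Real.mul_self_sqrt h0
  have e : ∀ (r : ℝ) (Z : Matrix n n ℂ), r • Z = (r : ℂ) • Z := fun r Z =>
    (Complex.coe_smul r Z).symm
  rw [gen_apply, generator, generator, perturbation, Finset.smul_sum, add_assoc,
    ← Finset.sum_add_distrib]
  congr 1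
  refine Finset.sum_congr rfl fun k _ => ?_
  rw [realCLM_apply, dissipator_apply, Matrix.conjTranspose_smul]
  simp only [Matrix.smul_mul, Matrix.mul_smul, smul_smul, Complex.star_def, Complex.conj_ofReal,
    hs, map_smul, e]
  module

/-- The unperturbed state. -/
def state (t : ℝ) : Matrix n n ℂ := NormedSpace.exp (t • realCLM S.gen) S.ρ₀

theorem IsEvolution.eq_state {S : FeedbackSystem n K} {τ : ℝ} {ρ : ℝ → Matrix n n ℂ}
    (hρ : S.IsEvolution τ ρ) {t : ℝ} (ht : t ∈ Set.Icc 0 τ) : ρ t = S.state t := by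
  rw [state, ← hρ.1]
  exact eq_flow (A := realCLM S.gen) hρ.2 ht

theorem hasDerivAt_state (t : ℝ) : HasDerivAt S.state (S.gen (S.state t)) t :=
  hasDerivAt_flow (realCLM S.gen) S.ρ₀ t

theorem continuous_state : Continuous S.state := continuous_flow _ _

theorem moments_fst_eq_state (c : K → ℝ) {t : ℝ} (ht : 0 ≤ t) : (S.moments c t).1 = S.state t := by
  have h := eq_flow (A := realCLM S.gen) (u := fun t => (S.moments c t).1) (τ := t)
    (fun s _ => (S.hasDerivAt_moments_fst c s).hasDerivWithinAt) ⟨ht, le_rfl⟩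
  rw [moments_zero] at h
  exact h

/-- The integrand of Duhamel's formula for the perturbed state. -/
def duhamelIntegrand (ρ ρθ : ℝ → Matrix n n ℂ) (s : ℝ) : Matrix n n ℂ :=
  NormedSpace.exp ((-s) • realCLM S.gen) (S.perturbation (fun k => S.bias (ρ s) k) (ρθ s))

theorem continuous_exp_neg :
    Continuous fun s : ℝ => NormedSpace.exp ((-s) • realCLM S.gen) := by
  have : Continuous fun s : ℝ => NormedSpace.exp (s • realCLM S.gen) :=
    continuous_iff_continuousAt.2 fun t =>
      (hasDerivAt_exp_smul_const (𝕂 := ℝ) (realCLM S.gen) t).continuousAt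
  exact this.comp continuous_neg

theorem intervalIntegrable_duhamelIntegrand {ρ ρθ : ℝ → Matrix n n ℂ} {τ : ℝ} (hτ : 0 ≤ τ)
    (hρ : ContinuousOn ρ (Set.Icc 0 τ)) (hpos : ∀ t ∈ Set.Icc 0 τ, (ρ t).PosSemidef)
    (hρθ : ContinuousOn ρθ (Set.Icc 0 τ)) :
    IntervalIntegrable (S.duhamelIntegrand ρ ρθ) MeasureTheory.volume 0 τ := by
  have e : S.duhamelIntegrand ρ ρθ = fun s => ∑ k, S.bias (ρ s) k •
      NormedSpace.exp ((-s) • realCLM S.gen) (realCLM (S.dissipator k) (ρθ s)) := by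
    funext s
    simp only [duhamelIntegrand, perturbation, map_sum, map_smul]
  have e2 : (fun s => ∑ k, S.bias (ρ s) k •
      NormedSpace.exp ((-s) • realCLM S.gen) (realCLM (S.dissipator k) (ρθ s))) = ∑ k, fun s =>
      S.bias (ρ s) k •
        NormedSpace.exp ((-s) • realCLM S.gen) (realCLM (S.dissipator k) (ρθ s)) := by
    funext s
    rw [Finset.sum_apply]
  rw [e, e2]
  refine IntervalIntegrable.sum _ fun k _ => ?_
  refine intervalIntegrable_bdd_smul hτ (S.aestronglyMeasurable_bias hρ k)
    (fun t ht => S.abs_bias_le_one (hpos t ht) k) ?_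
  exact S.continuous_exp_neg.continuousOn.clm_apply
    ((realCLM (S.dissipator k)).continuous.comp_continuousOn hρθ)

/-- Total norm of the dissipators. -/
def dissipatorNorm : ℝ := ∑ k, ‖realCLM (S.dissipator k)‖

theorem dissipatorNorm_nonneg : 0 ≤ S.dissipatorNorm := Finset.sum_nonneg fun _ _ => norm_nonneg _

theorem norm_perturbation_le {ℓ : K → ℝ} (hℓ : ∀ k, |ℓ k| ≤ 1) (X : Matrix n n ℂ) :
    ‖S.perturbation ℓ X‖ ≤ S.dissipatorNorm * ‖X‖ := by
  rw [perturbation, dissipatorNorm, Finset.sum_mul]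
  refine (norm_sum_le _ _).trans (Finset.sum_le_sum fun k _ => ?_)
  rw [norm_smul]
  exact (mul_le_of_le_one_left (norm_nonneg _) (hℓ k)).trans (ContinuousLinearMap.le_opNorm _ _)

theorem perturbation_sub (ℓ : K → ℝ) (X Y : Matrix n n ℂ) :
    S.perturbation ℓ (X - Y) = S.perturbation ℓ X - S.perturbation ℓ Y := by
  simp only [perturbation, map_sub, smul_sub, Finset.sum_sub_distrib]

/-- Duhamel's formula for the perturbed state. -/
theorem IsPerturbedEvolution.eq_duhamel {S : FeedbackSystem n K} {τ : ℝ} (hτ : 0 ≤ τ)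
    {ρ ρθ : ℝ → Matrix n n ℂ} (hρ : ContinuousOn ρ (Set.Icc 0 τ))
    (hpos : ∀ t ∈ Set.Icc 0 τ, (ρ t).PosSemidef) {θ : ℝ} (hθ : θ ∈ Set.Ioo (-1 : ℝ) 1)
    (h : S.IsPerturbedEvolution τ ρ θ ρθ) {t : ℝ} (ht : t ∈ Set.Icc 0 τ) :
    ρθ t = S.state t + θ • NormedSpace.exp (t • realCLM S.gen)
      (∫ s in (0 : ℝ)..t, S.duhamelIntegrand ρ ρθ s) := by
  have hc : ContinuousOn ρθ (Set.Icc 0 τ) := fun s hs => (h.2 s hs).continuousWithinAt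
  have hu : ∀ s ∈ Set.Icc 0 τ, HasDerivWithinAt ρθ (realCLM S.gen (ρθ s) +
      θ • S.perturbation (fun k => S.bias (ρ s) k) (ρθ s)) (Set.Icc 0 τ) s := fun s hs => by
    rw [realCLM_apply, ← S.generator_perturbed (fun k => S.abs_bias_le_one (hpos s hs) k) hθ]
    exact h.2 s hs
  have hint := (S.intervalIntegrable_duhamelIntegrand hτ hρ hpos hc).smul θ
  have e : (fun s => NormedSpace.exp ((-s) • realCLM S.gen)
      (θ • S.perturbation (fun k => S.bias (ρ s) k) (ρθ s))) =
      fun s => θ • S.duhamelIntegrand ρ ρθ s := by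
    funext s
    rw [map_smul]; rfl
  have hd := duhamel hu (by rw [e]; exact hint) ht
  rw [hd, h.1, e, intervalIntegral.integral_smul, map_add, map_smul, state]

theorem IsPerturbedEvolution.norm_le {S : FeedbackSystem n K} {τ : ℝ}
    {ρ ρθ : ℝ → Matrix n n ℂ} (hpos : ∀ t ∈ Set.Icc 0 τ, (ρ t).PosSemidef) {θ : ℝ}
    (hθ : θ ∈ Set.Ioo (-1 : ℝ) 1) (h : S.IsPerturbedEvolution τ ρ θ ρθ) {t : ℝ}
    (ht : t ∈ Set.Icc 0 τ) :
    ‖ρθ t‖ ≤ ‖S.ρ₀‖ * Real.exp ((‖realCLM S.gen‖ + S.dissipatorNorm) * τ) := by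
  have hK : 0 ≤ ‖realCLM S.gen‖ + S.dissipatorNorm :=
    add_nonneg (norm_nonneg _) S.dissipatorNorm_nonneg
  have hg := norm_le_gronwallBound_of_norm_deriv_right_le (f := ρθ) (a := 0) (b := τ)
    (f' := fun s => S.generator (fun k => (Real.sqrt (1 + S.bias (ρ s) k * θ) : ℂ) • S.L k) (ρθ s))
    (δ := ‖S.ρ₀‖) (K := ‖realCLM S.gen‖ + S.dissipatorNorm) (ε := 0)
    (fun s hs => (h.2 s hs).continuousWithinAt)
    (fun s hs => (h.2 s ⟨hs.1, hs.2.le⟩).mono_of_mem_nhdsWithin (Icc_mem_nhdsGE_of_mem hs))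
    (by rw [h.1]) (fun s hs => ?_) t ht
  · rw [gronwallBound_ε0, sub_zero] at hg
    refine hg.trans (mul_le_mul_of_nonneg_left (Real.exp_le_exp.2 ?_) (norm_nonneg _))
    exact mul_le_mul_of_nonneg_left ht.2 hK
  · have hb := fun k => S.abs_bias_le_one (hpos s ⟨hs.1, hs.2.le⟩) k
    rw [S.generator_perturbed hb hθ, add_zero, add_mul]
    refine (norm_add_le _ _).trans (add_le_add ((realCLM S.gen).le_opNorm _) ?_)
    rw [norm_smul]
    exact (mul_le_of_le_one_left (norm_nonneg _) (abs_le.2 ⟨hθ.1.le, hθ.2.le⟩)).trans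
      (S.norm_perturbation_le hb _)

theorem norm_exp_neg_le {s τ : ℝ} (hs : s ∈ Set.Icc 0 τ) :
    ‖NormedSpace.exp ((-s) • realCLM S.gen)‖ ≤ Real.exp (τ * ‖realCLM S.gen‖) := by
  have := norm_exp_smul_le (-realCLM S.gen) hs.1
  rw [norm_neg, smul_neg, ← neg_smul] at this
  exact this.trans (Real.exp_le_exp.2 (mul_le_mul_of_nonneg_right hs.2 (norm_nonneg _)))

theorem norm_integral_duhamel_le {τ : ℝ} {ρ ρ' : ℝ → Matrix n n ℂ}
    (hpos : ∀ t ∈ Set.Icc 0 τ, (ρ t).PosSemidef) {C : ℝ} (hC : ∀ t ∈ Set.Icc 0 τ, ‖ρ' t‖ ≤ C)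
    {t : ℝ} (ht : t ∈ Set.Icc 0 τ) :
    ‖∫ s in (0 : ℝ)..t, S.duhamelIntegrand ρ ρ' s‖ ≤
      Real.exp (τ * ‖realCLM S.gen‖) * (S.dissipatorNorm * C) * τ := by
  have hC0 : 0 ≤ C := (norm_nonneg _).trans (hC t ht)
  have h := intervalIntegral.norm_integral_le_of_norm_le_const (a := 0) (b := t)
    (f := S.duhamelIntegrand ρ ρ')
    (C := Real.exp (τ * ‖realCLM S.gen‖) * (S.dissipatorNorm * C)) (fun s hs => ?_)
  · refine h.trans ?_
    rw [sub_zero, abs_of_nonneg ht.1]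
    refine mul_le_mul_of_nonneg_left ht.2 ?_
    have := S.dissipatorNorm_nonneg
    positivity
  · rw [Set.uIoc_of_le ht.1] at hs
    have hs' : s ∈ Set.Icc 0 τ := ⟨hs.1.le, hs.2.trans ht.2⟩
    refine (ContinuousLinearMap.le_opNorm _ _).trans
      (mul_le_mul (S.norm_exp_neg_le hs') ?_ (norm_nonneg _) (Real.exp_pos _).le)
    exact (S.norm_perturbation_le (fun k => S.abs_bias_le_one (hpos s hs') k) _).trans
      (mul_le_mul_of_nonneg_left (hC s hs') S.dissipatorNorm_nonneg)

/-- The first order response in closed form. -/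
def linearResponse (ρ : ℝ → Matrix n n ℂ) (t : ℝ) : Matrix n n ℂ :=
  NormedSpace.exp (t • realCLM S.gen) (∫ s in (0 : ℝ)..t, S.duhamelIntegrand ρ ρ s)

/-- By Duhamel the slope in `θ` is the linear response formula with `ρ` replaced by `ρp θ`. A
Grönwall bound uniform in `θ` gives `ρp θ - ρ = O(θ)`, and inserting this once more bounds the error
of the slope by `O(θ)`. -/
theorem hasDerivAt_perturbed {τ : ℝ} {ρ : ℝ → Matrix n n ℂ}
    (hρ : S.IsEvolution τ ρ) (hpos : ∀ t ∈ Set.Icc 0 τ, (ρ t).PosSemidef)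
    {ρp : ℝ → ℝ → Matrix n n ℂ}
    (hρp : ∀ θ ∈ Set.Ioo (-1 : ℝ) 1, S.IsPerturbedEvolution τ ρ θ (ρp θ)) {t : ℝ}
    (ht : t ∈ Set.Icc 0 τ) :
    HasDerivAt (fun θ => ρp θ t) (S.linearResponse ρ t) 0 := by
  have hτ : 0 ≤ τ := ht.1.trans ht.2
  have hc : ContinuousOn ρ (Set.Icc 0 τ) := fun s hs => (hρ.2 s hs).continuousWithinAt
  have hρc : ∀ θ ∈ Set.Ioo (-1 : ℝ) 1, ContinuousOn (ρp θ) (Set.Icc 0 τ) := fun θ hθ s hs =>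
    ((hρp θ hθ).2 s hs).continuousWithinAt
  set C := ‖S.ρ₀‖ * Real.exp ((‖realCLM S.gen‖ + S.dissipatorNorm) * τ)
  set b := Real.exp (τ * ‖realCLM S.gen‖) with hb
  have hexp : ∀ s ∈ Set.Icc 0 τ, ‖NormedSpace.exp (s • realCLM S.gen)‖ ≤ b := fun s hs =>
    (norm_exp_smul_le _ hs.1).trans
      (Real.exp_le_exp.2 (mul_le_mul_of_nonneg_right hs.2 (norm_nonneg _)))
  have hdiff : ∀ θ ∈ Set.Ioo (-1 : ℝ) 1, ∀ s ∈ Set.Icc 0 τ,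
      ‖ρp θ s - ρ s‖ ≤ |θ| * (b * (b * (S.dissipatorNorm * C) * τ)) := by
    intro θ hθ s hs
    rw [(hρp θ hθ).eq_duhamel hτ hc hpos hθ hs, hρ.eq_state hs, add_sub_cancel_left, norm_smul,
      Real.norm_eq_abs]
    refine mul_le_mul_of_nonneg_left ?_ (abs_nonneg _)
    refine (ContinuousLinearMap.le_opNorm _ _).trans (mul_le_mul (hexp s hs) ?_ (norm_nonneg _)
      (Real.exp_pos _).le)
    exact S.norm_integral_duhamel_le hpos (fun r hr => (hρp θ hθ).norm_le hpos hθ hr) hs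
  have h0 : ρp 0 t = S.state t := by
    rw [(hρp 0 (by simp)).eq_duhamel hτ hc hpos (by simp) ht, zero_smul, add_zero]
  rw [hasDerivAt_iff_tendsto_slope, tendsto_iff_norm_sub_tendsto_zero]
  have hbound : ∀ᶠ θ : ℝ in 𝓝[≠] 0, ‖slope (fun θ => ρp θ t) 0 θ - S.linearResponse ρ t‖ ≤
      |θ| * (b * (b * (S.dissipatorNorm * (b * (b * (S.dissipatorNorm * C) * τ))) * τ)) := by
    have hnear : ∀ᶠ θ : ℝ in 𝓝[≠] 0, θ ∈ Set.Ioo (-1 : ℝ) 1 :=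
      nhdsWithin_le_nhds (Ioo_mem_nhds (by norm_num) (by norm_num))
    filter_upwards [hnear, self_mem_nhdsWithin] with θ hθ hθ0
    have hθ0 : θ ≠ 0 := hθ0
    have e1 : slope (fun θ => ρp θ t) 0 θ = NormedSpace.exp (t • realCLM S.gen)
        (∫ s in (0 : ℝ)..t, S.duhamelIntegrand ρ (ρp θ) s) := by
      rw [slope_def_module, h0, (hρp θ hθ).eq_duhamel hτ hc hpos hθ ht, add_sub_cancel_left,
        sub_zero, smul_smul, inv_mul_cancel₀ hθ0, one_smul]
    have hsub : Set.uIcc 0 t ⊆ Set.uIcc 0 τ := by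
      rw [Set.uIcc_of_le ht.1, Set.uIcc_of_le hτ]
      exact Set.Icc_subset_Icc_right ht.2
    have e2 : slope (fun θ => ρp θ t) 0 θ - S.linearResponse ρ t =
        NormedSpace.exp (t • realCLM S.gen)
          (∫ s in (0 : ℝ)..t, S.duhamelIntegrand ρ (fun s => ρp θ s - ρ s) s) := by
      rw [e1, linearResponse, ← map_sub, ← intervalIntegral.integral_sub
        ((S.intervalIntegrable_duhamelIntegrand hτ hc hpos (hρc θ hθ)).mono_set hsub)
        ((S.intervalIntegrable_duhamelIntegrand hτ hc hpos hc).mono_set hsub)]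
      simp only [duhamelIntegrand, perturbation_sub, map_sub]
    rw [e2]
    refine (ContinuousLinearMap.le_opNorm _ _).trans ((mul_le_mul (hexp t ht)
      (S.norm_integral_duhamel_le hpos (hdiff θ hθ) ht) (norm_nonneg _)
      (Real.exp_pos _).le).trans_eq ?_)
    ring
  refine squeeze_zero' (Eventually.of_forall fun _ => norm_nonneg _) hbound ?_
  have : Continuous fun θ : ℝ => |θ| *
      (b * (b * (S.dissipatorNorm * (b * (b * (S.dissipatorNorm * C) * τ))) * τ)) := by fun_prop
  have h2 := (this.tendsto 0).mono_left (nhdsWithin_le_nhds (s := {0}ᶜ))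
  simpa using h2

theorem continuousOn_linearResponse {τ : ℝ} (hτ : 0 ≤ τ) {ρ : ℝ → Matrix n n ℂ}
    (hρ : ContinuousOn ρ (Set.Icc 0 τ)) (hpos : ∀ t ∈ Set.Icc 0 τ, (ρ t).PosSemidef) :
    ContinuousOn (S.linearResponse ρ) (Set.Icc 0 τ) := by
  have h1 := intervalIntegral.continuousOn_primitive_interval'
    (S.intervalIntegrable_duhamelIntegrand hτ hρ hpos hρ) Set.left_mem_uIcc
  rw [Set.uIcc_of_le hτ] at h1
  have h2 : Continuous fun s : ℝ => NormedSpace.exp (s • realCLM S.gen) :=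
    continuous_iff_continuousAt.2 fun t =>
      (hasDerivAt_exp_smul_const (𝕂 := ℝ) (realCLM S.gen) t).continuousAt
  exact h2.continuousOn.clm_apply h1

/-- Restricted to interior times: there full rank makes the biases, hence the Duhamel integrand,
continuous. -/
theorem hasDerivAt_linearResponse {τ : ℝ} {ρ : ℝ → Matrix n n ℂ}
    (hρ : ContinuousOn ρ (Set.Icc 0 τ)) (hpos : ∀ t ∈ Set.Icc 0 τ, (ρ t).PosSemidef)
    (hfull : ∀ t ∈ Set.Ioo 0 τ, (ρ t).PosDef) {t : ℝ} (ht : t ∈ Set.Ioo 0 τ) :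
    HasDerivAt (S.linearResponse ρ) (S.gen (S.linearResponse ρ t) +
      S.perturbation (fun k => S.bias (ρ t) k) (ρ t)) t := by
  have hτ : 0 ≤ τ := (ht.1.trans ht.2).le
  have hcont : ContinuousOn (S.duhamelIntegrand ρ ρ) (Set.Ioo 0 τ) := by
    refine S.continuous_exp_neg.continuousOn.clm_apply ?_
    refine continuousOn_finsetSum _ fun k _ => ContinuousOn.fun_smul ?_ ?_
    · intro s hs
      exact (S.continuousAt_bias (hfull s hs) k).comp_continuousWithinAt
        ((hρ s ⟨hs.1.le, hs.2.le⟩).mono Set.Ioo_subset_Icc_self)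
    · exact (realCLM (S.dissipator k)).continuous.comp_continuousOn
        (hρ.mono Set.Ioo_subset_Icc_self)
  have hsub : Set.uIcc 0 t ⊆ Set.uIcc 0 τ := by
    rw [Set.uIcc_of_le ht.1.le, Set.uIcc_of_le hτ]
    exact Set.Icc_subset_Icc_right ht.2.le
  have h1 := intervalIntegral.integral_hasDerivAt_right
    ((S.intervalIntegrable_duhamelIntegrand hτ hρ hpos hρ).mono_set hsub)
    (hcont.stronglyMeasurableAtFilter isOpen_Ioo t ht)
    (hcont.continuousAt (isOpen_Ioo.mem_nhds ht))
  have h2 := (hasDerivAt_exp_smul_const' (𝕂 := ℝ) (realCLM S.gen) t).clm_apply h1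
  refine h2.congr_deriv ?_
  rw [mul_apply_eq_comp]
  congr 1
  rw [duhamelIntegrand, ← mul_apply_eq_comp]
  let _ : NormedAlgebra ℚ (Matrix n n ℂ →L[ℝ] Matrix n n ℂ) := .restrictScalars ℚ ℝ _
  rw [← NormedSpace.exp_add_of_commute
    ((Commute.refl (realCLM S.gen)).smul_left t |>.smul_right (-t)),
    ← add_smul, add_neg_cancel, zero_smul, NormedSpace.exp_zero, one_apply_eq_self]

theorem linearResponse_zero (ρ : ℝ → Matrix n n ℂ) : S.linearResponse ρ 0 = 0 := by
  simp [linearResponse]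

end FeedbackSystem

/-! ### Bounds on entropy and on the logarithm of the state. -/

section

variable {n : Type*} [Fintype n] [DecidableEq n]

theorem abs_re_trace_le (X : Matrix n n ℂ) : |X.trace.re| ≤ ‖reTrace n‖ * ‖X‖ :=
  (reTrace n).le_opNorm X

theorem Matrix.PosSemidef.eigenvalues_le_one {X : Matrix n n ℂ} (hX : X.PosSemidef)
    (htr : X.trace = 1) (i : n) : hX.1.eigenvalues i ≤ 1 := by
  have h1 : ∑ i, hX.1.eigenvalues i = 1 := by
    have := hX.1.trace_eq_sum_eigenvalues
    rw [htr] at this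
    have h := congrArg Complex.re this
    simpa using h.symm
  rw [← h1]
  exact Finset.single_le_sum (fun j _ => hX.eigenvalues_nonneg j) (Finset.mem_univ i)

theorem abs_vonNeumannEntropy_le {X : Matrix n n ℂ} (hX : X.PosSemidef) (htr : X.trace = 1) :
    |vonNeumannEntropy X| ≤ ‖reTrace n‖ := by
  rw [vonNeumannEntropy_eq_cfc hX.1]
  have h : ‖cfc Real.negMulLog X‖ ≤ 1 := by
    refine norm_cfc_le zero_le_one fun x hx => ?_
    rw [hX.1.spectrum_real_eq_range_eigenvalues] at hx
    obtain ⟨i, rfl⟩ := hx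
    have h0 := hX.eigenvalues_nonneg i
    have h1 := hX.eigenvalues_le_one htr i
    rw [Real.norm_eq_abs, abs_of_nonneg (Real.negMulLog_nonneg h0 h1), Real.negMulLog]
    rcases h0.lt_or_eq with h | h
    · have := Real.mul_log_sub_nonneg h one_pos
      rw [Real.log_one] at this
      linarith
    · rw [← h]; simp
  exact (abs_re_trace_le _).trans (mul_le_of_le_one_right (norm_nonneg _) h)

/-- With unit trace all eigenvalues are at most `1`, so the numbers `-log λ_i` are nonnegative and
each is at most their sum, `-log det X`. -/
theorem Matrix.PosDef.norm_log_le {X : Matrix n n ℂ} (hX : X.PosDef) (htr : X.trace = 1) :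
    ‖cfc Real.log X‖ ≤ -Real.log ‖X.det‖ := by
  have hdet : ‖X.det‖ = ∏ i, hX.1.eigenvalues i := by
    rw [hX.1.det_eq_prod_eigenvalues, norm_prod]
    refine Finset.prod_congr rfl fun i _ => ?_
    rw [RCLike.norm_ofReal, abs_of_pos (hX.eigenvalues_pos i)]
  have hlog : -Real.log ‖X.det‖ = ∑ i, -Real.log (hX.1.eigenvalues i) := by
    rw [hdet, Real.log_prod fun i _ => (hX.eigenvalues_pos i).ne', Finset.sum_neg_distrib]
  have hnn : ∀ i, 0 ≤ -Real.log (hX.1.eigenvalues i) := fun i => by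
    have := Real.log_nonpos (hX.eigenvalues_pos i).le (hX.posSemidef.eigenvalues_le_one htr i)
    linarith
  rw [hlog]
  refine norm_cfc_le (Finset.sum_nonneg fun i _ => hnn i) fun x hx => ?_
  rw [hX.1.spectrum_real_eq_range_eigenvalues] at hx
  obtain ⟨i, rfl⟩ := hx
  have h1 := hnn i
  rw [Real.norm_eq_abs, abs_of_nonpos (by linarith)]
  exact Finset.single_le_sum (fun j _ => hnn j) (Finset.mem_univ i)

end

/-! ### Mutual-information rate and entropy production rate. -/

namespace FeedbackSystem

variable {n K : Type*} [Fintype n] [DecidableEq n] [Fintype K] (S : FeedbackSystem n K)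

theorem trace_state (t : ℝ) : (S.state t).trace = 1 := by
  have hd : ∀ t, HasDerivAt (fun t => (S.state t).trace) 0 t := fun t => by
    have h := (realCLM (Matrix.traceLinearMap n ℂ ℂ)).hasFDerivAt.comp_hasDerivAt t
      (S.hasDerivAt_state t)
    refine h.congr_deriv ?_
    simp [trace_gen]
  have h := is_const_of_deriv_eq_zero (fun t => (hd t).differentiableAt) (fun t => (hd t).deriv) t 0
  rw [h, state, flow_zero, S.trace_ρ₀]

/-- The flow is real analytic in `t`, hence so is the determinant, and the logarithm of the norm of
a meromorphic function is integrable even across zeros. This covers loss of rank at the end points.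
-/
theorem intervalIntegrable_log_det (τ : ℝ) :
    IntervalIntegrable (fun t => Real.log ‖(S.state t).det‖) MeasureTheory.volume 0 τ := by
  refine MeromorphicOn.intervalIntegrable_log_norm fun t _ => AnalyticAt.meromorphicAt ?_
  have h1 : AnalyticAt ℝ (fun t : ℝ => NormedSpace.exp (t • realCLM S.gen)) t :=
    AnalyticAt.comp (f := fun t : ℝ => t • realCLM S.gen)
      (NormedSpace.exp_analytic (𝕂 := ℝ) (t • realCLM S.gen))
      (((1 : ℝ →L[ℝ] ℝ).smulRight (realCLM S.gen)).analyticAt t)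
  have h2 : ∀ i j, AnalyticAt ℝ (fun t : ℝ => S.state t i j) t := by
    intro i j
    have h3 := ((realCLM (Matrix.entryLinearMap ℂ ℂ i j)).comp (ContinuousLinearMap.apply ℝ
      (Matrix n n ℂ) S.ρ₀)).analyticAt (NormedSpace.exp (t • realCLM S.gen))
    exact AnalyticAt.comp (f := fun t : ℝ => NormedSpace.exp (t • realCLM S.gen)) h3 h1
  simp only [Matrix.det_apply]
  refine Finset.analyticAt_fun_sum _ fun σ _ => ?_
  have : ∀ z : ℂ, Equiv.Perm.sign σ • z = ((Equiv.Perm.sign σ : ℤ) : ℂ) * z := fun z => by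
    rw [Units.smul_def, zsmul_eq_mul]
  simp only [this]
  exact analyticAt_const.mul (Finset.analyticAt_fun_prod _ fun i _ => h2 _ _)

theorem intervalIntegrable_trace_mul_log {τ : ℝ} (hτ : 0 ≤ τ)
    (hfull : ∀ t ∈ Set.Ioo 0 τ, (S.state t).PosDef) {B : ℝ → Matrix n n ℂ}
    (hB : Continuous B) :
    IntervalIntegrable (fun t => (B t * cfc Real.log (S.state t)).trace.re)
      MeasureTheory.volume 0 τ := by
  obtain ⟨C, hC⟩ := isCompact_Icc.exists_bound_of_continuousOn (hB.continuousOn (s := Set.Icc 0 τ))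
  have hlog := (S.intervalIntegrable_log_det τ).const_mul (‖reTrace n‖ * C)
  rw [intervalIntegrable_iff_integrableOn_Ioo_of_le hτ] at hlog ⊢
  have hmeas : ContinuousOn (fun t => (B t * cfc Real.log (S.state t)).trace.re)
      (Set.Ioo 0 τ) := by
    refine continuous_trace_re.comp_continuousOn (hB.continuousOn.mul ?_)
    intro t ht
    exact tendsto_log (S.continuous_state.continuousWithinAt)
      (eventually_nhdsWithin_of_forall fun s hs => (hfull s hs).1) (hfull t ht)
  refine MeasureTheory.Integrable.mono hlog
    (hmeas.aestronglyMeasurable measurableSet_Ioo) ?_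
  filter_upwards [MeasureTheory.ae_restrict_mem measurableSet_Ioo] with t ht
  rw [Real.norm_eq_abs, norm_mul, Real.norm_eq_abs]
  have h1 := abs_re_trace_le (B t * cfc Real.log (S.state t))
  have h2 : ‖B t * cfc Real.log (S.state t)‖ ≤ C * -Real.log ‖(S.state t).det‖ :=
    (norm_mul_le _ _).trans (mul_le_mul (hC t ⟨ht.1.le, ht.2.le⟩)
      ((hfull t ht).norm_log_le (S.trace_state t)) (norm_nonneg _)
      ((norm_nonneg _).trans (hC t ⟨ht.1.le, ht.2.le⟩)))
  refine h1.trans ((mul_le_mul_of_nonneg_left h2 (norm_nonneg _)).trans ?_)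
  rw [← mul_assoc, Real.norm_eq_abs]
  exact (mul_le_mul_of_nonneg_left (neg_le_abs _) (mul_nonneg (norm_nonneg _)
    ((norm_nonneg _).trans (hC t ⟨ht.1.le, ht.2.le⟩)))).trans
      (mul_le_mul_of_nonneg_right (le_abs_self _) (abs_nonneg _))

/-- The generator without feedback. -/
def bareGen : Matrix n n ℂ →ₗ[ℂ] Matrix n n ℂ :=
  ∑ k, conjMap (S.L k) - (LinearMap.mulLeft ℂ S.decay + LinearMap.mulRight ℂ S.decayᴴ)

theorem bareGen_apply (X : Matrix n n ℂ) :
    S.bareGen X = ∑ k, S.L k * X * (S.L k)ᴴ - (S.decay * X + X * S.decayᴴ) := by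
  simp [bareGen, conjMap_apply]

theorem trace_bareGen (X : Matrix n n ℂ) : (S.bareGen X).trace = 0 := by
  have h := S.trace_gen X
  rw [gen_eq, Matrix.trace_sub, Matrix.trace_sum] at h
  rw [bareGen_apply, Matrix.trace_sub, Matrix.trace_sum, ← h]
  simp only [trace_jump]

/-- State after a jump in the channel `k`, before feedback. -/
def jumpState (X : Matrix n n ℂ) (k : K) : Matrix n n ℂ :=
  ((S.rate X k)⁻¹ : ℂ) • (S.L k * X * (S.L k)ᴴ)

/-- Rate of change, by feedback, of the mean entropy of the states after a jump (with a minus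
sign). -/
def conditionalRate (X : Matrix n n ℂ) : ℝ :=
  ∑ k, S.rate X k * (vonNeumannEntropy (S.jumpState X k) -
    vonNeumannEntropy (S.F k (S.jumpState X k)))

theorem jumpState_posSemidef {X : Matrix n n ℂ} (hX : X.PosSemidef) (k : K) :
    (S.jumpState X k).PosSemidef := by
  refine (hX.mul_mul_conjTranspose_same (S.L k)).smul ?_
  rw [← Complex.ofReal_inv]
  exact_mod_cast inv_nonneg.2 (S.rate_nonneg hX k)

theorem conditionalRate_nonpos {X : Matrix n n ℂ} (hX : X.PosSemidef) :
    S.conditionalRate X ≤ 0 := by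
  refine Finset.sum_nonpos fun k _ => mul_nonpos_of_nonneg_of_nonpos (S.rate_nonneg hX k) ?_
  have := (S.isPositiveMap_F k).vonNeumannEntropy_le (S.isUnitalCPTP_F k).tracePreserving
    (S.isUnitalCPTP_F k).unital (S.jumpState_posSemidef hX k)
  linarith

theorem ofReal_rate {X : Matrix n n ℂ} (hX : X.PosSemidef) (k : K) :
    (S.rate X k : ℂ) = (S.L k * X * (S.L k)ᴴ).trace := by
  have him := (Complex.nonneg_iff.1 (hX.mul_mul_conjTranspose_same (S.L k)).trace_nonneg).2
  exact Complex.ext rfl (by simpa using him)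

/-- Outcomes of probability `0` are included: there the inverse is `0`, and a positive semidefinite
matrix of trace `0` vanishes. -/
theorem smul_inv_smul_of_posSemidef {Z : Matrix n n ℂ} (hZ : Z.PosSemidef) :
    (Z.trace.re : ℂ) • (((Z.trace.re)⁻¹ : ℂ) • Z) = Z := by
  have him := (Complex.nonneg_iff.1 hZ.trace_nonneg).2
  by_cases h : Z.trace.re = 0
  · have : Z.trace = 0 := Complex.ext h him.symm
    rw [hZ.trace_eq_zero_iff.1 this]
    simp
  · rw [smul_smul, mul_inv_cancel₀ (by exact_mod_cast h), one_smul]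

/-- Averaging over outcomes gives one Euler step with and one without feedback, with equal `h²`
terms. The entropies of the no-jump state cancel, and for a jump the normalised state does not
depend on `h`. -/
theorem mutualInfoChange_eq {X : Matrix n n ℂ} (hX : X.PosSemidef) {h : ℝ} (hh : 0 < h) :
    S.mutualInfoChange X h =
      vonNeumannEntropy (X + (h : ℂ) • S.gen X + ((h : ℂ) ^ 2) • conjMap S.decay X) -
      vonNeumannEntropy (X + (h : ℂ) • S.bareGen X + ((h : ℂ) ^ 2) • conjMap S.decay X) +
      h * S.conditionalRate X := by
  have hps : ∀ a, (S.kraus h a * X * (S.kraus h a)ᴴ).PosSemidef := fun a =>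
    hX.mul_mul_conjTranspose_same _
  have h1 : ∀ a, (S.outcomeProb X h a : ℂ) • S.measuredState X h a =
      S.kraus h a * X * (S.kraus h a)ᴴ := fun a => smul_inv_smul_of_posSemidef (hps a)
  have h2 : ∀ a, (S.outcomeProb X h a : ℂ) • S.feedback a (S.measuredState X h a) =
      S.stepMap h a X := by
    intro a
    rw [← feedback_kraus, ← h1]
    cases a with
    | none => rfl
    | some k => exact (map_smul (S.F k) _ _).symm
  have h3 : ∑ a, S.kraus h a * X * (S.kraus h a)ᴴ =
      X + (h : ℂ) • S.bareGen X + ((h : ℂ) ^ 2) • conjMap S.decay X := by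
    have := S.stepMap_none h X
    rw [← feedback_kraus] at this
    change S.kraus h none * X * (S.kraus h none)ᴴ = _ at this
    rw [Fintype.sum_option, this, bareGen_apply, conjMap_apply]
    simp only [S.kraus_some_conj hh.le, ← Finset.smul_sum, smul_sub]
    abel
  have h4 : ∀ k, S.outcomeProb X h (some k) = h * S.rate X k := by
    intro k
    rw [outcomeProb, S.kraus_some_conj hh.le, Matrix.trace_smul, smul_eq_mul,
      Complex.re_ofReal_mul, rate]
  have h5 : ∀ k, S.measuredState X h (some k) = S.jumpState X k := by
    intro k
    have hh' : (h : ℂ) ≠ 0 := by exact_mod_cast hh.ne'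
    rw [measuredState, S.kraus_some_conj hh.le, h4, jumpState, smul_smul]
    congr 1
    push_cast
    rw [mul_inv, mul_comm, ← mul_assoc, mul_inv_cancel₀ hh', one_mul]
  rw [mutualInfoChange, holevoInformation, holevoInformation]
  simp only [h1, h2, h3]
  rw [S.sum_stepMap hh.le, Fintype.sum_option, Fintype.sum_option]
  simp only [h4, h5, feedback, conditionalRate, mul_sub, Finset.sum_sub_distrib, Finset.mul_sum,
    mul_assoc]
  ring

/-- The rate of change of the mutual information in closed form. -/
theorem tendsto_mutualInfoChange {X : Matrix n n ℂ} (hX : X.PosDef) :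
    Tendsto (fun h => S.mutualInfoChange X h / h) (𝓝[>] 0)
      (𝓝 (-((S.gen X - S.bareGen X) * (cfc Real.log X + 1)).trace.re + S.conditionalRate X)) := by
  have hlim : ∀ A : Matrix n n ℂ, Tendsto (fun h : ℝ => X + (h : ℂ) • A +
      ((h : ℂ) ^ 2) • conjMap S.decay X) (𝓝[>] 0) (𝓝 X) := by
    intro A
    have : Continuous fun h : ℝ => X + (h : ℂ) • A + ((h : ℂ) ^ 2) • conjMap S.decay X := by
      fun_prop
    have h2 := (this.tendsto 0).mono_left (nhdsWithin_le_nhds (s := Set.Ioi 0))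
    simpa using h2
  have hherm : ∀ A : Matrix n n ℂ, A.IsHermitian → ∀ h : ℝ, (X + (h : ℂ) • A +
      ((h : ℂ) ^ 2) • conjMap S.decay X).IsHermitian := by
    intro A hA h
    have h1 := (isPositiveMap_conjMap S.decay X hX.posSemidef).1
    rw [Matrix.IsHermitian, Matrix.conjTranspose_add, Matrix.conjTranspose_add,
      Matrix.conjTranspose_smul, Matrix.conjTranspose_smul, hA, hX.1, h1]
    simp
  have hA1 : (S.gen X).IsHermitian := by
    rw [Matrix.IsHermitian, ← gen_conjTranspose, hX.1]
  have hA2 : (S.bareGen X).IsHermitian := by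
    rw [Matrix.IsHermitian, bareGen_apply, Matrix.conjTranspose_sub, Matrix.conjTranspose_sum]
    simp only [Matrix.conjTranspose_add, Matrix.conjTranspose_mul,
      Matrix.conjTranspose_conjTranspose, hX.1.eq, Matrix.mul_assoc]
    rw [add_comm (X * S.decayᴴ)]
  have h := tendsto_vonNeumannEntropy_slope hX (hlim (S.gen X)) (hlim (S.bareGen X))
    (Eventually.of_forall (hherm _ hA1)) (Eventually.of_forall (hherm _ hA2))
    (h := fun h : ℝ => h) self_mem_nhdsWithin (A := S.gen X - S.bareGen X) ?_
  · refine (h.add_const (S.conditionalRate X)).congr' ?_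
    filter_upwards [self_mem_nhdsWithin] with h hh
    have hh : 0 < h := hh
    rw [S.mutualInfoChange_eq hX.posSemidef hh, add_div, mul_div_cancel_left₀ _ hh.ne']
  · refine tendsto_const_nhds.congr' ?_
    filter_upwards [self_mem_nhdsWithin] with h hh
    have hh : (h : ℂ) ≠ 0 := by exact_mod_cast (ne_of_gt hh)
    rw [← Complex.coe_smul, Complex.ofReal_inv, add_sub_add_right_eq_sub, add_sub_add_left_eq_sub,
      ← smul_sub, smul_smul, inv_mul_cancel₀ hh, one_smul]

theorem mutualInfoRate_eq {X : Matrix n n ℂ} (hX : X.PosDef) :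
    S.mutualInfoRate X =
      -((S.gen X - S.bareGen X) * (cfc Real.log X + 1)).trace.re + S.conditionalRate X :=
  (S.tendsto_mutualInfoChange hX).limUnder_eq

/-- Right derivative of the entropy along the evolution. -/
theorem hasDerivWithinAt_vonNeumannEntropy {t : ℝ} (ht : (S.state t).PosDef)
    (hh : ∀ᶠ s in 𝓝 t, (S.state s).IsHermitian) :
    HasDerivWithinAt (fun t => vonNeumannEntropy (S.state t))
      (-(S.gen (S.state t) * (cfc Real.log (S.state t) + 1)).trace.re) (Set.Ioi t) t := by
  rw [hasDerivWithinAt_iff_tendsto_slope' (Set.notMem_Ioi.2 le_rfl)]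
  have hd := (S.hasDerivAt_state t).hasDerivWithinAt (s := Set.Ioi t)
  rw [hasDerivWithinAt_iff_tendsto_slope' (Set.notMem_Ioi.2 le_rfl)] at hd
  have h := tendsto_vonNeumannEntropy_slope ht
    (S.continuous_state.continuousWithinAt (s := Set.Ioi t) (x := t))
    (tendsto_const_nhds (x := S.state t)) (nhdsWithin_le_nhds hh)
    (Eventually.of_forall fun _ => ht.1) (h := fun s => s - t)
    (eventually_nhdsWithin_of_forall fun s hs => sub_pos.2 hs) (A := S.gen (S.state t)) ?_
  · refine h.congr fun s => ?_
    rw [slope_def_field]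
  · refine hd.congr fun s => ?_
    rw [slope_def_module]

/-- Continuity is taken within the positive semidefinite matrices because convergence of the entropy
needs Hermitian arguments. At full rank a nonzero channel has positive rate, so normalisation is
harmless. -/
theorem continuousAt_conditionalRate {X : Matrix n n ℂ} (hX : X.PosDef) :
    ContinuousWithinAt (fun X => S.conditionalRate X) {X | X.PosSemidef} X := by
  refine tendsto_finsetSum _ fun k _ => ?_
  by_cases hk : S.L k = 0
  · have : (fun X => S.rate X k * (vonNeumannEntropy (S.jumpState X k) -
        vonNeumannEntropy (S.F k (S.jumpState X k)))) = fun _ => 0 := by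
      funext Y
      rw [S.rate_eq_zero hk, zero_mul]
    rw [this, S.rate_eq_zero hk, zero_mul]
    exact tendsto_const_nhds
  · have hr := (S.continuous_rate k).continuousWithinAt (s := {X | X.PosSemidef}) (x := X)
    have hω : ContinuousWithinAt (fun X => S.jumpState X k) {X | X.PosSemidef} X := by
      have hne : (S.rate X k : ℂ) ≠ 0 := by exact_mod_cast (S.rate_pos hX hk).ne'
      refine ContinuousWithinAt.smul
        ((Complex.continuous_ofReal.continuousAt.comp_continuousWithinAt hr).inv₀ hne) ?_
      exact (by fun_prop : Continuous fun X : Matrix n n ℂ =>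
        S.L k * X * (S.L k)ᴴ).continuousWithinAt
    have hFω : ContinuousWithinAt (fun X => S.F k (S.jumpState X k)) {X | X.PosSemidef} X :=
      (realCLM (S.F k)).continuous.continuousAt.comp_continuousWithinAt hω
    refine hr.mul (Tendsto.sub ?_ ?_)
    · exact tendsto_vonNeumannEntropy hω
        (eventually_nhdsWithin_of_forall fun Y hY => (S.jumpState_posSemidef hY k).1)
        (S.jumpState_posSemidef hX.posSemidef k).1
    · exact tendsto_vonNeumannEntropy hFω
        (eventually_nhdsWithin_of_forall fun Y hY =>
          (S.isPositiveMap_F k _ (S.jumpState_posSemidef hY k)).1)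
        (S.isPositiveMap_F k _ (S.jumpState_posSemidef hX.posSemidef k)).1

theorem abs_conditionalRate_le {X : Matrix n n ℂ} (hX : X.PosSemidef) :
    |S.conditionalRate X| ≤ ∑ k, S.rate X k * (2 * ‖reTrace n‖) := by
  refine (Finset.abs_sum_le_sum_abs _ _).trans (Finset.sum_le_sum fun k _ => ?_)
  rw [abs_mul, abs_of_nonneg (S.rate_nonneg hX k)]
  rcases (S.rate_nonneg hX k).lt_or_eq with h | h
  · refine mul_le_mul_of_nonneg_left ?_ h.le
    have htr : (S.jumpState X k).trace = 1 := by
      rw [jumpState, Matrix.trace_smul, ← S.ofReal_rate hX, smul_eq_mul,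
        inv_mul_cancel₀ (by exact_mod_cast h.ne')]
    have h1 := abs_vonNeumannEntropy_le (S.jumpState_posSemidef hX k) htr
    have h2 := abs_vonNeumannEntropy_le (S.isPositiveMap_F k _ (S.jumpState_posSemidef hX k))
      (((S.isUnitalCPTP_F k).tracePreserving _).trans htr)
    refine (abs_sub _ _).trans ?_
    linarith
  · rw [← h]; simp

theorem intervalIntegrable_conditionalRate {τ : ℝ} (hτ : 0 ≤ τ)
    (hfull : ∀ t ∈ Set.Ioo 0 τ, (S.state t).PosDef) :
    IntervalIntegrable (fun t => S.conditionalRate (S.state t)) MeasureTheory.volume 0 τ := by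
  have hb : Continuous fun t => ∑ k, S.rate (S.state t) k * (2 * ‖reTrace n‖) :=
    continuous_finsetSum _ fun k _ => ((S.continuous_rate k).comp S.continuous_state).mul_const _
  have hbi := hb.intervalIntegrable (μ := MeasureTheory.volume) 0 τ
  rw [intervalIntegrable_iff_integrableOn_Ioo_of_le hτ] at hbi ⊢
  have hmeas : ContinuousOn (fun t => S.conditionalRate (S.state t)) (Set.Ioo 0 τ) := by
    intro t ht
    exact (S.continuousAt_conditionalRate (hfull t ht)).comp
      S.continuous_state.continuousWithinAt fun s hs => (hfull s hs).posSemidef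
  refine MeasureTheory.Integrable.mono hbi (hmeas.aestronglyMeasurable measurableSet_Ioo) ?_
  filter_upwards [MeasureTheory.ae_restrict_mem measurableSet_Ioo] with t ht
  rw [Real.norm_eq_abs, Real.norm_eq_abs]
  exact (S.abs_conditionalRate_le (hfull t ht).posSemidef).trans (le_abs_self _)

/-- The entropy production rate. -/
def entropyProductionRate (X : Matrix n n ℂ) : ℝ :=
  -(S.bareGen X * (cfc Real.log X + 1)).trace.re + ∑ k, S.Δs k * S.rate X k - S.conditionalRate X

/-- The second law per channel: Klein's inequality for `Z ↦ L_k Z L_k†`, with `X` as both arguments,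
bounds `r_k log (r_k / r_{k*})` by the entropy balance of channel `k`. What is left is
`-conditionalRate`, nonnegative as unital feedback does not lower entropy. -/
theorem sum_rate_mul_log_le {X : Matrix n n ℂ} (hX : X.PosDef) :
    ∑ k, S.rate X k * Real.log (S.rate X k / S.rate X (S.rev k)) ≤ S.entropyProductionRate X := by
  have hG : S.decay + S.decayᴴ = ∑ k, (S.L k)ᴴ * S.L k := by
    rw [decay_conjTranspose, decay]
    module
  have hcomm : X * cfc Real.log X = cfc Real.log X * X := by
    have h1 := hX.1.cfc_mul_cfc (fun x => x) Real.log
    have h2 := hX.1.cfc_mul_cfc Real.log (fun x => x)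
    rw [hX.1.cfc_self] at h1 h2
    rw [h1, h2]
    congr 1
    funext x
    ring
  -- Since `X` commutes with `log X`, the decay terms only see `G + G† = ∑ L_k† L_k`, which lets
  -- them be split among the channels.
  have hD : (S.bareGen X * (cfc Real.log X + 1)).trace =
      ∑ k, (S.L k * X * (S.L k)ᴴ * cfc Real.log X).trace -
      ∑ k, (S.L k * (X * cfc Real.log X) * (S.L k)ᴴ).trace := by
    rw [Matrix.mul_add, Matrix.mul_one, Matrix.trace_add, trace_bareGen, add_zero, bareGen_apply,
      Matrix.sub_mul, Matrix.trace_sub, Finset.sum_mul, Matrix.trace_sum]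
    congr 1
    have e1 : (X * S.decayᴴ * cfc Real.log X).trace = (S.decayᴴ * (X * cfc Real.log X)).trace := by
      rw [Matrix.trace_mul_comm, ← Matrix.mul_assoc, ← hcomm, Matrix.trace_mul_comm]
    rw [Matrix.add_mul, Matrix.trace_add, e1, Matrix.mul_assoc, ← Matrix.trace_add,
      ← Matrix.add_mul, hG, Finset.sum_mul, Matrix.trace_sum]
    refine Finset.sum_congr rfl fun k _ => ?_
    rw [Matrix.mul_assoc, Matrix.trace_mul_comm]
  have key : ∀ k, S.rate X k * Real.log (S.rate X k / S.rate X (S.rev k)) ≤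
      (S.L k * (X * cfc Real.log X) * (S.L k)ᴴ).trace.re -
        (S.L k * X * (S.L k)ᴴ * cfc Real.log X).trace.re + S.Δs k * S.rate X k := by
    intro k
    by_cases hk : S.L k = 0
    · simp [hk, S.rate_eq_zero hk]
    have hr := S.rate_pos hX hk
    have hs := S.rate_pos hX (S.L_rev_ne_zero hk)
    -- The scale for Klein's inequality. By detailed balance `exp (-Δs_k) tr (L_k L_k† X) = r_{k*}`,
    -- so the last term of Klein becomes `r_k` and cancels, while `log c = log (r_k / r_{k*}) -
    -- Δs_k`.
    have hc : 0 < S.rate X k / S.rate X (S.rev k) * Real.exp (-S.Δs k) := by positivity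
    have h := (isPositiveMap_conjMap (S.L k)).klein hX hX hc
    have hrev : Real.exp (-S.Δs k) * (S.L k * (S.L k)ᴴ * X).trace.re = S.rate X (S.rev k) := by
      have e0 : (Real.exp (-S.Δs k / 2) : ℂ) * (Real.exp (-S.Δs k / 2) : ℂ) =
          (Real.exp (-S.Δs k) : ℂ) := by
        rw [← Complex.ofReal_mul, ← Real.exp_add]
        congr 2; ring
      rw [rate, L_rev, Matrix.conjTranspose_smul, Matrix.conjTranspose_conjTranspose]
      simp only [Matrix.smul_mul, Matrix.mul_smul, smul_smul, Complex.star_def,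
        Complex.conj_ofReal, e0, Matrix.trace_smul, smul_eq_mul, Complex.re_ofReal_mul]
      rw [Matrix.trace_mul_comm _ (S.L k), ← Matrix.mul_assoc]
    simp only [conjMap_apply, Matrix.mul_one] at h
    rw [mul_assoc (S.rate X k / S.rate X (S.rev k)), hrev, div_mul_cancel₀ _ hs.ne', Real.log_mul (div_pos hr hs).ne'
      (Real.exp_pos _).ne', Real.log_exp] at h
    change 0 ≤ _ - _ - (1 + (_ + -S.Δs k)) * S.rate X k + _ at h
    linarith
  have hcond := S.conditionalRate_nonpos hX.posSemidef
  have hsum := Finset.sum_le_sum fun k (_ : k ∈ Finset.univ) => key k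
  rw [entropyProductionRate, hD, Complex.sub_re, Complex.re_sum, Complex.re_sum]
  rw [Finset.sum_add_distrib, Finset.sum_sub_distrib] at hsum
  linarith

end FeedbackSystem

/-! ### Positivity of the state up to the end points. -/

theorem isClosed_posSemidef {n : Type*} [Fintype n] :
    IsClosed {X : Matrix n n ℂ | X.PosSemidef} := by
  have : {X : Matrix n n ℂ | X.PosSemidef} = {X | Xᴴ = X} ∩
      ⋂ x : n → ℂ, {X | 0 ≤ star x ⬝ᵥ (X *ᵥ x)} := by
    ext X
    simp [Matrix.posSemidef_iff_dotProduct_mulVec, Matrix.IsHermitian]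
  rw [this]
  refine (isClosed_eq (by fun_prop) continuous_id).inter (isClosed_iInter fun x => ?_)
  exact isClosed_le continuous_const (by fun_prop)

namespace FeedbackSystem

variable {n K : Type*} [Fintype n] [DecidableEq n] [Fintype K] (S : FeedbackSystem n K)

theorem state_posSemidef {τ : ℝ} (hτ : 0 < τ) (hfull : ∀ t ∈ Set.Ioo 0 τ, (S.state t).PosDef) :
    ∀ t ∈ Set.Icc 0 τ, (S.state t).PosSemidef := by
  intro t ht
  have h : Set.Icc 0 τ ⊆ S.state ⁻¹' {X | X.PosSemidef} := by
    rw [← closure_Ioo hτ.ne]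
    exact closure_minimal (fun s hs => (hfull s hs).posSemidef)
      (isClosed_posSemidef.preimage S.continuous_state)
  exact h ht

theorem continuous_rate_state (k : K) : Continuous fun t => S.rate (S.state t) k :=
  (S.continuous_rate k).comp S.continuous_state

/-! ### Entropy production -/

theorem intervalIntegrable_trace_mul_log_add_one {τ : ℝ} (hτ : 0 ≤ τ)
    (hfull : ∀ t ∈ Set.Ioo 0 τ, (S.state t).PosDef) (T : Matrix n n ℂ →ₗ[ℂ] Matrix n n ℂ) :
    IntervalIntegrable (fun t => (T (S.state t) * (cfc Real.log (S.state t) + 1)).trace.re)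
      MeasureTheory.volume 0 τ := by
  have hc : Continuous fun t => T (S.state t) := (realCLM T).continuous.comp S.continuous_state
  have h := (S.intervalIntegrable_trace_mul_log hτ hfull hc).add
    ((continuous_trace_re.comp hc).intervalIntegrable (μ := MeasureTheory.volume) 0 τ)
  refine h.congr fun t _ => ?_
  rw [Matrix.mul_add, Matrix.mul_one, Matrix.trace_add, Complex.add_re]
  rfl

theorem intervalIntegrable_mutualInfoRate {τ : ℝ} (hτ : 0 ≤ τ)
    (hfull : ∀ t ∈ Set.Ioo 0 τ, (S.state t).PosDef) :
    IntervalIntegrable (fun t => S.mutualInfoRate (S.state t)) MeasureTheory.volume 0 τ := by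
  have h := ((S.intervalIntegrable_trace_mul_log_add_one hτ hfull (S.gen - S.bareGen)).neg).add
    (S.intervalIntegrable_conditionalRate hτ hfull)
  rw [intervalIntegrable_iff_integrableOn_Ioo_of_le hτ] at h ⊢
  refine h.congr_fun (fun t ht => ?_) measurableSet_Ioo
  rw [S.mutualInfoRate_eq (hfull t ht)]
  rfl

theorem intervalIntegrable_entropyProductionRate {τ : ℝ} (hτ : 0 ≤ τ)
    (hfull : ∀ t ∈ Set.Ioo 0 τ, (S.state t).PosDef) :
    IntervalIntegrable (fun t => S.entropyProductionRate (S.state t))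
      MeasureTheory.volume 0 τ := by
  have hc : Continuous fun t => ∑ k, S.Δs k * S.rate (S.state t) k :=
    continuous_finsetSum _ fun k _ => (S.continuous_rate_state k).const_mul _
  exact ((S.intervalIntegrable_trace_mul_log_add_one hτ hfull S.bareGen).neg.add
    (hc.intervalIntegrable _ _)).sub (S.intervalIntegrable_conditionalRate hτ hfull)

/-- The contribution of `gen` to the entropy derivative is cancelled by the same term in the
mutual-information rate, which leaves the generator without feedback. -/
theorem entropyProduction_eq {τ : ℝ} (hτ : 0 < τ)
    (hfull : ∀ t ∈ Set.Ioo 0 τ, (S.state t).PosDef) :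
    S.entropyProduction τ S.state = ∫ t in (0 : ℝ)..τ, S.entropyProductionRate (S.state t) := by
  have hps := S.state_posSemidef hτ hfull
  have hgen : IntervalIntegrable (fun t => -(S.gen (S.state t) *
      (cfc Real.log (S.state t) + 1)).trace.re) MeasureTheory.volume 0 τ :=
    (S.intervalIntegrable_trace_mul_log_add_one hτ.le hfull S.gen).neg
  have hS := intervalIntegral.integral_eq_sub_of_hasDeriv_right_of_le hτ.le
    (f := fun t => vonNeumannEntropy (S.state t))
    (f' := fun t => -(S.gen (S.state t) * (cfc Real.log (S.state t) + 1)).trace.re)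
    (fun t ht => tendsto_vonNeumannEntropy S.continuous_state.continuousWithinAt
      (eventually_nhdsWithin_of_forall fun s hs => (hps s hs).1) (hps t ht).1)
    (fun t ht => S.hasDerivWithinAt_vonNeumannEntropy (hfull t ht)
      (Filter.mem_of_superset (isOpen_Ioo.mem_nhds ht) fun s hs => (hfull s hs).1)) hgen
  have hc : Continuous fun t => ∑ k, S.Δs k * S.rate (S.state t) k :=
    continuous_finsetSum _ fun k _ => (S.continuous_rate_state k).const_mul _
  have hci := hc.intervalIntegrable (μ := MeasureTheory.volume) 0 τ
  rw [entropyProduction, totalEntropyProduction, ← hS, ← intervalIntegral.integral_add hgen hci,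
    ← intervalIntegral.integral_sub (hgen.add hci)
      (S.intervalIntegrable_mutualInfoRate hτ.le hfull)]
  refine intervalIntegral.integral_congr_ae ?_
  -- The closed form of the information rate needs full rank, which may fail at `τ`; one point is
  -- negligible.
  have hne : ∀ᵐ t : ℝ, t ≠ τ := by simp [MeasureTheory.ae_iff, MeasureTheory.measure_singleton]
  filter_upwards [hne] with t htne ht
  rw [Set.uIoc_of_le hτ.le] at ht
  have ht' : t ∈ Set.Ioo 0 τ := ⟨ht.1, lt_of_le_of_ne ht.2 htne⟩
  rw [S.mutualInfoRate_eq (hfull t ht'), entropyProductionRate]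
  simp only [Matrix.sub_mul, Matrix.trace_sub, Complex.sub_re]
  ring

/-! ### The information of the perturbation -/

/-- Rate of the Fisher information of the perturbed dynamics. -/
def informationRate (X : Matrix n n ℂ) : ℝ := ∑ k, S.bias X k ^ 2 * S.rate X k

theorem sum_comp_rev (f : K → ℝ) : ∑ k, f (S.rev k) = ∑ k, f k :=
  Equiv.sum_comp (Function.Involutive.toPerm S.rev S.rev_rev) f

theorem bias_rev (X : Matrix n n ℂ) (k : K) : S.bias X (S.rev k) = -S.bias X k := by
  rw [bias, bias, S.rev_rev, ← neg_div, neg_sub, add_comm]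

/-- In each pair, `c_k (r_k - r_{k*}) = c_k ℓ_k (r_k + r_{k*})`, and `c` and `ℓ` are both odd under
reversal. Thus the explicit effect of the perturbation on the mean current is `⟨J⟩` itself. -/
theorem sum_mul_rate_eq {c : K → ℝ} (hc : ∀ k, c (S.rev k) = -c k) {X : Matrix n n ℂ}
    (hX : X.PosSemidef) :
    ∑ k, c k * S.rate X k = ∑ k, S.bias X k * (c k * S.rate X k) := by
  have h1 := S.sum_comp_rev fun k => c k * S.rate X k
  have h2 := S.sum_comp_rev fun k => S.bias X k * (c k * S.rate X k)
  simp only [bias_rev, hc] at h1 h2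
  have h3 : ∀ k, S.bias X k * (S.rate X k + S.rate X (S.rev k)) =
      S.rate X k - S.rate X (S.rev k) := by
    intro k
    have hr := S.rate_nonneg hX k
    have hs := S.rate_nonneg hX (S.rev k)
    by_cases h : S.rate X k + S.rate X (S.rev k) = 0
    · rw [h, mul_zero]; linarith
    · rw [bias, div_mul_cancel₀ _ h]
  have h4 : ∑ k, c k * S.rate X k + ∑ k, -c k * S.rate X (S.rev k) =
      ∑ k, S.bias X k * (c k * S.rate X k) +
        ∑ k, -S.bias X k * (-c k * S.rate X (S.rev k)) := by
    rw [← Finset.sum_add_distrib, ← Finset.sum_add_distrib]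
    refine Finset.sum_congr rfl fun k _ => ?_
    linear_combination (-c k) * h3 k
  linarith

theorem two_mul_informationRate (X : Matrix n n ℂ) :
    2 * S.informationRate X = ∑ k, (S.rate X k - S.rate X (S.rev k)) ^ 2 /
      (S.rate X k + S.rate X (S.rev k)) := by
  have h1 := S.sum_comp_rev fun k => S.bias X k ^ 2 * S.rate X k
  simp only [bias_rev] at h1
  rw [informationRate, two_mul]
  nth_rewrite 1 [← h1]
  rw [← Finset.sum_add_distrib]
  refine Finset.sum_congr rfl fun k _ => ?_
  by_cases h : S.rate X k + S.rate X (S.rev k) = 0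
  · simp [bias, h]
  · rw [bias]
    field_simp
    ring

theorem sum_sub_mul_log (X : Matrix n n ℂ) :
    ∑ k, (S.rate X k - S.rate X (S.rev k)) * Real.log (S.rate X k / S.rate X (S.rev k)) =
      2 * ∑ k, S.rate X k * Real.log (S.rate X k / S.rate X (S.rev k)) := by
  have h1 := S.sum_comp_rev fun k => S.rate X k * Real.log (S.rate X k / S.rate X (S.rev k))
  simp only [S.rev_rev] at h1
  rw [two_mul]
  nth_rewrite 2 [← h1]
  rw [← Finset.sum_add_distrib]
  refine Finset.sum_congr rfl fun k _ => ?_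
  rw [← inv_div (S.rate X k), Real.log_inv]
  ring

theorem sum_rate_rev (X : Matrix n n ℂ) :
    ∑ k, (S.rate X k + S.rate X (S.rev k)) = 2 * ∑ k, S.rate X k := by
  rw [Finset.sum_add_distrib, S.sum_comp_rev fun k => S.rate X k]
  ring

/-- Symmetrising over `k ↔ k*` reduces this to `sq_div_add_le_mul_log`. It is what makes `Σ`
positive once the Fisher information is. -/
theorem two_mul_informationRate_le {X : Matrix n n ℂ} (hX : X.PosDef) :
    2 * S.informationRate X ≤ S.entropyProductionRate X := by
  refine le_trans ?_ (S.sum_rate_mul_log_le hX)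
  have h2 := S.sum_sub_mul_log X
  have h3 : ∑ k, (S.rate X k - S.rate X (S.rev k)) ^ 2 / (S.rate X k + S.rate X (S.rev k)) ≤
      ∑ k, 1 / 2 * ((S.rate X k - S.rate X (S.rev k)) *
        Real.log (S.rate X k / S.rate X (S.rev k))) := by
    refine Finset.sum_le_sum fun k _ => ?_
    by_cases hk : S.L k = 0
    · simp [S.rate_eq_zero hk, S.rate_rev_eq_zero hk]
    · exact sq_div_add_le_mul_log (S.rate_pos hX hk) (S.rate_pos hX (S.L_rev_ne_zero hk))
  rw [← Finset.mul_sum, h2] at h3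
  rw [two_mul_informationRate]
  linarith

theorem informationRate_le_tangent {x₀ m : ℝ} (hm : 0 ≤ m)
    (h : ∀ r s : ℝ, 0 < r → 0 < s → (r - s) ^ 2 / (r + s) ≤ (r + s) * Real.tanh x₀ ^ 2 +
      m * (1 / 2 * ((r - s) * Real.log (r / s)) - x₀ * Real.tanh x₀ * (r + s)))
    {X : Matrix n n ℂ} (hX : X.PosDef) :
    S.informationRate X ≤ Real.tanh x₀ ^ 2 * (∑ k, S.rate X k) +
      m * (1 / 2 * S.entropyProductionRate X - x₀ * Real.tanh x₀ * ∑ k, S.rate X k) := by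
  have h1 := S.two_mul_informationRate X
  have h2 := S.sum_sub_mul_log X
  have h3 := S.sum_rate_rev X
  have h4 := mul_le_mul_of_nonneg_left (S.sum_rate_mul_log_le hX) hm
  have h5 : ∑ k, (S.rate X k - S.rate X (S.rev k)) ^ 2 / (S.rate X k + S.rate X (S.rev k)) ≤
      ∑ k, (Real.tanh x₀ ^ 2 * (S.rate X k + S.rate X (S.rev k)) +
        m * (1 / 2) * ((S.rate X k - S.rate X (S.rev k)) *
        Real.log (S.rate X k / S.rate X (S.rev k))) -
        m * (x₀ * Real.tanh x₀) * (S.rate X k + S.rate X (S.rev k))) := by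
    refine Finset.sum_le_sum fun k _ => ?_
    by_cases hk : S.L k = 0
    · simp [S.rate_eq_zero hk, S.rate_rev_eq_zero hk]
    · refine (h _ _ (S.rate_pos hX hk) (S.rate_pos hX (S.L_rev_ne_zero hk))).trans_eq ?_
      ring
  rw [Finset.sum_sub_distrib, Finset.sum_add_distrib, ← Finset.mul_sum, ← Finset.mul_sum,
    ← Finset.mul_sum, h2, h3] at h5
  linarith

theorem informationRate_nonneg {X : Matrix n n ℂ} (hX : X.PosSemidef) :
    0 ≤ S.informationRate X :=
  Finset.sum_nonneg fun k _ => mul_nonneg (sq_nonneg _) (S.rate_nonneg hX k)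

theorem informationRate_le {X : Matrix n n ℂ} (hX : X.PosSemidef) :
    S.informationRate X ≤ ∑ k, S.rate X k :=
  Finset.sum_le_sum fun k _ => mul_le_of_le_one_left (S.rate_nonneg hX k)
    ((sq_le_one_iff_abs_le_one _).2 (S.abs_bias_le_one hX k))

theorem intervalIntegrable_sum_bias_mul {τ : ℝ} (hτ : 0 ≤ τ)
    (hps : ∀ t ∈ Set.Icc 0 τ, (S.state t).PosSemidef) {f : K → ℝ → ℝ}
    (hf : ∀ k, Continuous (f k)) :
    IntervalIntegrable (fun t => ∑ k, S.bias (S.state t) k * f k t)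
      MeasureTheory.volume 0 τ := by
  have e : (fun t => ∑ k, S.bias (S.state t) k * f k t) =
      ∑ k, fun t => S.bias (S.state t) k • f k t := by
    funext t; simp [Finset.sum_apply]
  rw [e]
  exact IntervalIntegrable.sum _ fun k _ => intervalIntegrable_bdd_smul hτ
    (S.aestronglyMeasurable_bias S.continuous_state.continuousOn k)
    (fun t ht => S.abs_bias_le_one (hps t ht) k) (hf k).continuousOn

theorem intervalIntegrable_informationRate {τ : ℝ} (hτ : 0 ≤ τ)
    (hps : ∀ t ∈ Set.Icc 0 τ, (S.state t).PosSemidef) :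
    IntervalIntegrable (fun t => S.informationRate (S.state t)) MeasureTheory.volume 0 τ := by
  have e : (fun t => S.informationRate (S.state t)) =
      ∑ k, fun t => S.bias (S.state t) k ^ 2 • S.rate (S.state t) k := by
    funext t; simp [Finset.sum_apply, informationRate]
  rw [e]
  exact IntervalIntegrable.sum _ fun k _ => intervalIntegrable_bdd_smul hτ
    ((S.aestronglyMeasurable_bias S.continuous_state.continuousOn k).pow 2)
    (fun t ht => by
      rw [abs_pow]
      exact pow_le_one₀ (abs_nonneg _) (S.abs_bias_le_one (hps t ht) k))
    (S.continuous_rate_state k).continuousOn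

/-! ### The Cramér–Rao inequality -/

theorem meanCurrent_eq_integral (c : K → ℝ) {τ : ℝ} (hτ : 0 < τ) :
    S.meanCurrent c τ = ∫ t in (0 : ℝ)..τ, ∑ k, c k * S.rate (S.state t) k := by
  have hc : Continuous fun t => ∑ k, c k * S.rate (S.state t) k :=
    continuous_finsetSum _ fun k _ => (S.continuous_rate_state k).const_mul _
  have h := intervalIntegral.integral_eq_sub_of_hasDerivAt_of_le hτ.le
    (f := fun t => (S.moments c t).2.1.trace.re)
    (fun t _ => (S.hasDerivAt_moments_snd c t).reTrace.continuousAt.continuousWithinAt)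
    (f' := fun t => ∑ k, c k * S.rate (S.state t) k) (fun t ht => ?_) (hc.intervalIntegrable _ _)
  · rw [h, S.meanCurrent_eq c hτ, moments_zero]
    simp
  · refine (S.hasDerivAt_moments_snd c t).reTrace.congr_deriv ?_
    rw [Matrix.trace_add, trace_gen, zero_add, re_trace_weightedJump,
      S.moments_fst_eq_state c ht.1.le]

/-- The response of the mean current is a correlation of the bias with the jump defects. -/
theorem integral_response_eq (c : K → ℝ) {τ : ℝ} (hτ : 0 < τ)
    (hfull : ∀ t ∈ Set.Ioo 0 τ, (S.state t).PosDef) {N : ℝ → Matrix n n ℂ} (hNτ : N τ = 0)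
    (hN : ∀ t, HasDerivAt N (-(traceAdjoint S.gen (N t) +
      traceAdjoint (S.weightedJump c) 1)) t) :
    ∫ t in (0 : ℝ)..τ, ∑ k, c k * S.rate (S.linearResponse S.state t) k =
      ∫ t in (0 : ℝ)..τ, ∑ k, S.bias (S.state t) k *
        (N t * S.dissipator k (S.state t)).trace.re := by
  have hps := S.state_posSemidef hτ hfull
  have hNc : Continuous N := continuous_iff_continuousAt.2 fun t => (hN t).continuousAt
  have hφ := S.continuousOn_linearResponse hτ.le S.continuous_state.continuousOn hps
  have hi1 : IntervalIntegrable (fun t => ∑ k, c k * S.rate (S.linearResponse S.state t) k)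
      MeasureTheory.volume 0 τ := by
    refine ContinuousOn.intervalIntegrable_of_Icc hτ.le ?_
    exact continuousOn_finsetSum _ fun k _ =>
      ((S.continuous_rate k).comp_continuousOn hφ).const_mul _
  have hi2 : IntervalIntegrable (fun t => ∑ k, S.bias (S.state t) k *
      (N t * S.dissipator k (S.state t)).trace.re) MeasureTheory.volume 0 τ :=
    S.intervalIntegrable_sum_bias_mul hτ.le hps fun k =>
      continuous_trace_re.comp (hNc.mul ((realCLM (S.dissipator k)).continuous.comp S.continuous_state))
  -- Duality of the backward and response equations: in the derivative of `tr (N φ)` the generator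
  -- terms cancel, and both boundary values vanish because `N τ = 0` and `φ 0 = 0`.
  have h := intervalIntegral.integral_eq_sub_of_hasDerivAt_of_le hτ.le
    (f := fun t => (N t * S.linearResponse S.state t).trace.re)
    (f' := fun t => ∑ k, S.bias (S.state t) k * (N t * S.dissipator k (S.state t)).trace.re -
      ∑ k, c k * S.rate (S.linearResponse S.state t) k)
    (continuous_trace_re.comp_continuousOn (hNc.continuousOn.mul hφ)) (fun t ht => ?_)
    (hi2.sub hi1)
  · rw [intervalIntegral.integral_sub hi2 hi1, hNτ, linearResponse_zero] at h
    simp only [Matrix.zero_mul, Matrix.mul_zero, Matrix.trace_zero, Complex.zero_re,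
      sub_zero] at h
    linarith
  · refine ((hN t).mul (S.hasDerivAt_linearResponse S.continuous_state.continuousOn hps hfull
      ht)).reTrace.congr_deriv ?_
    rw [← re_trace_weightedJump]
    simp only [Matrix.neg_mul, Matrix.add_mul, Matrix.mul_add, Matrix.trace_add, Matrix.trace_neg,
      trace_traceAdjoint_mul, Matrix.one_mul, Complex.add_re, Complex.neg_re, perturbation,
      Finset.mul_sum, Matrix.mul_smul, Matrix.trace_sum, Matrix.trace_smul, Complex.re_sum,
      Complex.smul_re, smul_eq_mul, realCLM_apply]
    ring

/-- For Hermitian `N` and `X` the two halves of the anticommutator have equal real trace, so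
together they give the `L_k N` part of the defect. -/
theorem re_trace_jumpDefect (c : K → ℝ) {N X : Matrix n n ℂ} (hN : N.IsHermitian)
    (hX : X.IsHermitian) (k : K) :
    (S.jumpDefect c N k * X * (S.L k)ᴴ).trace.re =
      c k * S.rate X k + (N * S.dissipator k X).trace.re := by
  have e1 : (N * (X * ((S.L k)ᴴ * S.L k))).trace = (S.L k * N * X * (S.L k)ᴴ).trace := by
    rw [Matrix.trace_mul_comm (S.L k * N * X)]
    simp only [← Matrix.mul_assoc]
    rw [Matrix.trace_mul_comm, ← Matrix.mul_assoc, ← Matrix.mul_assoc, Matrix.trace_mul_comm]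
    simp only [Matrix.mul_assoc]
  have e2 : (N * ((S.L k)ᴴ * S.L k * X)).trace.re = (N * (X * ((S.L k)ᴴ * S.L k))).trace.re := by
    have : (N * ((S.L k)ᴴ * S.L k * X))ᴴ = X * ((S.L k)ᴴ * S.L k) * N := by
      simp only [Matrix.conjTranspose_mul, Matrix.conjTranspose_conjTranspose, hN.eq, hX.eq,
        Matrix.mul_assoc]
    have h2 := congrArg (fun M => M.trace.re) this
    simp only [Matrix.trace_conjTranspose] at h2
    rw [Matrix.trace_mul_comm N (X * _), ← h2]
    simp
  rw [dissipator_apply, jumpDefect]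
  simp only [Matrix.sub_mul, Matrix.add_mul, Matrix.smul_mul, Matrix.one_mul, Matrix.mul_sub,
    Matrix.mul_add, Matrix.mul_smul, Matrix.trace_sub, Matrix.trace_add, Matrix.trace_smul,
    smul_eq_mul, Complex.sub_re, Complex.add_re, Complex.re_ofReal_mul]
  rw [Matrix.mul_assoc (traceAdjoint (S.F k) N) (S.L k), Matrix.mul_assoc (traceAdjoint (S.F k) N),
    trace_traceAdjoint_mul, ← e1]
  have h2 : ∀ z : ℂ, (1 / 2 * z).re = 1 / 2 * z.re := fun z => by
    rw [show (1 / 2 : ℂ) = ((1 / 2 : ℝ) : ℂ) by norm_num, Complex.re_ofReal_mul]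
  rw [h2, Complex.add_re, e2, rate]
  ring

/-- Cauchy–Schwarz before optimisation: `tr (Q X Q†) ≥ 0` with `Q = D_k - x ℓ_k L_k`, summed over
`k`. With `x` still free, it can be integrated over time first. -/
theorem two_mul_sub_sq_le (c : K → ℝ) {N X : Matrix n n ℂ} (hN : N.IsHermitian)
    (hX : X.PosSemidef) (x : ℝ) :
    2 * x * ∑ k, S.bias X k * (c k * S.rate X k + (N * S.dissipator k X).trace.re) -
      x ^ 2 * S.informationRate X ≤
        ∑ k, (S.jumpDefect c N k * X * (S.jumpDefect c N k)ᴴ).trace.re := by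
  rw [informationRate, Finset.mul_sum, Finset.mul_sum, ← Finset.sum_sub_distrib]
  refine Finset.sum_le_sum fun k _ => ?_
  rw [← S.re_trace_jumpDefect c hN hX.1]
  set T := S.jumpDefect c N k
  set y := x * S.bias X k with hy
  have h := (Complex.nonneg_iff.1
    (hX.mul_mul_conjTranspose_same (T - (y : ℂ) • S.L k)).trace_nonneg).1
  rw [Matrix.conjTranspose_sub, Matrix.conjTranspose_smul] at h
  simp only [Matrix.sub_mul, Matrix.mul_sub, Matrix.smul_mul, Matrix.mul_smul, Matrix.trace_sub,
    Matrix.trace_smul, Complex.star_def, Complex.conj_ofReal, smul_eq_mul, Complex.sub_re,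
    Complex.re_ofReal_mul] at h
  have e : (S.L k * X * Tᴴ).trace.re = (T * X * (S.L k)ᴴ).trace.re := by
    have : (S.L k * X * Tᴴ)ᴴ = T * X * (S.L k)ᴴ := by
      simp only [Matrix.conjTranspose_mul, Matrix.conjTranspose_conjTranspose, hX.1.eq,
        Matrix.mul_assoc]
    rw [← this, Matrix.trace_conjTranspose]
    simp
  rw [e] at h
  change 0 ≤ _ - y * (_ - y * S.rate X k) at h
  rw [hy] at h
  linarith

/-- The Cramér–Rao inequality for the perturbed dynamics, in the form of a quadratic inequality. -/
theorem two_mul_response_sub_le_varCurrent {c : K → ℝ} (hc : ∀ k, c (S.rev k) = -c k) {τ : ℝ}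
    (hτ : 0 < τ) (hfull : ∀ t ∈ Set.Ioo 0 τ, (S.state t).PosDef) (x : ℝ) :
    2 * x * (S.meanCurrent c τ +
      ∫ t in (0 : ℝ)..τ, ∑ k, c k * S.rate (S.linearResponse S.state t) k) -
      x ^ 2 * ∫ t in (0 : ℝ)..τ, S.informationRate (S.state t) ≤ S.varCurrent c τ := by
  have hps := S.state_posSemidef hτ hfull
  have hB : (traceAdjoint (S.weightedJump c) (1 : Matrix n n ℂ)).IsHermitian := by
    rw [Matrix.IsHermitian, ← traceAdjoint_conjTranspose (S.weightedJump_conjTranspose c)]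
    simp
  obtain ⟨N, hNτ, hNh, hN⟩ := exists_backward_solution
    (T := traceAdjoint S.gen) (fun Z => traceAdjoint_conjTranspose S.gen_conjTranspose Z) hB τ
  have hNc : Continuous N := continuous_iff_continuousAt.2 fun t => (hN t).continuousAt
  have hi1 : IntervalIntegrable (fun t => ∑ k, S.bias (S.state t) k *
      (c k * S.rate (S.state t) k)) MeasureTheory.volume 0 τ :=
    S.intervalIntegrable_sum_bias_mul hτ.le hps fun k => (S.continuous_rate_state k).const_mul _
  have hi2 : IntervalIntegrable (fun t => ∑ k, S.bias (S.state t) k *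
      (N t * S.dissipator k (S.state t)).trace.re) MeasureTheory.volume 0 τ :=
    S.intervalIntegrable_sum_bias_mul hτ.le hps fun k =>
      continuous_trace_re.comp (hNc.mul ((realCLM (S.dissipator k)).continuous.comp S.continuous_state))
  have hi3 := S.intervalIntegrable_informationRate hτ.le hps
  have hmean : S.meanCurrent c τ = ∫ t in (0 : ℝ)..τ, ∑ k, S.bias (S.state t) k *
      (c k * S.rate (S.state t) k) := by
    rw [S.meanCurrent_eq_integral c hτ]
    refine intervalIntegral.integral_congr fun t ht => ?_
    rw [Set.uIcc_of_le hτ.le] at ht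
    exact S.sum_mul_rate_eq hc (hps t ht)
  have hint := ((hi1.add hi2).const_mul (2 * x)).sub (hi3.const_mul (x ^ 2))
  have h := S.integral_defect_le c hτ.le hNτ hNh hN
    (fun t ht => by rw [S.moments_fst_eq_state c ht.1]; exact hps t ht)
    ((intervalIntegrable_iff_integrableOn_Icc_of_le hτ.le).1 hint) (fun t ht => ?_)
  · rw [intervalIntegral.integral_sub ((hi1.add hi2).const_mul (2 * x)) (hi3.const_mul (x ^ 2)),
      intervalIntegral.integral_const_mul, intervalIntegral.integral_const_mul,
      intervalIntegral.integral_add hi1 hi2, ← hmean,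
      ← S.integral_response_eq c hτ hfull hNτ hN] at h
    rw [← S.meanCurrent_eq c hτ] at h
    rw [varCurrent, S.currentMoment_two_eq c hτ]
    exact h
  · rw [S.moments_fst_eq_state c ht.1.le]
    refine le_trans (le_of_eq ?_) (S.two_mul_sub_sq_le c (hNh t) (hfull t ht).posSemidef x)
    simp only [mul_add, Finset.sum_add_distrib]

/-- From `(c_k - x ℓ_k)² r_k ≥ 0` follows `2 x ⟨J⟩ ≤ ∫ ∑ c_k² r_k + x² I`. If `I = 0`, a function
linear in `x` is bounded above, so `⟨J⟩ = 0`. -/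
theorem integral_informationRate_pos {c : K → ℝ} (hc : ∀ k, c (S.rev k) = -c k) {τ : ℝ}
    (hτ : 0 < τ) (hps : ∀ t ∈ Set.Icc 0 τ, (S.state t).PosSemidef)
    (hJ : S.meanCurrent c τ ≠ 0) : 0 < ∫ t in (0 : ℝ)..τ, S.informationRate (S.state t) := by
  have hi := S.intervalIntegrable_informationRate hτ.le hps
  have hnn : 0 ≤ ∫ t in (0 : ℝ)..τ, S.informationRate (S.state t) :=
    intervalIntegral.integral_nonneg hτ.le fun t ht => S.informationRate_nonneg (hps t ht)
  refine lt_of_le_of_ne hnn fun h0 => hJ ?_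
  have hcont : ∀ c : K → ℝ, Continuous fun t => ∑ k, c k * S.rate (S.state t) k := fun c =>
    continuous_finsetSum _ fun k _ => (S.continuous_rate_state k).const_mul _
  have hbound : ∀ x : ℝ, 2 * x * S.meanCurrent c τ ≤
      ∫ t in (0 : ℝ)..τ, ∑ k, c k ^ 2 * S.rate (S.state t) k := by
    intro x
    have h2 := (hcont fun k => c k ^ 2).intervalIntegrable (μ := MeasureTheory.volume) 0 τ
    have h := intervalIntegral.integral_mono_on hτ.le
      (((hcont c).intervalIntegrable 0 τ).const_mul (2 * x)) (h2.add (hi.const_mul (x ^ 2)))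
      (fun t ht => ?_)
    · rw [intervalIntegral.integral_const_mul, ← S.meanCurrent_eq_integral c hτ,
        intervalIntegral.integral_add h2 (hi.const_mul _), intervalIntegral.integral_const_mul,
        ← h0, mul_zero, add_zero] at h
      exact h
    · rw [S.sum_mul_rate_eq hc (hps t ht), informationRate, Finset.mul_sum, Finset.mul_sum,
        ← Finset.sum_add_distrib]
      refine Finset.sum_le_sum fun k _ => ?_
      have := mul_nonneg (sq_nonneg (c k - x * S.bias (S.state t) k)) (S.rate_nonneg (hps t ht) k)
      linarith
  by_contra hJ
  set B := ∫ t in (0 : ℝ)..τ, ∑ k, c k ^ 2 * S.rate (S.state t) k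
  -- This `x` makes the left side `B + 1`, which exceeds the bound `B`.
  have h := hbound ((B + 1) / (2 * S.meanCurrent c τ))
  have e : 2 * ((B + 1) / (2 * S.meanCurrent c τ)) * S.meanCurrent c τ = B + 1 := by field_simp
  linarith

/-- The thermodynamic bound on the Fisher information. -/
theorem integral_informationRate_le {τ : ℝ} (hτ : 0 < τ)
    (hfull : ∀ t ∈ Set.Ioo 0 τ, (S.state t).PosDef) (hA : 0 < S.activity τ S.state)
    (hE : 0 < S.entropyProduction τ S.state) :
    ∫ t in (0 : ℝ)..τ, S.informationRate (S.state t) ≤ S.activity τ S.state *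
      Real.tanh (Phi (S.entropyProduction τ S.state / (2 * S.activity τ S.state))) ^ 2 := by
  set s := S.entropyProduction τ S.state / (2 * S.activity τ S.state) with hs
  have hs0 : 0 < s := div_pos hE (mul_pos two_pos hA)
  -- With the tangent point `Φ(s)`, the integrated correction is `m (Σ / 2 - s A)`, which is zero by
  -- the choice of `s`.
  obtain ⟨m, hm, h⟩ := exists_sq_div_add_le_tangent (Phi_pos hs0)
  have hc : Continuous fun t => ∑ k, S.rate (S.state t) k :=
    continuous_finsetSum _ fun k _ => S.continuous_rate_state k
  have hi1 := hc.intervalIntegrable (μ := MeasureTheory.volume) 0 τ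
  have hi2 := S.intervalIntegrable_entropyProductionRate hτ.le hfull
  have hi := S.intervalIntegrable_informationRate hτ.le (S.state_posSemidef hτ hfull)
  have hi3 := (hi2.const_mul (1 / 2)).sub (hi1.const_mul (Phi s * Real.tanh (Phi s)))
  have hmono := intervalIntegral.integral_mono_on_of_le_Ioo hτ.le hi
    ((hi1.const_mul (Real.tanh (Phi s) ^ 2)).add (hi3.const_mul m))
    (fun t ht => S.informationRate_le_tangent hm h (hfull t ht))
  refine hmono.trans_eq ?_
  rw [intervalIntegral.integral_add (hi1.const_mul _) (hi3.const_mul _),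
    intervalIntegral.integral_const_mul, intervalIntegral.integral_const_mul,
    intervalIntegral.integral_sub (hi2.const_mul _) (hi1.const_mul _),
    intervalIntegral.integral_const_mul, intervalIntegral.integral_const_mul,
    ← S.entropyProduction_eq hτ hfull, Phi_mul_tanh_Phi hs0.le]
  change _ * S.activity τ S.state + m * (_ - s * S.activity τ S.state) = _
  rw [hs]
  field_simp
  ring

theorem isEvolution_state (τ : ℝ) : S.IsEvolution τ S.state :=
  ⟨flow_zero _ _, fun t _ => (S.hasDerivAt_state t).hasDerivWithinAt⟩

theorem activity_congr {τ : ℝ} (hτ : 0 ≤ τ) {ρ σ : ℝ → Matrix n n ℂ}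
    (h : ∀ t ∈ Set.Icc 0 τ, ρ t = σ t) : S.activity τ ρ = S.activity τ σ :=
  intervalIntegral.integral_congr fun t ht => by
    rw [Set.uIcc_of_le hτ] at ht
    simp only [h t ht]

theorem entropyProduction_congr {τ : ℝ} (hτ : 0 ≤ τ) {ρ σ : ℝ → Matrix n n ℂ}
    (h : ∀ t ∈ Set.Icc 0 τ, ρ t = σ t) : S.entropyProduction τ ρ = S.entropyProduction τ σ := by
  have h1 : ∫ t in (0 : ℝ)..τ, ∑ k, S.Δs k * S.rate (ρ t) k =
      ∫ t in (0 : ℝ)..τ, ∑ k, S.Δs k * S.rate (σ t) k :=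
    intervalIntegral.integral_congr fun t ht => by
      rw [Set.uIcc_of_le hτ] at ht
      simp only [h t ht]
  have h2 : ∫ t in (0 : ℝ)..τ, S.mutualInfoRate (ρ t) =
      ∫ t in (0 : ℝ)..τ, S.mutualInfoRate (σ t) :=
    intervalIntegral.integral_congr fun t ht => by
      rw [Set.uIcc_of_le hτ] at ht
      simp only [h t ht]
  rw [entropyProduction, entropyProduction, totalEntropyProduction, totalEntropyProduction,
    h τ ⟨hτ, le_rfl⟩, h 0 ⟨le_rfl, hτ⟩, h1, h2]

theorem differentiableAt_perturbed {τ : ℝ} {ρp : ℝ → ℝ → Matrix n n ℂ}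
    (hps : ∀ t ∈ Set.Icc 0 τ, (S.state t).PosSemidef)
    (hρp : ∀ θ ∈ Set.Ioo (-1 : ℝ) 1, S.IsPerturbedEvolution τ S.state θ (ρp θ))
    {t : ℝ} (ht : t ∈ Set.Icc 0 τ) :
    DifferentiableAt ℝ (fun θ => ρp θ t) 0 :=
  (S.hasDerivAt_perturbed (S.isEvolution_state τ) hps hρp ht).differentiableAt

theorem response_eq {τ : ℝ} {ρp : ℝ → ℝ → Matrix n n ℂ}
    (hps : ∀ t ∈ Set.Icc 0 τ, (S.state t).PosSemidef)
    (hρp : ∀ θ ∈ Set.Ioo (-1 : ℝ) 1, S.IsPerturbedEvolution τ S.state θ (ρp θ))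
    {t : ℝ} (ht : t ∈ Set.Icc 0 τ) :
    response ρp t = S.linearResponse S.state t :=
  (S.hasDerivAt_perturbed (S.isEvolution_state τ) hps hρp ht).deriv

theorem intervalIntegrable_sum_mul_rate_response {τ : ℝ} {ρp : ℝ → ℝ → Matrix n n ℂ}
    (hps : ∀ t ∈ Set.Icc 0 τ, (S.state t).PosSemidef)
    (hρp : ∀ θ ∈ Set.Ioo (-1 : ℝ) 1, S.IsPerturbedEvolution τ S.state θ (ρp θ))
    (hτ : 0 ≤ τ) (c : K → ℝ) :
    IntervalIntegrable (fun t => ∑ k, c k * S.rate (response ρp t) k)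
      MeasureTheory.volume 0 τ := by
  have hφ := S.continuousOn_linearResponse hτ S.continuous_state.continuousOn hps
  refine ContinuousOn.intervalIntegrable_of_Icc hτ ?_
  have h : ContinuousOn (fun t => ∑ k, c k * S.rate (S.linearResponse S.state t) k)
      (Set.Icc 0 τ) :=
    continuousOn_finsetSum _ fun k _ =>
      ((S.continuous_rate k).comp_continuousOn hφ).const_mul (c k)
  exact h.congr fun t ht => by simp only [S.response_eq hps hρp ht]

end FeedbackSystem

/-! ### The uncertainty relation. -/

theorem uncertainty_arith {V J δ A E Φ I T : ℝ} (hJ : J ≠ 0) (hA : 0 < A) (hE : 0 < E) (hI : 0 < I)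
    (hΦ : 0 < Φ) (hT : Φ * T = E / (2 * A)) (hIle : I ≤ A * T ^ 2)
    (hV : ∀ x : ℝ, 2 * x * ((1 + δ) * J) - x ^ 2 * I ≤ V) :
    (1 + δ) ^ 2 * (4 * A / E ^ 2) * Φ ^ 2 ≤ V / J ^ 2 := by
  have h1 : ((1 + δ) * J) ^ 2 / I ≤ V := by
    -- The maximiser of the quadratic in `x`.
    have h := hV ((1 + δ) * J / I)
    refine le_trans (le_of_eq ?_) h
    field_simp
    ring
  have hT' : T = E / (2 * A * Φ) := by
    field_simp at hT ⊢
    linarith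
  rw [hT'] at hIle
  have h2 : 4 * A / E ^ 2 * Φ ^ 2 ≤ 1 / I := by
    rw [le_div_iff₀ hI]
    calc 4 * A / E ^ 2 * Φ ^ 2 * I ≤ 4 * A / E ^ 2 * Φ ^ 2 * (A * (E / (2 * A * Φ)) ^ 2) :=
          mul_le_mul_of_nonneg_left hIle (by positivity)
      _ = 1 := by field_simp; norm_num
  rw [le_div_iff₀ (by positivity)]
  calc (1 + δ) ^ 2 * (4 * A / E ^ 2) * Φ ^ 2 * J ^ 2
      = ((1 + δ) * J) ^ 2 * (4 * A / E ^ 2 * Φ ^ 2) := by ring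
    _ ≤ ((1 + δ) * J) ^ 2 * (1 / I) := mul_le_mul_of_nonneg_left h2 (sq_nonneg _)
    _ = ((1 + δ) * J) ^ 2 / I := by ring
    _ ≤ V := h1

end

theorem mainTheorem1 {n K : Type*} [Fintype n] [DecidableEq n] [Fintype K]
    (S : FeedbackSystem n K)
    (c : K → ℝ) (hc : ∀ k, c (S.rev k) = -c k)
    (τ : ℝ) (hτ : 0 < τ)
    (ρ : ℝ → Matrix n n ℂ) (hρ : S.IsEvolution τ ρ)
    (hfull : ∀ t ∈ Set.Ioo 0 τ, (ρ t).PosDef)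
    (ρp : ℝ → ℝ → Matrix n n ℂ)
    (hρp : ∀ θ ∈ Set.Ioo (-1 : ℝ) 1, S.IsPerturbedEvolution τ ρ θ (ρp θ)) :
    -- the quantities defined by limits, derivatives and integrals are well defined
    (Tendsto (S.discreteMoment c τ 1) atTop (𝓝 (S.meanCurrent c τ)) ∧
      Tendsto (S.discreteMoment c τ 2) atTop (𝓝 (S.currentMoment c τ 2)) ∧
      (∀ t ∈ Set.Ioo 0 τ, Tendsto (fun h => S.mutualInfoChange (ρ t) h / h) (𝓝[>] 0)
        (𝓝 (S.mutualInfoRate (ρ t)))) ∧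
      IntervalIntegrable (fun t => S.mutualInfoRate (ρ t)) MeasureTheory.volume 0 τ ∧
      (∀ t ∈ Set.Icc 0 τ, DifferentiableAt ℝ (fun θ => ρp θ t) 0) ∧
      IntervalIntegrable (fun t => ∑ k, c k * S.rate (FeedbackSystem.response ρp t) k)
        MeasureTheory.volume 0 τ) ∧
    -- the uncertainty relation
    (S.meanCurrent c τ ≠ 0 →
      0 < S.activity τ ρ ∧
      0 < S.entropyProduction τ ρ ∧
      S.varCurrent c τ / S.meanCurrent c τ ^ 2 ≥
        (1 + S.correction c τ ρp) ^ 2 *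
          (4 * S.activity τ ρ / S.entropyProduction τ ρ ^ 2) *
          Phi (S.entropyProduction τ ρ / (2 * S.activity τ ρ)) ^ 2 ∧
      (1 + S.correction c τ ρp) ^ 2 *
          (4 * S.activity τ ρ / S.entropyProduction τ ρ ^ 2) *
          Phi (S.entropyProduction τ ρ / (2 * S.activity τ ρ)) ^ 2 ≥
        2 * (1 + S.correction c τ ρp) ^ 2 / S.entropyProduction τ ρ) := by
  have heq : ∀ t ∈ Set.Icc 0 τ, ρ t = S.state t := fun t ht => hρ.eq_state ht
  have hfull' : ∀ t ∈ Set.Ioo 0 τ, (S.state t).PosDef := fun t ht => by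
    rw [← heq t ⟨ht.1.le, ht.2.le⟩]; exact hfull t ht
  have hps := S.state_posSemidef hτ hfull'
  have hρp' : ∀ θ ∈ Set.Ioo (-1 : ℝ) 1, S.IsPerturbedEvolution τ S.state θ (ρp θ) :=
    fun θ hθ => ⟨(hρp θ hθ).1, fun t ht => by rw [← heq t ht]; exact (hρp θ hθ).2 t ht⟩
  refine ⟨⟨?_, ?_, fun t ht => ?_, ?_, fun t ht => S.differentiableAt_perturbed hps hρp' ht,
    S.intervalIntegrable_sum_mul_rate_response hps hρp' hτ.le c⟩, fun hJ => ?_⟩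
  · rw [S.meanCurrent_eq c hτ]; exact S.tendsto_discreteMoment_one c hτ
  · rw [S.currentMoment_two_eq c hτ]; exact S.tendsto_discreteMoment_two c hτ
  · rw [S.mutualInfoRate_eq (hfull t ht)]; exact S.tendsto_mutualInfoChange (hfull t ht)
  · refine (S.intervalIntegrable_mutualInfoRate hτ.le hfull').congr fun t ht => ?_
    rw [Set.uIoc_of_le hτ.le] at ht
    simp only [heq t ⟨ht.1.le, ht.2⟩]
  · rw [S.activity_congr hτ.le heq, S.entropyProduction_congr hτ.le heq]
    have hI := S.integral_informationRate_pos hc hτ hps hJ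
    have hi := S.intervalIntegrable_informationRate hτ.le hps
    have hcont : Continuous fun t => ∑ k, S.rate (S.state t) k :=
      continuous_finsetSum _ fun k _ => S.continuous_rate_state k
    have hA : 0 < S.activity τ S.state :=
      hI.trans_le (intervalIntegral.integral_mono_on hτ.le hi (hcont.intervalIntegrable _ _)
        fun t ht => S.informationRate_le (hps t ht))
    have hE : 0 < S.entropyProduction τ S.state := by
      have h := intervalIntegral.integral_mono_on_of_le_Ioo hτ.le (hi.const_mul 2)
        (S.intervalIntegrable_entropyProductionRate hτ.le hfull')
        (fun t ht => S.two_mul_informationRate_le (hfull' t ht))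
      rw [intervalIntegral.integral_const_mul, ← S.entropyProduction_eq hτ hfull'] at h
      linarith
    have hs : 0 < S.entropyProduction τ S.state / (2 * S.activity τ S.state) :=
      div_pos hE (mul_pos two_pos hA)
    refine ⟨hA, hE, ?_, ?_⟩
    · refine uncertainty_arith hJ hA hE hI (Phi_pos hs) (Phi_mul_tanh_Phi hs.le)
        (S.integral_informationRate_le hτ hfull' hA hE) fun x => ?_
      have hcorr : (1 + S.correction c τ ρp) * S.meanCurrent c τ = S.meanCurrent c τ +
          ∫ t in (0 : ℝ)..τ, ∑ k, c k * S.rate (S.linearResponse S.state t) k := by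
        rw [FeedbackSystem.correction, add_mul, one_mul, div_mul_cancel₀ _ hJ]
        congr 1
        refine intervalIntegral.integral_congr fun t ht => ?_
        rw [Set.uIcc_of_le hτ.le] at ht
        simp only [S.response_eq hps hρp' ht]
      rw [hcorr]
      exact S.two_mul_response_sub_le_varCurrent hc hτ hfull' x
    -- With `s = Σ / (2A)`, `Φ(s)² ≥ s` and `(4A / Σ²) s = 2 / Σ`.
    · have h := mul_le_mul_of_nonneg_left (le_Phi_sq hs.le) (by positivity :
        0 ≤ (1 + S.correction c τ ρp) ^ 2 *
          (4 * S.activity τ S.state / S.entropyProduction τ S.state ^ 2))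
      refine le_trans (le_of_eq ?_) h
      field_simp
      ring
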